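/- **Setting.** There are $K$ arms. For each arm $k$ a function $\mu_k:\Theta\to\mathbb R$ on an arbitrary set $\Theta$ is known, and the true parameter is $\theta^*\in\Theta$. The successive rewards of arm $k$ are i.i.d. with mean $\mu_k(\theta^*)$ and sub-Gaussian with variance proxy $\sigma^2>0$, and the rewards of different arms are independent. Let $k^*$ be the unique optimal arm, $\Delta_k=\mu_{k^*}(\theta^*)-\mu_k(\theta^*)$ and $\Delta_{\min}=\min_{k\ne k^*}\Delta_k>0$. Arm $k$ is *non-competitive* if for some $\epsilon>0$ one has $\mu_k(\theta)<\max_\ell\mu_\ell(\theta)$ for all $\theta$ with $|\mu_{k^*}(\theta^*)-\mu_{k^*}(\theta)|<\epsilon$; the largest such $\epsilon\in(0,\infty]$ is its degree of non-competitiveness $\epsilon_k$. **Algorithms.** Let $n_k(t)$ be the number of pulls of arm $k$ in the first $t$ rounds and $\hat\mu_k(t)$ the empirical mean of its rewards. In round $t+1$ (for $t\ge 0$), let $$\hat\Theta_t=\Big\{\theta:\ |\mu_k(\theta)-\hat\mu_k(t)|<\sqrt{2\alpha\sigma^2\log t/n_k(t)}\ \text{ for all } k\Big\},$$ where $\alpha>0$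 and an arm with $n_k(t)=0$ imposes no constraint. Let $\mathcal C_t$ be the set of arms $k$ with $\mu_k(\theta)=\max_\ell\mu_\ell(\theta)$ for some $\theta\in\hat\Theta_t$, or the set of all arms if $\hat\Theta_t=\emptyset$. UCB-C pulls an arm of $\mathcal C_t$ that maximizes $\hat\mu_k(t)+\sqrt{2\alpha\sigma^2\log t/n_k(t)}$. TS-C pulls an arm of $\mathcal C_t$ that maximizes $S_{k,t}$, where the $S_{k,t}\sim\mathcal N(\hat\mu_k(t),\beta\sigma^2/n_k(t))$ are drawn independently given the past. In both algorithms the index of an arm with $n_k(t)=0$ is $+\infty$. **Theorem.** Let arm $k$ be non-competitive and $\alpha>0$. (i) For UCB-C and every horizon $T$, $$\mathbb E[n_k(T)]\le Kt_0+\sum_{t=1}^{T}2Kt^{1-\alpha}+K^3\sum_{t=Kt_0}^{T}6\Big(\frac tK\Big)^{2-\alpha},$$ where $t_0$ is the least integer $\tau\ge 2$ such that $\Delta_{\min}$ and $\epsilon_k$ are both at least $4\sqrt{K\alpha\sigma^2\log\tau/\tau}$. If $\alpha>3$, the right-hand side, and hence $\mathbb E[n_k(T)]$, is $O(1)$ as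 $T\to\infty$. (ii) For TS-C with $\beta>1$ and every horizon $T$, $$\mathbb E[n_k(T)]\le Kt_b+\sum_{t=1}^{T}2Kt^{1-\alpha}+K^3\sum_{t=Kt_b}^{T}4\Big(\frac tK\Big)^{2-\alpha}+K^2\sum_{t=Kt_b}^{T}\Big(\frac tK\Big)^{1-2\beta},$$ where $t_b$ is the least integer $\tau\ge\exp(11\beta\sigma^2)$ such that $\Delta_{\min}$ and $\epsilon_k$ are both at least $3\sqrt{3K\alpha\sigma^2\log\tau/\tau}$. If $\alpha>3$, the right-hand side, and hence $\mathbb E[n_k(T)]$, is $O(1)$ as $T\to\infty$. -/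

import Mathlib

open MeasureTheory ProbabilityTheory Filter Asymptotics

noncomputable section

namespace StructuredBandit

/-! ### Structured bandits: arms `Fin K`, known mean-reward functions `μ k : Θ → ℝ` -/

/-- Arm `k` is optimal under the parameter `θ`: `μ_k(θ) = max_ℓ μ_ℓ(θ)`. -/
def IsOptimal {Θ : Type*} {K : ℕ} (μ : Fin K → Θ → ℝ) (θ : Θ) (k : Fin K) : Prop :=
  ∀ l, μ l θ ≤ μ k θ

/-- Arm `k` is non-competitive (true parameter `θs`, optimal arm `ks`): for some `ε > 0` it is
not optimal for any `θ` with `|μ_{ks}(θs) - μ_{ks}(θ)| < ε`. -/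
def NonCompetitive {Θ : Type*} {K : ℕ} (μ : Fin K → Θ → ℝ) (θs : Θ) (ks k : Fin K) : Prop :=
  ∃ ε : ℝ, 0 < ε ∧ ∀ θ, |μ ks θs - μ ks θ| < ε → ¬ IsOptimal μ θ k

/-- The degree of non-competitiveness `ε_k`: the largest `ε` such that arm `k` is not optimal for
any `θ` with `|μ_{ks}(θs) - μ_{ks}(θ)| < ε`. It is `∞` if arm `k` is optimal for no `θ`. -/
def degree {Θ : Type*} {K : ℕ} (μ : Fin K → Θ → ℝ) (θs : Θ) (ks k : Fin K) : ENNReal :=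
  sSup {ε : ENNReal | ∀ θ, ENNReal.ofReal |μ ks θs - μ ks θ| < ε → ¬ IsOptimal μ θ k}

/-- The smallest sub-optimality gap `Δ_min`, the minimum of `μ_{ks}(θs) - μ_l(θs)` over the arms
`l` other than the optimal arm `ks`. -/
def gapMin {Θ : Type*} {K : ℕ} (μ : Fin K → Θ → ℝ) (θs : Θ) (ks : Fin K) : ℝ :=
  ⨅ l : {l : Fin K // l ≠ ks}, (μ ks θs - μ l.1 θs)

/-! ### Rewards -/

/-- `X k i` is the reward that arm `k` gives when it is pulled for the `(i+1)`-st time. The rewards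
are independent, identically distributed for each arm, with mean `m k`, and sub-Gaussian with
variance proxy `σ ^ 2`. -/
structure IsRewardTable {Ω : Type*} [MeasurableSpace Ω] {K : ℕ} (P : Measure Ω)
    (X : Fin K → ℕ → Ω → ℝ) (m : Fin K → ℝ) (σ : ℝ) : Prop where
  measurable : ∀ k i, Measurable (X k i)
  indep : iIndepFun (fun p : Fin K × ℕ => X p.1 p.2) P
  identDistrib : ∀ k i, IdentDistrib (X k i) (X k 0) P P
  integrable : ∀ k, Integrable (X k 0) P
  mean : ∀ k, ∫ ω, X k 0 ω ∂P = m k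
  subgaussian : ∀ k, HasSubgaussianMGF (fun ω => X k 0 ω - m k) (Real.toNNReal (σ ^ 2)) P

/-! ### Histories

`arm t ω` is the arm pulled in round `t + 1`, for `t = 0, 1, 2, …`. -/

/-- `n_k(t)`: the number of pulls of arm `k` in the first `t` rounds. -/
def pulls {Ω : Type*} {K : ℕ} (arm : ℕ → Ω → Fin K) (k : Fin K) (t : ℕ) (ω : Ω) : ℕ :=
  ((Finset.range t).filter (fun s => arm s ω = k)).card

/-- The empirical mean of the rewards from arm `k` in the first `t` rounds
(only used when arm `k` has been pulled). -/
def empMean {Ω : Type*} {K : ℕ} (X : Fin K → ℕ → Ω → ℝ) (arm : ℕ → Ω → Fin K)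
    (k : Fin K) (t : ℕ) (ω : Ω) : ℝ :=
  (∑ i ∈ Finset.range (pulls arm k t ω), X k i ω) / (pulls arm k t ω : ℝ)

/-- The width `√(2 α σ² log t / n)` of the confidence interval of an arm pulled `n ≥ 1` times in
the first `t` rounds. -/
def width (α σ : ℝ) (t n : ℕ) : ℝ :=
  Real.sqrt (2 * α * σ ^ 2 * Real.log t / n)

/-- The confidence set after `t` rounds. An arm that has not been pulled has an infinite
confidence width, so it imposes no constraint. -/
def confSet {Θ Ω : Type*} {K : ℕ} (μ : Fin K → Θ → ℝ) (α σ : ℝ) (X : Fin K → ℕ → Ω → ℝ)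
    (arm : ℕ → Ω → Fin K) (t : ℕ) (ω : Ω) : Set Θ :=
  {θ | ∀ k, 0 < pulls arm k t ω →
    |μ k θ - empMean X arm k t ω| < width α σ t (pulls arm k t ω)}

/-- The set `C_t` of arms that are competitive with respect to the confidence set: the arms that
are optimal for some `θ` in it, and all arms if it is empty. -/
def competitiveSet {Θ Ω : Type*} {K : ℕ} (μ : Fin K → Θ → ℝ) (α σ : ℝ)
    (X : Fin K → ℕ → Ω → ℝ) (arm : ℕ → Ω → Fin K) (t : ℕ) (ω : Ω) : Set (Fin K) :=
  {k | confSet μ α σ X arm t ω = ∅ ∨ ∃ θ ∈ confSet μ α σ X arm t ω, IsOptimal μ θ k}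

/-! ### UCB-C and TS-C -/

/-- The UCB index after `t` rounds; it is `+∞` for an arm that has not been pulled. -/
def ucbIndex {Ω : Type*} {K : ℕ} (α σ : ℝ) (X : Fin K → ℕ → Ω → ℝ)
    (arm : ℕ → Ω → Fin K) (k : Fin K) (t : ℕ) (ω : Ω) : EReal :=
  if pulls arm k t ω = 0 then ⊤
  else ((empMean X arm k t ω + width α σ t (pulls arm k t ω) : ℝ) : EReal)

/-- The arms are chosen by UCB-C: every round pulls an arm of largest UCB index among the arms of
`C_t`. Ties are broken in an arbitrary measurable way. -/
structure IsUCBC {Θ Ω : Type*} [MeasurableSpace Ω] {K : ℕ} (μ : Fin K → Θ → ℝ) (α σ : ℝ)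
    (X : Fin K → ℕ → Ω → ℝ) (arm : ℕ → Ω → Fin K) : Prop where
  measurable : ∀ t, Measurable (arm t)
  mem : ∀ t ω, arm t ω ∈ competitiveSet μ α σ X arm t ω
  argmax : ∀ t ω, ∀ l ∈ competitiveSet μ α σ X arm t ω,
    ucbIndex α σ X arm l t ω ≤ ucbIndex α σ X arm (arm t ω) t ω

/-- The Thompson sample `S_{k,t} = μ̂_k(t) + √(β σ² / n_k(t)) · G_{t,k}`. For a standard Gaussian
`G_{t,k}` independent of the past it has the law `N(μ̂_k(t), β σ² / n_k(t))` given the past. For an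
arm that has not been pulled (infinite variance) it is `+∞`, so that such an arm, if it is in `C_t`,
is tried before the arms already pulled. -/
def tsSample {Ω : Type*} {K : ℕ} (β σ : ℝ) (X : Fin K → ℕ → Ω → ℝ) (G : ℕ → Fin K → Ω → ℝ)
    (arm : ℕ → Ω → Fin K) (k : Fin K) (t : ℕ) (ω : Ω) : EReal :=
  if pulls arm k t ω = 0 then ⊤
  else ((empMean X arm k t ω +
    Real.sqrt (β * σ ^ 2 / (pulls arm k t ω : ℝ)) * G t k ω : ℝ) : EReal)

/-- The arms are chosen by TS-C: every round pulls an arm of largest Thompson sample among the arms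
of `C_t`. The Gaussian variables of a round are i.i.d. standard and independent of the rewards
and of the Gaussian variables and choices of all earlier rounds. -/
structure IsTSC {Θ Ω : Type*} [MeasurableSpace Ω] {K : ℕ} (P : Measure Ω) (μ : Fin K → Θ → ℝ)
    (α β σ : ℝ) (X : Fin K → ℕ → Ω → ℝ) (G : ℕ → Fin K → Ω → ℝ) (arm : ℕ → Ω → Fin K) :
    Prop where
  measurable : ∀ t, Measurable (arm t)
  measurable_gauss : ∀ t k, Measurable (G t k)
  gauss : ∀ t k, P.map (G t k) = gaussianReal 0 1
  indep_arms : ∀ t, iIndepFun (G t) P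
  indep_past : ∀ t, IndepFun (fun ω k => G t k ω)
    (fun ω => ((fun (k : Fin K) (i : ℕ) => X k i ω),
      (fun s : Fin t => (arm s ω, fun k : Fin K => G s k ω)))) P
  mem : ∀ t ω, arm t ω ∈ competitiveSet μ α σ X arm t ω
  argmax : ∀ t ω, ∀ l ∈ competitiveSet μ α σ X arm t ω,
    tsSample β σ X G arm l t ω ≤ tsSample β σ X G arm (arm t ω) t ω

/-! ### The bounds -/

/-- `t_0`: the least integer `τ ≥ 2` with `Δ_min, ε_k ≥ 4 √(K α σ² log τ / τ)`. -/
def tZero {Θ : Type*} {K : ℕ} (μ : Fin K → Θ → ℝ) (θs : Θ) (ks k : Fin K) (α σ : ℝ) : ℕ :=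
  sInf {τ : ℕ | 2 ≤ τ ∧
    4 * Real.sqrt (K * α * σ ^ 2 * Real.log τ / τ) ≤ gapMin μ θs ks ∧
    ENNReal.ofReal (4 * Real.sqrt (K * α * σ ^ 2 * Real.log τ / τ)) ≤ degree μ θs ks k}

/-- `t_b`: the least integer `τ ≥ exp(11 β σ²)` with `Δ_min, ε_k ≥ 3 √(3 K α σ² log τ / τ)`. -/
def tB {Θ : Type*} {K : ℕ} (μ : Fin K → Θ → ℝ) (θs : Θ) (ks k : Fin K) (α β σ : ℝ) : ℕ :=
  sInf {τ : ℕ | Real.exp (11 * β * σ ^ 2) ≤ τ ∧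
    3 * Real.sqrt (3 * (K * α * σ ^ 2 * Real.log τ / τ)) ≤ gapMin μ θs ks ∧
    ENNReal.ofReal (3 * Real.sqrt (3 * (K * α * σ ^ 2 * Real.log τ / τ))) ≤ degree μ θs ks k}

/-- The bound for UCB-C, as a function of `K`, `α`, `t_0` and the horizon `T`. -/
def ucbBound (K : ℕ) (α : ℝ) (t₀ T : ℕ) : ℝ :=
  K * t₀ + ∑ t ∈ Finset.Icc 1 T, 2 * K * (t : ℝ) ^ (1 - α)
    + (K : ℝ) ^ 3 * ∑ t ∈ Finset.Icc (K * t₀) T, 6 * ((t : ℝ) / K) ^ (2 - α)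

/-- The bound for TS-C, as a function of `K`, `α`, `β`, `t_b` and the horizon `T`. -/
def tsBound (K : ℕ) (α β : ℝ) (tb T : ℕ) : ℝ :=
  K * tb + ∑ t ∈ Finset.Icc 1 T, 2 * K * (t : ℝ) ^ (1 - α)
    + (K : ℝ) ^ 3 * ∑ t ∈ Finset.Icc (K * tb) T, 4 * ((t : ℝ) / K) ^ (2 - α)
    + (K : ℝ) ^ 2 * ∑ t ∈ Finset.Icc (K * tb) T, ((t : ℝ) / K) ^ (1 - 2 * β)

end StructuredBandit

end

/-! Both halves rest on the event that `θs` lies in the confidence set. A Chernoff bound, with a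
union bound over arms and possible pull counts, shows that it fails after `t` rounds with
probability at most `2 K t^(1-α)` (`measure_not_mem_confSet_le`). On this event the optimal arm `ks`
is competitive, while a non-competitive arm `k` can be competitive only if twice the width at `ks`
exceeds its degree (`lt_two_mul_width`). So a pull of `k` means that `ks` has been pulled too
rarely.

UCB-C. Let `t ≥ K t₀` and let the confidence sets after `⌊t/K⌋, …, t` rounds be correct. If `ks` has
its share `t/K` of the pulls, its interval is too narrow for `k` to be competitive. Otherwise some
`l ≠ ks` has more than its share. When `l` was pulled with count `⌊t/K⌋`, its index was at least
that of `ks`, hence above `μ ks θs`, so twice its width exceeded the gap, which is impossible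
(`IsUCBC.arm_ne`). Summing the failure probabilities gives the bound.

TS-C. Let `D` be the value to which the gap and the degree are compared, and `J` the pull count at
which the width equals `D / 2`. Given the past and the samples of the other arms, symmetries of the
two remaining Gaussians show that a pull of an arm `l` with many pulls is at most `ρ` times as
likely as a pull of `ks` (`IsTSC.measure_duel_le`, `IsTSC.measure_pull_le`). Here `ρ` is 1 or 2 plus
a miss cost: twice the inverse probability that the sample of `ks` exceeds `μ ks θs - D / 2`, due
only if the empirical mean of `ks` is below that level. Each pull count of `ks` belongs to at most
one pull, so the expected miss costs sum to at most a series over counts, which the sub-Gaussian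
moment bound keeps below `τ / 2` (`IsRewardTable.sum_lintegral_missCost_le`).

Time is then cut at `t i = 2^i · 4 K² τ²`. In the block after `t i`, a pull of `k` under a correct
confidence set requires fewer than `J (i + 1)` pulls of `ks`. If `ks` is still that rare at `t i`,
the other arms must have filled the preceding block, far beyond what can be charged to `ks`;
Markov's inequality makes this unlikely, up to wrong confidence sets
(`IsTSC.measure_pulls_best_lt_le`). As `J i` grows linearly in `i` and the blocks grow
geometrically, the total fits into `K τ + 2 K - 1` (`block_budget`), and the wrong confidence sets
are paid for by the sum of `4 K³ (t/K)^(2-α)`. For `α < 2` the summands of that sum are at least one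
and the bound is trivial. -/

namespace StructuredBandit

/-! ### Pull counts -/

section Counting

variable {Ω : Type*} {K : ℕ} {arm : ℕ → Ω → Fin K} {k l : Fin K} {s t T : ℕ} {ω : Ω}

lemma pulls_zero : pulls arm k 0 ω = 0 := by simp [pulls]

lemma pulls_succ :
    pulls arm k (t + 1) ω = pulls arm k t ω + if arm t ω = k then 1 else 0 := by
  unfold pulls
  rw [Finset.range_add_one, Finset.filter_insert]
  split_ifs with h
  · rw [Finset.card_insert_of_notMem (by simp)]
  · rfl

lemma pulls_mono (h : s ≤ t) : pulls arm k s ω ≤ pulls arm k t ω :=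
  Finset.card_le_card (Finset.filter_subset_filter _ (Finset.range_mono h))

lemma pulls_le : pulls arm k t ω ≤ t :=
  (Finset.card_filter_le _ _).trans_eq (Finset.card_range t)

lemma pulls_lt (hs : arm s ω = k) (hst : s < t) : pulls arm k s ω < pulls arm k t ω := by
  have h := pulls_succ (arm := arm) (k := k) (t := s) (ω := ω)
  have h2 := pulls_mono (arm := arm) (k := k) (ω := ω) (Nat.succ_le_of_lt hst)
  simp only [hs, if_true] at h
  simp only [Nat.succ_eq_add_one] at h2
  omega

lemma pulls_inj (hs : arm s ω = k) (ht : arm t ω = k)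
    (h : pulls arm k s ω = pulls arm k t ω) : s = t := by
  rcases lt_trichotomy s t with hst | hst | hst
  · exact absurd (pulls_lt hs hst) (by omega)
  · exact hst
  · exact absurd (pulls_lt ht hst) (by omega)

lemma sum_pulls (arm : ℕ → Ω → Fin K) (t : ℕ) (ω : Ω) : ∑ k, pulls arm k t ω = t := by
  unfold pulls
  rw [← Finset.card_eq_sum_card_fiberwise (f := fun s => arm s ω) (t := Finset.univ)
    (fun _ _ => by simp)]
  simp

/-- A count starts at zero and moves in unit steps, so it skips no value. This supplies the past
round in which an over-pulled arm is compared with the best one. -/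
lemma exists_pull {m : ℕ} (h : m < pulls arm l t ω) :
    ∃ s < t, arm s ω = l ∧ pulls arm l s ω = m := by
  induction t with
  | zero => simp [pulls] at h
  | succ t ih =>
    by_cases h' : m < pulls arm l t ω
    · obtain ⟨s, hs, h1, h2⟩ := ih h'
      exact ⟨s, by omega, h1, h2⟩
    · rw [pulls_succ] at h
      split_ifs at h with ha
      · exact ⟨t, by omega, ha, by omega⟩
      · omega

/-- The rounds in which arm `l` is pulled while its number of pulls lies in `[a, b)`. -/
lemma card_pulls_between (arm : ℕ → Ω → Fin K) (l : Fin K) (ω : Ω) (S : Finset ℕ) (a b : ℕ) :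
    (S.filter (fun s => arm s ω = l ∧ a ≤ pulls arm l s ω ∧ pulls arm l s ω < b)).card
      ≤ b - a := by
  rw [← Nat.card_Ico]
  refine Finset.card_le_card_of_injOn (fun s => pulls arm l s ω) ?_ ?_
  · intro s hs
    simp only [Finset.coe_filter, Set.mem_ofPred_eq] at hs
    simp [hs.2.2.1, hs.2.2.2]
  · intro s hs t ht hst
    simp only [Finset.coe_filter, Set.mem_ofPred_eq] at hs ht
    exact pulls_inj hs.2.1 ht.2.1 hst

end Counting

/-! ### Confidence widths -/

section Width

variable {α σ : ℝ}

lemma width_nonneg (α σ : ℝ) (t n : ℕ) : 0 ≤ width α σ t n := Real.sqrt_nonneg _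

lemma width_sq (hα : 0 ≤ α) (t n : ℕ) :
    width α σ t n ^ 2 = 2 * α * σ ^ 2 * Real.log t / n := by
  unfold width
  have := Real.log_natCast_nonneg t
  rw [Real.sq_sqrt (by positivity)]

lemma log_natCast_mono {s t : ℕ} (h : s ≤ t) : Real.log s ≤ Real.log t := by
  rcases Nat.eq_zero_or_pos s with rfl | hs
  · simpa using Real.log_natCast_nonneg t
  · exact Real.log_le_log (by exact_mod_cast hs) (by exact_mod_cast h)

lemma width_mono (hα : 0 ≤ α) {s t : ℕ} (h : s ≤ t) (n : ℕ) :
    width α σ s n ≤ width α σ t n := by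
  unfold width
  have := log_natCast_mono h
  gcongr

end Width

/-! ### Competitive arms, gap and degree -/

section Competitive

variable {Θ Ω : Type*} {K : ℕ} {μ : Fin K → Θ → ℝ} {θs : Θ} {ks k : Fin K} {α σ : ℝ}
  {X : Fin K → ℕ → Ω → ℝ} {arm : ℕ → Ω → Fin K} {t : ℕ} {ω : Ω}

/-- The best arm is competitive as soon as the true parameter is in the confidence set. -/
lemma best_mem_competitiveSet (hks : ∀ l, l ≠ ks → μ l θs < μ ks θs)
    (hg : θs ∈ confSet μ α σ X arm t ω) : ks ∈ competitiveSet μ α σ X arm t ω := by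
  refine Or.inr ⟨θs, hg, fun l => ?_⟩
  rcases eq_or_ne l ks with rfl | h
  · exact le_rfl
  · exact (hks l h).le

/-- The parameter `θs` itself is at distance zero, and `ks` is optimal there. -/
lemma NonCompetitive.ne (hks : ∀ l, l ≠ ks → μ l θs < μ ks θs)
    (hk : NonCompetitive μ θs ks k) : k ≠ ks := by
  rintro rfl
  obtain ⟨ε, hε, h⟩ := hk
  refine h θs (by simpa using hε) fun l => ?_
  rcases eq_or_ne l k with rfl | h
  · exact le_rfl
  · exact (hks l h).le

/-- A non-competitive arm can only be in the competitive set if the confidence interval of the best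
arm is wide compared with the degree of non-competitiveness. -/
lemma lt_two_mul_width {D : ℝ} (hD : ENNReal.ofReal D ≤ degree μ θs ks k)
    (hg : θs ∈ confSet μ α σ X arm t ω) (hk : k ∈ competitiveSet μ α σ X arm t ω)
    (hn : 0 < pulls arm ks t ω) : D < 2 * width α σ t (pulls arm ks t ω) := by
  -- The default "all arms" for an empty confidence set does not occur, since `θs` belongs to it.
  rcases hk with h | ⟨θ, hθ, hopt⟩
  · rw [h] at hg; exact hg.elim
  have h1 := abs_lt.1 (hg ks hn)
  have h2 := abs_lt.1 (hθ ks hn)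
  by_contra! hlt
  -- Both `μ ks θs` and `μ ks θ` are within one width of the same empirical mean.
  have h3 : |μ ks θs - μ ks θ| < D := by
    refine lt_of_lt_of_le ?_ hlt
    rw [abs_lt]; constructor <;> linarith
  have h4 : ENNReal.ofReal |μ ks θs - μ ks θ| < degree μ θs ks k :=
    lt_of_lt_of_le ((ENNReal.ofReal_lt_ofReal_iff ((abs_nonneg _).trans_lt h3)).2 h3) hD
  -- The degree is only a supremum; the strict inequality yields an admissible `ε` above the
  -- distance.
  obtain ⟨ε, hε, hlt'⟩ := lt_sSup_iff.1 h4
  exact hε θ hlt' hopt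

lemma gapMin_le {l : Fin K} (hl : l ≠ ks) : gapMin μ θs ks ≤ μ ks θs - μ l θs :=
  ciInf_le (f := fun l : {l : Fin K // l ≠ ks} => μ ks θs - μ l.1 θs)
    (Set.finite_range _).bddBelow ⟨l, hl⟩

lemma gapMin_pos (hks : ∀ l, l ≠ ks → μ l θs < μ ks θs) (hk : k ≠ ks) :
    0 < gapMin μ θs ks := by
  have : Nonempty {l : Fin K // l ≠ ks} := ⟨⟨k, hk⟩⟩
  obtain ⟨l, hl⟩ := exists_eq_ciInf_of_finite
    (f := fun l : {l : Fin K // l ≠ ks} => μ ks θs - μ l.1 θs)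
  unfold gapMin
  rw [← hl]
  have := hks l.1 l.2
  linarith

lemma degree_pos (hk : NonCompetitive μ θs ks k) : 0 < degree μ θs ks k := by
  obtain ⟨ε, hε, h⟩ := hk
  refine lt_of_lt_of_le (ENNReal.ofReal_pos.2 hε) (le_sSup ?_)
  intro θ hθ
  exact h θ ((ENNReal.ofReal_lt_ofReal_iff hε).1 hθ)

lemma two_le_of_ne {k ks : Fin K} (hk : k ≠ ks) : 2 ≤ K := by
  have h1 := k.2
  have h2 := ks.2
  have : (k : ℕ) ≠ ks := fun h => hk (Fin.ext h)
  omega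

end Competitive

/-! ### Concentration of empirical means -/

section Concentration

variable {Θ Ω : Type*} [MeasurableSpace Ω] {P : Measure Ω} {K : ℕ}
  {X : Fin K → ℕ → Ω → ℝ} {m : Fin K → ℝ} {σ α : ℝ}

lemma IsRewardTable.hasSubgaussianMGF_sum (hX : IsRewardTable P X m σ) (k : Fin K) (n : ℕ) :
    HasSubgaussianMGF (fun ω => ∑ i ∈ Finset.range n, (X k i ω - m k))
      (∑ _i ∈ Finset.range n, Real.toNNReal (σ ^ 2)) P := by
  have h1 : iIndepFun (fun i => X k i) P :=
    hX.indep.precomp (g := fun i : ℕ => (k, i)) (fun i j h => by simpa using h)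
  have h2 : iIndepFun (fun i ω => X k i ω - m k) P :=
    h1.comp (fun _ x => x - m k) (fun _ => by fun_prop)
  refine HasSubgaussianMGF.sum_of_iIndepFun h2 fun i _ => ?_
  exact (hX.subgaussian k).congr_identDistrib
    ((hX.identDistrib k i).symm.comp (u := fun x => x - m k) (by fun_prop))

/-- The moment generating function of a centred empirical sum. -/
lemma IsRewardTable.mgf_sum_le (hX : IsRewardTable P X m σ) (k : Fin K) (n : ℕ) (u : ℝ) :
    Integrable (fun ω => Real.exp (u * ∑ i ∈ Finset.range n, (X k i ω - m k))) P ∧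
    ∫ ω, Real.exp (u * ∑ i ∈ Finset.range n, (X k i ω - m k)) ∂P
      ≤ Real.exp (n * σ ^ 2 * u ^ 2 / 2) := by
  have h := hX.hasSubgaussianMGF_sum k n
  refine ⟨h.integrable_exp_mul u, ?_⟩
  have := h.mgf_le u
  simpa [mgf, Real.coe_toNNReal _ (sq_nonneg σ)] using this

/-- The width is chosen so that the Chernoff exponent `(n w)² / (2 n σ²)` equals `α log t`. The
factor 2 counts the two tails. -/
lemma IsRewardTable.measure_width_le [IsProbabilityMeasure P] (hX : IsRewardTable P X m σ)
    (hσ : 0 < σ) (hα : 0 < α) (k : Fin K) {t n : ℕ} (ht : 0 < t) (hn : 0 < n) :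
    P.real {ω | width α σ t n ≤ |m k - (∑ i ∈ Finset.range n, X k i ω) / n|}
      ≤ 2 * (t : ℝ) ^ (-α) := by
  have hn' : (0 : ℝ) < n := by exact_mod_cast hn
  have ht' : (0 : ℝ) < t := by exact_mod_cast ht
  have hw := width_nonneg α σ t n
  have h := hX.hasSubgaussianMGF_sum k n
  have h1 := h.measure_ge_le (ε := n * width α σ t n) (by positivity)
  have h2 := h.neg.measure_ge_le (ε := n * width α σ t n) (by positivity)
  have hb : Real.exp (-(n * width α σ t n) ^ 2 /
      (2 * ((∑ _i ∈ Finset.range n, Real.toNNReal (σ ^ 2) : NNReal) : ℝ))) = (t : ℝ) ^ (-α) := by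
    rw [mul_pow, width_sq hα.le, Real.rpow_def_of_pos ht']
    congr 1
    simp only [Finset.sum_const, Finset.card_range, nsmul_eq_mul, NNReal.coe_mul,
      NNReal.coe_natCast, Real.coe_toNNReal _ (sq_nonneg σ)]
    field_simp
  rw [hb] at h1 h2
  have hsum : ∀ ω, ∑ i ∈ Finset.range n, (X k i ω - m k)
      = (∑ i ∈ Finset.range n, X k i ω) - n * m k := by
    intro ω; simp [Finset.sum_sub_distrib]
  refine (measureReal_mono (s₂ := {ω | n * width α σ t n ≤ ∑ i ∈ Finset.range n, (X k i ω - m k)} ∪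
    {ω | n * width α σ t n ≤ (-fun ω => ∑ i ∈ Finset.range n, (X k i ω - m k)) ω}) ?_
    (measure_ne_top _ _)).trans
    ((measureReal_union_le _ _).trans (by linarith))
  intro ω hω
  simp only [Set.mem_ofPred_eq, Set.mem_union, Pi.neg_apply, hsum] at hω ⊢
  have he : (∑ i ∈ Finset.range n, X k i ω) = n * ((∑ i ∈ Finset.range n, X k i ω) / n) := by
    field_simp
  rw [he]
  rcases le_abs.1 hω with h' | h'
  · right
    have := mul_le_mul_of_nonneg_left h' hn'.le
    linarith
  · left
    have := mul_le_mul_of_nonneg_left h' hn'.le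
    linarith

/-- The true parameter leaves the confidence set with small probability. -/
lemma measure_not_mem_confSet_le [IsProbabilityMeasure P] {μ : Fin K → Θ → ℝ} {θs : Θ}
    (hX : IsRewardTable P X (fun k => μ k θs) σ) (hσ : 0 < σ) (hα : 0 < α)
    (arm : ℕ → Ω → Fin K) {t : ℕ} (ht : 0 < t) :
    P.real {ω | θs ∉ confSet μ α σ X arm t ω} ≤ 2 * K * (t : ℝ) ^ (1 - α) := by
  have ht' : (0 : ℝ) < t := by exact_mod_cast ht
  -- The pull count is random and depends on the rewards, so the union runs over all its values up
  -- to `t`; this turns `t^(-α)` into `t^(1-α)`.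
  have hsub : {ω | θs ∉ confSet μ α σ X arm t ω} ⊆
      ⋃ k ∈ (Finset.univ : Finset (Fin K)), ⋃ n ∈ Finset.Icc 1 t,
        {ω | width α σ t n ≤ |μ k θs - (∑ i ∈ Finset.range n, X k i ω) / n|} := by
    intro ω hω
    simp only [confSet, Set.mem_ofPred_eq, not_forall, not_lt] at hω
    obtain ⟨k, hk, h⟩ := hω
    simp only [Finset.mem_univ, Set.iUnion_true, Set.mem_iUnion, Finset.mem_Icc]
    exact ⟨k, pulls arm k t ω, ⟨hk, pulls_le⟩, h⟩
  refine (measureReal_mono hsub (measure_ne_top _ _)).trans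
    ((measureReal_biUnion_finset_le _ _).trans ?_)
  have h1 : ∀ k ∈ (Finset.univ : Finset (Fin K)), P.real (⋃ n ∈ Finset.Icc 1 t,
        {ω | width α σ t n ≤ |μ k θs - (∑ i ∈ Finset.range n, X k i ω) / n|})
        ≤ t * (2 * (t : ℝ) ^ (-α)) := by
    intro k _
    refine (measureReal_biUnion_finset_le _ _).trans ?_
    refine (Finset.sum_le_sum (g := fun _ => 2 * (t : ℝ) ^ (-α)) fun n hn => ?_).trans ?_
    · exact hX.measure_width_le hσ hα k ht (by simp at hn; omega)
    · simp
  refine (Finset.sum_le_sum h1).trans ?_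
  rw [sub_eq_add_neg, Real.rpow_add ht', Real.rpow_one]
  simp only [Finset.sum_const, Finset.card_univ, Fintype.card_fin, nsmul_eq_mul]
  exact le_of_eq (by ring)

lemma measurable_pulls {arm : ℕ → Ω → Fin K} (harm : ∀ t, Measurable (arm t)) (k : Fin K)
    (t : ℕ) : Measurable (pulls arm k t) := by
  induction t with
  | zero =>
    have : pulls arm k 0 = fun _ => 0 := by ext; exact pulls_zero
    rw [this]
    exact measurable_const
  | succ t ih =>
    have : pulls arm k (t + 1) = fun ω => pulls arm k t ω + if arm t ω = k then 1 else 0 := by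
      ext ω; exact pulls_succ
    rw [this]
    exact ih.add (Measurable.ite (harm t (measurableSet_singleton k)) measurable_const
      measurable_const)

lemma integral_pulls [IsProbabilityMeasure P] {arm : ℕ → Ω → Fin K}
    (harm : ∀ t, Measurable (arm t)) (k : Fin K) (T : ℕ) :
    ∫ ω, (pulls arm k T ω : ℝ) ∂P = ∑ t ∈ Finset.range T, P.real {ω | arm t ω = k} := by
  have h : ∀ ω, (pulls arm k T ω : ℝ)
      = ∑ t ∈ Finset.range T, Set.indicator {ω | arm t ω = k} (fun _ => (1 : ℝ)) ω := by
    intro ω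
    simp [pulls, Set.indicator_apply, Finset.sum_boole]
  have hm : ∀ t, MeasurableSet {ω | arm t ω = k} := fun t => harm t (measurableSet_singleton k)
  simp_rw [h]
  rw [integral_finsetSum _ fun t _ => (integrable_const (1 : ℝ)).indicator (hm t)]
  refine Finset.sum_congr rfl fun t _ => ?_
  rw [integral_indicator (hm t)]
  simp

end Concentration

/-! ### Elementary estimates and bounded sums -/

section Analysis

/-- `log x / x` decreases only from `e` on. For `τ = 2` the comparison passes through 4, where `log
4 / 4 = log 2 / 2`; this is why `t ≥ 2 τ` is asked. -/
lemma log_div_self_le {τ t : ℕ} (hτ : 2 ≤ τ) (ht : 2 * τ ≤ t) :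
    Real.log t / t ≤ Real.log τ / τ := by
  have key : ∀ a b : ℕ, 3 ≤ a → a ≤ b → Real.log b / b ≤ Real.log a / a := by
    intro a b ha hab
    have he : Real.exp 1 ≤ a := Real.exp_one_lt_three.le.trans (by exact_mod_cast ha)
    have hab' : (a : ℝ) ≤ b := by exact_mod_cast hab
    exact Real.log_div_self_antitoneOn he (he.trans hab') hab'
  rcases Nat.lt_or_ge τ 3 with h | h
  · obtain rfl : τ = 2 := by omega
    have h4 := key 4 t (by norm_num) (by omega)
    have : Real.log ((4 : ℕ) : ℝ) = 2 * Real.log 2 := by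
      rw [show ((4 : ℕ) : ℝ) = 2 ^ 2 by norm_num, Real.log_pow]; norm_num
    rw [this] at h4
    push_cast at h4 ⊢
    linarith
  · exact key τ t h (by omega)

lemma tendsto_sqrt_log_div (c d : ℝ) :
    Tendsto (fun τ : ℕ => c * Real.sqrt (d * Real.log τ / τ)) atTop (nhds 0) := by
  have h1 : Tendsto (fun x : ℝ => Real.log x / x) atTop (nhds 0) := by
    simpa using Real.isLittleO_log_id_atTop.tendsto_div_nhds_zero
  have h2 := (h1.comp tendsto_natCast_atTop_atTop).const_mul d
  have h3 := ((Real.continuous_sqrt.tendsto _).comp h2).const_mul c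
  simp only [mul_zero, Real.sqrt_zero] at h3
  refine h3.congr fun τ => ?_
  simp [Function.comp, mul_div_assoc]

lemma exists_threshold {c d gap : ℝ} {ε : ENNReal} (hgap : 0 < gap) (hε : 0 < ε) :
    ∀ᶠ τ : ℕ in atTop, c * Real.sqrt (d * Real.log τ / τ) ≤ gap ∧
      ENNReal.ofReal (c * Real.sqrt (d * Real.log τ / τ)) ≤ ε := by
  have h := tendsto_sqrt_log_div c d
  have h2 : Tendsto (fun τ : ℕ => ENNReal.ofReal (c * Real.sqrt (d * Real.log τ / τ)))
      atTop (nhds 0) := by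
    simpa using ENNReal.tendsto_ofReal h
  filter_upwards [h.eventually_lt_const hgap, h2.eventually_lt_const hε] with τ h1 h2
  exact ⟨h1.le, h2.le⟩

/-- Grouping a sum into blocks of length `K`. -/
lemma sum_blocks_le {K a T : ℕ} (hK : 0 < K) {G : ℕ → ℝ} (hG : ∀ t, 0 ≤ G t) :
    ∑ t ∈ Finset.Ico (K * a) T, G (K * (t / K)) ≤ K * ∑ t ∈ Finset.Icc (K * a) T, G t := by
  have hmaps : ∀ t ∈ Finset.Ico (K * a) T, K * (t / K) ∈ Finset.Icc (K * a) T := by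
    intro t ht
    rw [Finset.mem_Ico] at ht
    rw [Finset.mem_Icc]
    refine ⟨Nat.mul_le_mul_left K ((Nat.le_div_iff_mul_le hK).2 (by rw [mul_comm]; exact ht.1)), ?_⟩
    exact (Nat.mul_div_le t K).trans ht.2.le
  rw [← Finset.sum_fiberwise_of_maps_to hmaps, Finset.mul_sum]
  refine Finset.sum_le_sum fun u _ => ?_
  have h1 : ∑ t ∈ (Finset.Ico (K * a) T).filter (fun t => K * (t / K) = u), G (K * (t / K))
      = ∑ t ∈ (Finset.Ico (K * a) T).filter (fun t => K * (t / K) = u), G u := by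
    refine Finset.sum_congr rfl fun t ht => ?_
    rw [(Finset.mem_filter.1 ht).2]
  rw [h1, Finset.sum_const, nsmul_eq_mul]
  refine mul_le_mul_of_nonneg_right ?_ (hG u)
  have hsub : (Finset.Ico (K * a) T).filter (fun t => K * (t / K) = u) ⊆
      Finset.Ico u (u + K) := by
    intro t ht
    have := (Finset.mem_filter.1 ht).2
    have h2 := Nat.div_add_mod t K
    have h3 := Nat.mod_lt t hK
    rw [Finset.mem_Ico]
    omega
  exact_mod_cast (Finset.card_le_card hsub).trans (by simp)

lemma sum_rpow_le_tsum {p : ℝ} (hp : p < -1) (S : Finset ℕ) :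
    ∑ t ∈ S, (t : ℝ) ^ p ≤ ∑' t : ℕ, (t : ℝ) ^ p :=
  (Real.summable_nat_rpow.2 hp).sum_le_tsum _ fun t _ => by positivity

lemma sum_div_rpow_le {p : ℝ} (hp : p < -1) (K : ℕ) (S : Finset ℕ) :
    ∑ t ∈ S, ((t : ℝ) / K) ^ p ≤ (∑' t : ℕ, (t : ℝ) ^ p) / (K : ℝ) ^ p := by
  have : ∀ t ∈ S, ((t : ℝ) / K) ^ p = (t : ℝ) ^ p / (K : ℝ) ^ p := fun t _ =>
    Real.div_rpow (by positivity) (by positivity) _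
  rw [Finset.sum_congr rfl this, ← Finset.sum_div]
  gcongr
  exact sum_rpow_le_tsum hp S

lemma isBigO_one_of_le {f : ℕ → ℝ} {C : ℝ} (h0 : ∀ T, 0 ≤ f T) (hC : ∀ T, f T ≤ C) :
    f =O[atTop] (fun _ => (1 : ℝ)) :=
  IsBigO.of_bound C (Eventually.of_forall fun T => by
    rw [Real.norm_of_nonneg (h0 T)]; simpa using hC T)

lemma ucbBound_nonneg (K : ℕ) (α : ℝ) (t₀ T : ℕ) : 0 ≤ ucbBound K α t₀ T := by
  unfold ucbBound; positivity

lemma tsBound_nonneg (K : ℕ) (α β : ℝ) (tb T : ℕ) : 0 ≤ tsBound K α β tb T := by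
  unfold tsBound; positivity

/-- The exponent `2 - α` is below `-1` exactly when `α > 3`. -/
lemma exists_ucbBound_le (K : ℕ) {α : ℝ} (hα : 3 < α) (t₀ : ℕ) :
    ∃ C, ∀ T, ucbBound K α t₀ T ≤ C := by
  refine ⟨K * t₀ + 2 * K * (∑' t : ℕ, (t : ℝ) ^ (1 - α))
    + (K : ℝ) ^ 3 * (6 * ((∑' t : ℕ, (t : ℝ) ^ (2 - α)) / (K : ℝ) ^ (2 - α))), fun T => ?_⟩
  unfold ucbBound
  rw [← Finset.mul_sum, ← Finset.mul_sum]
  gcongr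
  · exact sum_rpow_le_tsum (by linarith) _
  · exact sum_div_rpow_le (by linarith) K _

lemma exists_tsBound_le (K : ℕ) {α β : ℝ} (hα : 3 < α) (hβ : 1 < β) (tb : ℕ) :
    ∃ C, ∀ T, tsBound K α β tb T ≤ C := by
  refine ⟨K * tb + 2 * K * (∑' t : ℕ, (t : ℝ) ^ (1 - α))
    + (K : ℝ) ^ 3 * (4 * ((∑' t : ℕ, (t : ℝ) ^ (2 - α)) / (K : ℝ) ^ (2 - α)))
    + (K : ℝ) ^ 2 * ((∑' t : ℕ, (t : ℝ) ^ (1 - 2 * β)) / (K : ℝ) ^ (1 - 2 * β)), fun T => ?_⟩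
  unfold tsBound
  rw [← Finset.mul_sum, ← Finset.mul_sum]
  gcongr
  · exact sum_rpow_le_tsum (by linarith) _
  · exact sum_div_rpow_le (by linarith) K _
  · exact sum_div_rpow_le (by linarith) K _

end Analysis

/-! ### The thresholds are attained -/

section Thresholds

variable {Θ : Type*} {K : ℕ} {μ : Fin K → Θ → ℝ} {θs : Θ} {ks k : Fin K} {α β σ : ℝ}

lemma tZero_spec (hks : ∀ l, l ≠ ks → μ l θs < μ ks θs) (hk : NonCompetitive μ θs ks k) :
    2 ≤ tZero μ θs ks k α σ ∧
    4 * Real.sqrt (K * α * σ ^ 2 * Real.log (tZero μ θs ks k α σ) / (tZero μ θs ks k α σ))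
      ≤ gapMin μ θs ks ∧
    ENNReal.ofReal (4 * Real.sqrt (K * α * σ ^ 2 * Real.log (tZero μ θs ks k α σ) /
      (tZero μ θs ks k α σ))) ≤ degree μ θs ks k := by
  have h := exists_threshold (c := 4) (d := K * α * σ ^ 2)
    (gapMin_pos hks (hk.ne hks)) (degree_pos hk)
  obtain ⟨τ, hτ, h1, h2⟩ := ((eventually_ge_atTop 2).and h).exists
  exact Nat.sInf_mem (s := {τ : ℕ | 2 ≤ τ ∧
    4 * Real.sqrt (K * α * σ ^ 2 * Real.log τ / τ) ≤ gapMin μ θs ks ∧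
    ENNReal.ofReal (4 * Real.sqrt (K * α * σ ^ 2 * Real.log τ / τ)) ≤ degree μ θs ks k})
    ⟨τ, hτ, h1, h2⟩

lemma tB_spec (hks : ∀ l, l ≠ ks → μ l θs < μ ks θs) (hk : NonCompetitive μ θs ks k)
    (hβ : 0 < β) (hσ : 0 < σ) :
    2 ≤ tB μ θs ks k α β σ ∧
    3 * Real.sqrt (3 * (K * α * σ ^ 2 * Real.log (tB μ θs ks k α β σ) / (tB μ θs ks k α β σ)))
      ≤ gapMin μ θs ks ∧
    ENNReal.ofReal (3 * Real.sqrt (3 * (K * α * σ ^ 2 * Real.log (tB μ θs ks k α β σ) /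
      (tB μ θs ks k α β σ)))) ≤ degree μ θs ks k := by
  have h := exists_threshold (c := 3) (d := 3 * (K * α * σ ^ 2))
    (gapMin_pos hks (hk.ne hks)) (degree_pos hk)
  obtain ⟨n, hn⟩ := exists_nat_ge (Real.exp (11 * β * σ ^ 2))
  obtain ⟨τ, hτ, h1, h2⟩ := ((eventually_ge_atTop n).and h).exists
  have hmem := Nat.sInf_mem (s := {τ : ℕ | Real.exp (11 * β * σ ^ 2) ≤ τ ∧
    3 * Real.sqrt (3 * (K * α * σ ^ 2 * Real.log τ / τ)) ≤ gapMin μ θs ks ∧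
    ENNReal.ofReal (3 * Real.sqrt (3 * (K * α * σ ^ 2 * Real.log τ / τ))) ≤ degree μ θs ks k})
    ⟨τ, hn.trans (by exact_mod_cast hτ), by convert h1 using 3; ring_nf, by
      convert h2 using 4; ring_nf⟩
  refine ⟨?_, hmem.2⟩
  -- The exponential of a positive number exceeds 1, so the integer `tB` is at least 2.
  have h3 : (1 : ℝ) < tB μ θs ks k α β σ :=
    lt_of_lt_of_le (Real.one_lt_exp_iff.2 (by positivity)) hmem.1
  have h4 : 1 < tB μ θs ks k α β σ := by exact_mod_cast h3
  exact h4

end Thresholds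

/-! ### The bound for UCB-C -/

section UCB

variable {Θ Ω : Type*} {K : ℕ} {μ : Fin K → Θ → ℝ} {θs : Θ} {ks k : Fin K} {α σ : ℝ}
  {X : Fin K → ℕ → Ω → ℝ} {arm : ℕ → Ω → Fin K}

/-- If the best arm was pulled in less than a `1/K` fraction of the rounds, another arm was pulled
in more than a `1/K` fraction of them. -/
lemma exists_pulls_gt {t : ℕ} {ω : Ω} (h : K * pulls arm ks t ω < t) :
    ∃ l, l ≠ ks ∧ t < K * pulls arm l t ω := by
  by_contra! hcon
  have h1 : ∑ l, K * pulls arm l t ω < ∑ _l : Fin K, t := by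
    refine Finset.sum_lt_sum (fun l _ => ?_) ⟨ks, Finset.mem_univ _, h⟩
    rcases eq_or_ne l ks with rfl | hl
    · exact h.le
    · exact hcon l hl
  rw [← Finset.mul_sum, sum_pulls] at h1
  simp at h1

/-- With `n ≥ t / (2K)`, the square of twice the width is `8 α σ² log t / n ≤ 16 K α σ² log t / t`,
and `log t / t` is compared with its value at `t₀`. The slack 2 in `2 K n` absorbs the rounding of
`t / K`. -/
lemma two_mul_width_le {t₀ t n : ℕ} (hα : 0 < α) (ht₀ : 2 ≤ t₀) (ht : 2 * t₀ ≤ t)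
    (hn : t ≤ 2 * K * n) :
    2 * width α σ t n ≤ 4 * Real.sqrt (K * α * σ ^ 2 * Real.log t₀ / t₀) := by
  have htp : (0 : ℝ) < t := by have : 0 < t := by omega
                               exact_mod_cast this
  have ht₀p : (0 : ℝ) < t₀ := by have : 0 < t₀ := by omega
                                 exact_mod_cast this
  have hnp : (0 : ℝ) < n := by
    have : 0 < n := by
      rcases Nat.eq_zero_or_pos n with rfl | h
      · omega
      · exact h
    exact_mod_cast this
  have hlog := Real.log_natCast_nonneg t
  have hlog₀ := Real.log_natCast_nonneg t₀
  have hn' : (t : ℝ) ≤ 2 * K * n := by exact_mod_cast hn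
  refine abs_le_of_sq_le_sq' ?_ (by positivity) |>.2
  rw [mul_pow, width_sq hα.le, mul_pow, Real.sq_sqrt (by positivity)]
  have h1 := log_div_self_le ht₀ ht
  have h2 : Real.log t / n ≤ 2 * K * (Real.log t / t) := by
    rw [div_le_iff₀ hnp]
    have : 2 * K * (Real.log t / t) * n = Real.log t * (2 * K * n / t) := by ring
    rw [this]
    exact le_mul_of_one_le_right hlog ((one_le_div htp).2 hn')
  have h3 : Real.log t / n ≤ 2 * K * (Real.log t₀ / t₀) :=
    h2.trans (mul_le_mul_of_nonneg_left h1 (by positivity))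
  have h4 : 0 ≤ 8 * α * σ ^ 2 := by positivity
  calc 2 ^ 2 * (2 * α * σ ^ 2 * Real.log t / n) = 8 * α * σ ^ 2 * (Real.log t / n) := by ring
    _ ≤ 8 * α * σ ^ 2 * (2 * K * (Real.log t₀ / t₀)) := mul_le_mul_of_nonneg_left h3 h4
    _ = 4 ^ 2 * (K * α * σ ^ 2 * Real.log t₀ / t₀) := by ring

variable [MeasurableSpace Ω] {P : Measure Ω}

/-- While the true parameter stays in the confidence sets, UCB-C does not pull a non-competitive
arm after round `K * t₀`. -/
lemma IsUCBC.arm_ne (harm : IsUCBC μ α σ X arm) (hks : ∀ l, l ≠ ks → μ l θs < μ ks θs)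
    (hα : 0 < α) {t₀ : ℕ} (ht₀ : 2 ≤ t₀) (hkks : k ≠ ks)
    (hgap : 4 * Real.sqrt (K * α * σ ^ 2 * Real.log t₀ / t₀) ≤ gapMin μ θs ks)
    (hdeg : ENNReal.ofReal (4 * Real.sqrt (K * α * σ ^ 2 * Real.log t₀ / t₀))
      ≤ degree μ θs ks k) {t : ℕ} {ω : Ω} (ht : K * t₀ ≤ t)
    (hg : ∀ s ∈ Finset.Icc (t / K) t, θs ∈ confSet μ α σ X arm s ω) : arm t ω ≠ k := by
  intro hk
  have hK := two_le_of_ne hkks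
  have ht2 : 2 * t₀ ≤ t := (Nat.mul_le_mul_right t₀ hK).trans ht
  have hmt : t / K ≤ t := Nat.div_le_self t K
  -- If `ks` has its share of the pulls, its interval is too narrow to leave `k` competitive.
  by_cases hn : t ≤ K * pulls arm ks t ω
  · have hpos : 0 < pulls arm ks t ω := by
      rcases Nat.eq_zero_or_pos (pulls arm ks t ω) with h | h
      · rw [h] at hn; omega
      · exact h
    have h1 := lt_two_mul_width hdeg (hg t (by simp [hmt])) (hk ▸ harm.mem t ω) hpos
    have h2 := two_mul_width_le (σ := σ) (K := K) hα ht₀ ht2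
      (n := pulls arm ks t ω) (by nlinarith)
    linarith
  -- Otherwise look at the round `s` in which `l` is pulled with count exactly `⌊t/K⌋`. A count
  -- cannot exceed the time, so `s ≥ ⌊t/K⌋` and the confidence set is correct there.
  · obtain ⟨l, hl, hlt⟩ := exists_pulls_gt (not_le.1 hn)
    have hm : t / K < pulls arm l t ω := by
      rw [Nat.div_lt_iff_lt_mul (by omega)]; linarith
    obtain ⟨s, hs, hsl, hsm⟩ := exists_pull hm
    have hms : t / K ≤ s := hsm ▸ pulls_le
    have hgs := hg s (by simp [hms, hs.le])
    have hm0 : t₀ ≤ t / K := (Nat.le_div_iff_mul_le (by omega)).2 (by linarith)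
    have hpl : pulls arm l s ω ≠ 0 := by omega
    have hidx := harm.argmax s ω ks (best_mem_competitiveSet hks hgs)
    rw [hsl] at hidx
    unfold ucbIndex at hidx
    rw [if_neg hpl] at hidx
    -- An unpulled `ks` would have index `⊤` and beat the finite index of `l`.
    have hpk : pulls arm ks s ω ≠ 0 := by
      intro h
      rw [if_pos h] at hidx
      exact absurd hidx (not_le.2 (EReal.coe_lt_top _))
    rw [if_neg hpk, EReal.coe_le_coe_iff] at hidx
    have h1 := abs_lt.1 (hgs ks (Nat.pos_of_ne_zero hpk))
    have h2 := abs_lt.1 (hgs l (Nat.pos_of_ne_zero hpl))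
    have h3 := gapMin_le (μ := μ) (θs := θs) hl
    have h4 := width_mono (σ := σ) hα.le hs.le (pulls arm l s ω)
    have h5 := two_mul_width_le (σ := σ) (K := K) hα ht₀ ht2 (n := pulls arm l s ω) (by
      rw [hsm]
      have h6 := Nat.div_add_mod t K
      have h7 := Nat.mod_lt t (show 0 < K by omega)
      have h8 : K * 1 ≤ K * (t / K) := Nat.mul_le_mul_left K (by omega)
      rw [mul_assoc]
      omega)
    linarith

lemma measure_exists_not_mem_le [IsProbabilityMeasure P]
    (hX : IsRewardTable P X (fun k => μ k θs) σ)
    (hσ : 0 < σ) (hα : 0 < α) (arm : ℕ → Ω → Fin K) (S : Finset ℕ) (hS : ∀ s ∈ S, 0 < s) :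
    P.real {ω | ∃ s ∈ S, θs ∉ confSet μ α σ X arm s ω} ≤ ∑ s ∈ S, 2 * K * (s : ℝ) ^ (1 - α) := by
  have : {ω | ∃ s ∈ S, θs ∉ confSet μ α σ X arm s ω}
      = ⋃ s ∈ S, {ω | θs ∉ confSet μ α σ X arm s ω} := by ext; simp
  rw [this]
  refine (measureReal_biUnion_finset_le _ _).trans (Finset.sum_le_sum fun s hs => ?_)
  exact measure_not_mem_confSet_le hX hσ hα arm (hS s hs)

lemma one_le_div_rpow {K t₀ t : ℕ} (hK : 0 < K) (ht₀ : 0 < t₀) (ht : K * t₀ ≤ t) {p : ℝ}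
    (hp : 0 ≤ p) : 1 ≤ ((t : ℝ) / K) ^ p := by
  refine Real.one_le_rpow ?_ hp
  have hK' : (0 : ℝ) < K := by exact_mod_cast hK
  rw [one_le_div hK']
  have : K ≤ t := by nlinarith
  exact_mod_cast this

/-- Every pull after round `K t₀` needs a wrong confidence set at time `t` or at some time in
`[⌊t/K⌋, t)`. The first possibility feeds the sum of `2 K t^(1-α)`, the second the sum of
`(t/K)^(2-α)`. -/
theorem IsUCBC.integral_pulls_le [IsProbabilityMeasure P] (harm : IsUCBC μ α σ X arm)
    (hX : IsRewardTable P X (fun k => μ k θs) σ)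
    (hks : ∀ l, l ≠ ks → μ l θs < μ ks θs) (hσ : 0 < σ)
    (hα : 0 < α) {t₀ : ℕ} (ht₀ : 2 ≤ t₀) (hkks : k ≠ ks)
    (hgap : 4 * Real.sqrt (K * α * σ ^ 2 * Real.log t₀ / t₀) ≤ gapMin μ θs ks)
    (hdeg : ENNReal.ofReal (4 * Real.sqrt (K * α * σ ^ 2 * Real.log t₀ / t₀))
      ≤ degree μ θs ks k) (T : ℕ) :
    ∫ ω, (pulls arm k T ω : ℝ) ∂P ≤ ucbBound K α t₀ T := by
  have hK := two_le_of_ne hkks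
  have hKp : (0 : ℝ) < K := by exact_mod_cast (show 0 < K by omega)
  have hK1 : (1 : ℝ) ≤ K := by exact_mod_cast (show 1 ≤ K by omega)
  rw [integral_pulls harm.measurable]
  have hsplit : Finset.range T ⊆ Finset.range (K * t₀) ∪ Finset.Ico (K * t₀) T := by
    intro t ht; simp at ht ⊢; omega
  have hdisj : Disjoint (Finset.range (K * t₀)) (Finset.Ico (K * t₀) T) := by
    rw [Finset.disjoint_left]; intro t; simp; omega
  have h1 : ∑ t ∈ Finset.range T, P.real {ω | arm t ω = k} ≤
      ∑ t ∈ Finset.range (K * t₀), P.real {ω | arm t ω = k} +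
      ∑ t ∈ Finset.Ico (K * t₀) T, P.real {ω | arm t ω = k} := by
    rw [← Finset.sum_union hdisj]
    exact Finset.sum_le_sum_of_subset_of_nonneg hsplit fun _ _ _ => measureReal_nonneg
  have h2 : ∑ t ∈ Finset.range (K * t₀), P.real {ω | arm t ω = k} ≤ K * t₀ := by
    refine (Finset.sum_le_sum (g := fun _ => (1 : ℝ)) fun t _ => measureReal_le_one).trans ?_
    simp
  have hpos : ∀ t ∈ Finset.Ico (K * t₀) T, 0 < t := by
    intro t ht
    rw [Finset.mem_Ico] at ht
    nlinarith [ht.1]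
  suffices h3 : ∑ t ∈ Finset.Ico (K * t₀) T, P.real {ω | arm t ω = k} ≤
      ∑ t ∈ Finset.Icc 1 T, 2 * K * (t : ℝ) ^ (1 - α)
        + (K : ℝ) ^ 3 * ∑ t ∈ Finset.Icc (K * t₀) T, 6 * ((t : ℝ) / K) ^ (2 - α) by
    unfold ucbBound; linarith
  have hsub : Finset.Ico (K * t₀) T ⊆ Finset.Icc (K * t₀) T := Finset.Ico_subset_Icc_self
  -- For `α ≤ 2` each term of the last sum is at least 1 and dominates a probability.
  rcases le_or_gt α 2 with hα2 | hα2
  · have h4 : ∑ t ∈ Finset.Ico (K * t₀) T, P.real {ω | arm t ω = k}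
        ≤ ∑ t ∈ Finset.Ico (K * t₀) T, (K : ℝ) ^ 3 * (6 * ((t : ℝ) / K) ^ (2 - α)) := by
      refine Finset.sum_le_sum fun t ht => measureReal_le_one.trans ?_
      have h5 := one_le_div_rpow (by omega) (by omega) (Finset.mem_Ico.1 ht).1
        (sub_nonneg.2 hα2)
      have h6 : (1 : ℝ) ≤ (K : ℝ) ^ 3 := one_le_pow₀ hK1
      nlinarith
    have h5 : ∑ t ∈ Finset.Ico (K * t₀) T, (K : ℝ) ^ 3 * (6 * ((t : ℝ) / K) ^ (2 - α)) ≤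
        (K : ℝ) ^ 3 * ∑ t ∈ Finset.Icc (K * t₀) T, 6 * ((t : ℝ) / K) ^ (2 - α) := by
      rw [Finset.mul_sum]
      exact Finset.sum_le_sum_of_subset_of_nonneg hsub fun _ _ _ => by positivity
    have h6 : 0 ≤ ∑ t ∈ Finset.Icc 1 T, 2 * K * (t : ℝ) ^ (1 - α) := by positivity
    linarith
  · have h4 : ∀ t ∈ Finset.Ico (K * t₀) T, P.real {ω | arm t ω = k} ≤
        2 * K * (t : ℝ) ^ (1 - α) +
          4 * K ^ 2 * (((K * (t / K) : ℕ) : ℝ) / K) ^ (2 - α) := by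
      intro t ht
      have htK := (Finset.mem_Ico.1 ht).1
      have ht0 := hpos t ht
      have hm : t₀ ≤ t / K := (Nat.le_div_iff_mul_le (by omega)).2 (by linarith)
      have hmp : (0 : ℝ) < ((t / K : ℕ) : ℝ) := by exact_mod_cast (show 0 < t / K by omega)
      have hsubset : {ω | arm t ω = k} ⊆ {ω | θs ∉ confSet μ α σ X arm t ω} ∪
          {ω | ∃ s ∈ Finset.Ico (t / K) t, θs ∉ confSet μ α σ X arm s ω} := by
        intro ω hω
        by_contra hcon
        simp only [Set.mem_union, Set.mem_ofPred_eq, not_or, not_not, not_exists, not_and] at hcon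
        refine harm.arm_ne hks hα ht₀ hkks hgap hdeg htK (fun s hs => ?_) hω
        rw [Finset.mem_Icc] at hs
        rcases hs.2.lt_or_eq with h | h
        · exact hcon.2 s (Finset.mem_Ico.2 ⟨hs.1, h⟩)
        · rw [h]; exact hcon.1
      refine (measureReal_mono hsubset (measure_ne_top _ _)).trans
        ((measureReal_union_le _ _).trans (add_le_add ?_ ?_))
      · exact measure_not_mem_confSet_le hX hσ hα arm ht0
      · refine (measure_exists_not_mem_le hX hσ hα arm _ fun s hs => ?_).trans ?_
        · have := (Finset.mem_Ico.1 hs).1; omega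
        · have h5 : ∀ s ∈ Finset.Ico (t / K) t, 2 * K * (s : ℝ) ^ (1 - α) ≤
              2 * K * ((t / K : ℕ) : ℝ) ^ (1 - α) := by
            intro s hs
            have hs1 : ((t / K : ℕ) : ℝ) ≤ s := by exact_mod_cast (Finset.mem_Ico.1 hs).1
            exact mul_le_mul_of_nonneg_left
              (Real.rpow_le_rpow_of_nonpos hmp hs1 (by linarith)) (by positivity)
          refine (Finset.sum_le_sum h5).trans ?_
          rw [Finset.sum_const, nsmul_eq_mul, Nat.card_Ico]
          -- Since `⌊t/K⌋ ≥ 1`, one has `t < K ⌊t/K⌋ + K ≤ 2 K ⌊t/K⌋`.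
          have h6 : ((t - t / K : ℕ) : ℝ) ≤ 2 * K * ((t / K : ℕ) : ℝ) := by
            have h6 := Nat.div_add_mod t K
            have h7 := Nat.mod_lt t (show 0 < K by omega)
            have h8 : K * 1 ≤ K * (t / K) := Nat.mul_le_mul_left K (by omega)
            have : t - t / K ≤ 2 * K * (t / K) := by rw [mul_assoc]; omega
            exact_mod_cast this
          have h7 : ((K * (t / K) : ℕ) : ℝ) / K = ((t / K : ℕ) : ℝ) := by
            push_cast [Nat.cast_mul]
            field_simp
          rw [h7, show (2 : ℝ) - α = 1 + (1 - α) by ring, Real.rpow_add hmp, Real.rpow_one]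
          have h8 : 0 ≤ 2 * K * ((t / K : ℕ) : ℝ) ^ (1 - α) := by positivity
          calc _ ≤ 2 * K * ((t / K : ℕ) : ℝ) * (2 * K * ((t / K : ℕ) : ℝ) ^ (1 - α)) :=
                mul_le_mul_of_nonneg_right h6 h8
            _ = _ := by ring
    refine (Finset.sum_le_sum h4).trans ?_
    rw [Finset.sum_add_distrib]
    refine add_le_add ?_ ?_
    · refine Finset.sum_le_sum_of_subset_of_nonneg (fun t ht => ?_) fun _ _ _ => by positivity
      have := hpos t ht
      have := (Finset.mem_Ico.1 ht).2
      rw [Finset.mem_Icc]; omega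
    -- The terms depend on `t` only through `⌊t/K⌋`. Grouping them costs a factor `K`, and the
    -- resulting `4 K³` is within the allowed `6 K³`.
    · refine (sum_blocks_le (by omega) (G := fun t => 4 * K ^ 2 * ((t : ℝ) / K) ^ (2 - α))
        fun t => by positivity).trans ?_
      rw [Finset.mul_sum, Finset.mul_sum]
      refine Finset.sum_le_sum fun t _ => ?_
      have : 0 ≤ (K : ℝ) ^ 3 * ((t : ℝ) / K) ^ (2 - α) := by positivity
      nlinarith

end UCB

/-! ### Standard Gaussian tails -/

section Gaussian

/-- The standard Gaussian measure. -/
noncomputable abbrev stdGauss : Measure ℝ := gaussianReal 0 1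

lemma stdGauss_singleton (x : ℝ) : stdGauss {x} = 0 := by
  have : NullSingletonClass stdGauss := nullSingletonClass_gaussianReal one_ne_zero
  exact measure_singleton x

lemma measurePreserving_neg_stdGauss : MeasurePreserving (fun x : ℝ => -x) stdGauss stdGauss :=
  ⟨by fun_prop, by simpa using gaussianReal_map_neg (μ := 0) (v := 1)⟩

lemma half_le_stdGauss_Iic {x : ℝ} (hx : 0 ≤ x) : 1 / 2 ≤ stdGauss (Set.Iic x) := by
  have h1 : stdGauss (Set.Ici 0) = stdGauss (Set.Iic 0) := by
    rw [← measurePreserving_neg_stdGauss.measure_preimage measurableSet_Ici.nullMeasurableSet]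
    congr 1
    ext y
    simp
  have h2 : 1 ≤ stdGauss (Set.Iic 0) + stdGauss (Set.Ici 0) := by
    rw [← measure_univ (μ := stdGauss), ← Set.Iic_union_Ici (a := (0 : ℝ))]
    exact measure_union_le _ _
  rw [h1, ← two_mul] at h2
  refine le_trans ?_ (measure_mono (Set.Iic_subset_Iic.2 hx))
  rw [ENNReal.div_le_iff_le_mul (by simp) (by simp), mul_comm]
  exact h2

lemma stdGauss_Ioi_pos (x : ℝ) : 0 < stdGauss (Set.Ioi x) := by
  rw [pos_iff_ne_zero]
  intro h
  have := gaussianReal_absolutelyContinuous' (0 : ℝ) (v := 1) one_ne_zero h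
  simp at this

/-- The tail of a product of two Gaussian tails, by rotation invariance. -/
lemma stdGauss_tail_mul_le {A x B : ℝ} (hA : 0 ≤ A) (hx : 0 < x) (hB : B ^ 2 ≤ A ^ 2 + x ^ 2) :
    stdGauss (Set.Ici A) * stdGauss (Set.Ioi x) ≤ stdGauss (Set.Ici B) := by
  set N := Real.sqrt (A ^ 2 + x ^ 2)
  have hN2 : N ^ 2 = A ^ 2 + x ^ 2 := Real.sq_sqrt (by positivity)
  have hN : 0 < N := Real.sqrt_pos.2 (by positivity)
  have hBN : B ≤ N := Real.le_sqrt_of_sq_le hB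
  -- The projection of a Gaussian pair on the unit vector `(A, x) / N` is standard Gaussian. On the
  -- quadrant `g1 ≥ A`, `g2 > x` it is at least `N ≥ B`.
  have hmap : (stdGauss.prod stdGauss).map
      ((fun g : ℝ × ℝ => (A / N) * g.1) + (fun g : ℝ × ℝ => (x / N) * g.2)) = stdGauss := by
    have hind : IndepFun (fun g : ℝ × ℝ => (A / N) * g.1) (fun g : ℝ × ℝ => (x / N) * g.2)
        (stdGauss.prod stdGauss) :=
      indepFun_prod (X := fun g : ℝ => (A / N) * g) (Y := fun g : ℝ => (x / N) * g)
        (by fun_prop) (by fun_prop)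
    have h1 : (stdGauss.prod stdGauss).map (fun g : ℝ × ℝ => (A / N) * g.1)
        = gaussianReal 0 (NNReal.mk ((A / N) ^ 2) (sq_nonneg _) * 1) := by
      have : (fun g : ℝ × ℝ => (A / N) * g.1) = (fun z : ℝ => (A / N) * z) ∘ Prod.fst := rfl
      rw [this, ← Measure.map_map (by fun_prop) (by fun_prop), Measure.map_fst_prod,
        measure_univ, one_smul, gaussianReal_map_const_mul, mul_zero]
    have h2 : (stdGauss.prod stdGauss).map (fun g : ℝ × ℝ => (x / N) * g.2)
        = gaussianReal 0 (NNReal.mk ((x / N) ^ 2) (sq_nonneg _) * 1) := by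
      have : (fun g : ℝ × ℝ => (x / N) * g.2) = (fun z : ℝ => (x / N) * z) ∘ Prod.snd := rfl
      rw [this, ← Measure.map_map (by fun_prop) (by fun_prop), Measure.map_snd_prod,
        measure_univ, one_smul, gaussianReal_map_const_mul, mul_zero]
    rw [gaussianReal_add_gaussianReal_of_indepFun hind h1 h2, add_zero]
    congr 1
    ext
    simp only [NNReal.coe_add, NNReal.coe_mk, NNReal.coe_one, mul_one]
    rw [div_pow, div_pow, ← add_div, ← hN2]
    exact div_self (by positivity)
  rw [← Measure.prod_prod]
  conv_rhs => rw [← hmap, Measure.map_apply (by fun_prop) measurableSet_Ici]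
  refine measure_mono ?_
  rintro ⟨g1, g2⟩ ⟨h1, h2⟩
  simp only [Set.mem_Ici, Set.mem_Ioi, Set.mem_preimage, Pi.add_apply] at h1 h2 ⊢
  have h3 : A / N * A + x / N * x = N := by
    field_simp; linarith
  have h4 : A / N * A ≤ A / N * g1 := by gcongr
  have h5 : x / N * x ≤ x / N * g2 := by gcongr
  linarith

end Gaussian

/-! ### Comparison of two Gaussian samples above a rival threshold -/

section Duel

/-- The Gaussian pairs for which the first of two samples beats the second one and a threshold. -/
def firstWins (u₀ s₁ v₀ s₂ : ℝ) (a : EReal) : Set (ℝ × ℝ) :=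
  {g | v₀ + s₂ * g.2 ≤ u₀ + s₁ * g.1 ∧ a ≤ ((u₀ + s₁ * g.1 : ℝ) : EReal)}

/-- The Gaussian pairs for which the second of two samples beats the first one and a threshold. -/
def secondWins (u₀ s₁ v₀ s₂ : ℝ) (a : EReal) : Set (ℝ × ℝ) :=
  {g | u₀ + s₁ * g.1 < v₀ + s₂ * g.2 ∧ a < ((v₀ + s₂ * g.2 : ℝ) : EReal)}

variable {u₀ s₁ v₀ s₂ y : ℝ} {a : EReal}

lemma measurableSet_secondWeak : MeasurableSet
    {g : ℝ × ℝ | u₀ + s₁ * g.1 ≤ v₀ + s₂ * g.2 ∧ a ≤ ((v₀ + s₂ * g.2 : ℝ) : EReal)} := by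
  rw [Set.ofPred_and]
  exact (measurableSet_le (by fun_prop) (by fun_prop)).inter
    (measurableSet_le measurable_const (by fun_prop))

/-- Ties have probability zero. -/
lemma secondWeak_le (hs₂ : 0 < s₂) :
    (stdGauss.prod stdGauss) {g | u₀ + s₁ * g.1 ≤ v₀ + s₂ * g.2 ∧ a ≤ ((v₀ + s₂ * g.2 : ℝ) : EReal)}
      ≤ (stdGauss.prod stdGauss) (secondWins u₀ s₁ v₀ s₂ a) := by
  have hnull : ∀ f : ℝ → ℝ, Measurable f →
      (stdGauss.prod stdGauss) {g | f g.1 = v₀ + s₂ * g.2} = 0 := by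
    intro f hf
    rw [Measure.measure_prod_null (measurableSet_eq_fun (by fun_prop) (by fun_prop))]
    refine Eventually.of_forall fun x => ?_
    refine measure_mono_null (t := {(f x - v₀) / s₂}) ?_ (stdGauss_singleton _)
    intro z hz
    simp only [Set.mem_preimage, Set.mem_ofPred_eq] at hz
    rw [Set.mem_singleton_iff, eq_div_iff hs₂.ne']
    linarith
  have h1 := hnull (fun x => u₀ + s₁ * x) (by fun_prop)
  -- Only a finite threshold can tie with a sample. For an infinite one the default value of
  -- `toReal` merely adds a null set.
  have h2 := hnull (fun _ => a.toReal) (by fun_prop)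
  have hsub : {g : ℝ × ℝ | u₀ + s₁ * g.1 ≤ v₀ + s₂ * g.2 ∧ a ≤ ((v₀ + s₂ * g.2 : ℝ) : EReal)} ⊆
      secondWins u₀ s₁ v₀ s₂ a ∪ ({g | u₀ + s₁ * g.1 = v₀ + s₂ * g.2} ∪
        {g | a.toReal = v₀ + s₂ * g.2}) := by
    intro g hg
    rcases hg.1.lt_or_eq with h | h
    · rcases hg.2.lt_or_eq with h' | h'
      · exact Or.inl ⟨h, h'⟩
      · right; right
        rw [Set.mem_ofPred_eq, h', EReal.toReal_coe]
    · exact Or.inr (Or.inl h)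
  refine (measure_mono hsub).trans ((measure_union_le _ _).trans ?_)
  rw [measure_union_null h1 h2, add_zero]

/-- A sample with larger mean and larger variance wins at least half as often. -/
lemma firstWins_le_two_mul (hs₁ : 0 < s₁) (hs : s₁ ≤ s₂) (huv : u₀ ≤ v₀) :
    (stdGauss.prod stdGauss) (firstWins u₀ s₁ v₀ s₂ a) ≤
      2 * (stdGauss.prod stdGauss) (secondWins u₀ s₁ v₀ s₂ a) := by
  have hs₂ : 0 < s₂ := hs₁.trans_le hs
  set W := {g : ℝ × ℝ | u₀ + s₁ * g.1 ≤ v₀ + s₂ * g.2 ∧ a ≤ ((v₀ + s₂ * g.2 : ℝ) : EReal)}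
  have hW : MeasurableSet W := measurableSet_secondWeak
  have hswap : MeasurePreserving Prod.swap (stdGauss.prod stdGauss) (stdGauss.prod stdGauss) :=
    Measure.measurePreserving_swap
  have hflip : MeasurePreserving (Prod.map id fun x : ℝ => -x)
      (stdGauss.prod stdGauss) (stdGauss.prod stdGauss) :=
    (MeasurePreserving.id _).prod measurePreserving_neg_stdGauss
  have hsub : firstWins u₀ s₁ v₀ s₂ a ⊆
      Prod.swap ⁻¹' W ∪ (Prod.map id fun x : ℝ => -x) ⁻¹' W := by
    rintro ⟨g1, g2⟩ ⟨h1, h2⟩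
    simp only at h1 h2
    -- If `g1 ≥ 0`, exchanging the two Gaussians hands the high value to the sample with larger mean
    -- and deviation. If `g1 < 0`, the losing `g2` is negative too, and reflecting it lifts the
    -- second sample above `v₀ ≥ u₀`, hence above the first sample and the threshold.
    rcases le_or_gt 0 g1 with hg | hg
    · left
      have h3 : s₁ * g1 ≤ s₂ * g1 := by gcongr
      have h4 : u₀ + s₁ * g2 ≤ v₀ + s₂ * g1 := by
        rcases le_or_gt g2 g1 with h | h
        · have : s₁ * g2 ≤ s₁ * g1 := by gcongr
          linarith
        · have h5 : s₁ * g2 ≤ s₂ * g2 := by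
            have := hg.trans h.le
            gcongr
          linarith
      exact ⟨h4, h2.trans (EReal.coe_le_coe_iff.2 (by simp only [Prod.snd_swap]; linarith))⟩
    · right
      have h3 : s₁ * g1 < 0 := mul_neg_of_pos_of_neg hs₁ hg
      have h4 : s₂ * g2 < 0 := by linarith
      refine ⟨?_, h2.trans (EReal.coe_le_coe_iff.2 ?_)⟩
      · simp only [Prod.map, id]; linarith
      · simp only [Prod.map]; linarith
  refine (measure_mono hsub).trans ((measure_union_le _ _).trans ?_)
  rw [hswap.measure_preimage hW.nullMeasurableSet, hflip.measure_preimage hW.nullMeasurableSet,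
    ← two_mul]
  exact mul_le_mul' le_rfl (secondWeak_le hs₂)

/-- Without a threshold, a sample with larger mean wins more often. -/
lemma firstWins_le (hs₂ : 0 < s₂) (huv : u₀ ≤ v₀) :
    (stdGauss.prod stdGauss) (firstWins u₀ s₁ v₀ s₂ ⊥) ≤
      (stdGauss.prod stdGauss) (secondWins u₀ s₁ v₀ s₂ ⊥) := by
  have hneg : MeasurePreserving (Prod.map (fun x : ℝ => -x) fun x : ℝ => -x)
      (stdGauss.prod stdGauss) (stdGauss.prod stdGauss) :=
    measurePreserving_neg_stdGauss.prod measurePreserving_neg_stdGauss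
  refine le_trans ?_ (secondWeak_le hs₂)
  rw [← hneg.measure_preimage measurableSet_secondWeak.nullMeasurableSet]
  refine measure_mono ?_
  rintro ⟨g1, g2⟩ ⟨h1, h2⟩
  simp only at h1
  refine ⟨?_, bot_le⟩
  simp only [Prod.map]
  linarith

/-- A sample of small mean wins at most `2 / p` times as often as a sample that exceeds `y` with
probability `p`. -/
lemma firstWins_le_div (hs₁ : 0 < s₁) (hs₂ : 0 < s₂) (hu : u₀ ≤ y) (hv : v₀ < y)
    (h : a = ⊥ ∨ (s₁ ≤ s₂ ∧ (y - v₀) / s₂ ^ 2 ≤ (y - u₀) / s₁ ^ 2)) :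
    (stdGauss.prod stdGauss) (firstWins u₀ s₁ v₀ s₂ a) ≤
      2 / stdGauss {g | y < v₀ + s₂ * g} * (stdGauss.prod stdGauss) (secondWins u₀ s₁ v₀ s₂ a) := by
  set p := stdGauss {g | y < v₀ + s₂ * g} with hp
  have hset : ∀ r : ℝ, {g : ℝ | r < v₀ + s₂ * g} = Set.Ioi ((r - v₀) / s₂) := by
    intro r; ext g
    rw [Set.mem_ofPred_eq, Set.mem_Ioi, div_lt_iff₀ hs₂]
    constructor <;> intro h <;> linarith
  have hset1 : ∀ r : ℝ, {g : ℝ | u₀ + s₁ * g ≤ r} = Set.Iic ((r - u₀) / s₁) := by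
    intro r; ext g
    rw [Set.mem_ofPred_eq, Set.mem_Iic, le_div_iff₀ hs₁]
    constructor <;> intro h <;> linarith
  have hp0 : p ≠ 0 := by rw [hp, hset]; exact (stdGauss_Ioi_pos _).ne'
  have hpt : p ≠ ⊤ := measure_ne_top _ _
  -- The second sample wins when it exceeds `r` and the first does not; the latter has probability
  -- at least 1/2 because `u₀ ≤ y ≤ r`.
  have hsecond : ∀ r : ℝ, y ≤ r → a ≤ r →
      1 / 2 * stdGauss {g | r < v₀ + s₂ * g} ≤
        (stdGauss.prod stdGauss) (secondWins u₀ s₁ v₀ s₂ a) := by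
    intro r hr har
    refine le_trans ?_ (measure_mono (s := {g : ℝ | u₀ + s₁ * g ≤ r} ×ˢ {g | r < v₀ + s₂ * g}) ?_)
    · rw [Measure.prod_prod]
      gcongr
      rw [hset1]
      exact half_le_stdGauss_Iic (div_nonneg (by linarith) hs₁.le)
    · rintro ⟨g1, g2⟩ ⟨h1, h2⟩
      simp only [Set.mem_ofPred_eq] at h1 h2
      exact ⟨by simp only; linarith, har.trans_lt (EReal.coe_lt_coe_iff.2 h2)⟩
  have hfin : (stdGauss.prod stdGauss) (firstWins u₀ s₁ v₀ s₂ a) * p ≤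
      2 * (stdGauss.prod stdGauss) (secondWins u₀ s₁ v₀ s₂ a) := by
    have htwo : ∀ z : ENNReal, z = 2 * (1 / 2 * z) := by
      intro z
      rw [← mul_assoc, one_div, ENNReal.mul_inv_cancel (by simp) (by simp), one_mul]
    -- For a threshold up to `y` the trivial bound 1 on the first sample suffices. For a threshold
    -- `r` above `y`, the tail of the first sample at `r` times `p` must be compared with the tail
    -- of the second at `r`.
    rcases le_or_gt a (y : EReal) with hay | hay
    · calc _ ≤ 1 * p := by gcongr; exact prob_le_one
        _ = 2 * (1 / 2 * p) := by rw [one_mul]; exact htwo p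
        _ ≤ _ := by gcongr; exact hsecond y le_rfl hay
    · rcases h with rfl | ⟨hs, hratio⟩
      · exact absurd hay not_lt_bot
      induction a using EReal.rec with
      | bot => exact absurd hay not_lt_bot
      | top =>
        have : firstWins u₀ s₁ v₀ s₂ ⊤ = ∅ := by
          ext g
          simp only [firstWins, Set.mem_ofPred_eq, Set.mem_empty_iff_false, iff_false, not_and,
            not_le]
          intro _
          exact EReal.coe_lt_top _
        rw [this]; simp
      | coe r =>
        rw [EReal.coe_lt_coe_iff] at hay
        have h1 : (stdGauss.prod stdGauss) (firstWins u₀ s₁ v₀ s₂ r) ≤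
            stdGauss (Set.Ici ((r - u₀) / s₁)) := by
          have : (stdGauss.prod stdGauss) (Set.Ici ((r - u₀) / s₁) ×ˢ Set.univ) =
              stdGauss (Set.Ici ((r - u₀) / s₁)) := by
            rw [Measure.prod_prod, measure_univ, mul_one]
          rw [← this]
          refine measure_mono ?_
          rintro ⟨g1, g2⟩ ⟨h1, h2⟩
          refine ⟨?_, trivial⟩
          simp only [EReal.coe_le_coe_iff] at h2
          simp only [Set.mem_Ici]
          rw [div_le_iff₀ hs₁]; linarith
        have h2 : stdGauss (Set.Ici ((r - v₀) / s₂)) = stdGauss {g | r < v₀ + s₂ * g} := by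
          have : NullSingletonClass stdGauss := nullSingletonClass_gaussianReal one_ne_zero
          rw [hset]
          exact measure_congr Ioi_ae_eq_Ici.symm
        have h3 : stdGauss (Set.Ici ((r - u₀) / s₁)) * p ≤ stdGauss (Set.Ici ((r - v₀) / s₂)) := by
          rw [hp, hset]
          refine stdGauss_tail_mul_le (div_nonneg (by linarith) hs₁.le)
            (div_pos (by linarith) hs₂) ?_
          have hd : 0 ≤ r - y := by linarith
          have hinv : 1 / s₂ ^ 2 ≤ 1 / s₁ ^ 2 := by gcongr
          -- Expand both squares around `y`. The linear terms compare by `hratio`, the quadratic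
          -- ones by `s₁ ≤ s₂`, and the constant term `((y - v₀) / s₂)²` is contributed by `p`.
          have e1 : ((r - v₀) / s₂) ^ 2 = ((y - v₀) / s₂) ^ 2 + 2 * (r - y) * ((y - v₀) / s₂ ^ 2)
              + (r - y) ^ 2 * (1 / s₂ ^ 2) := by field_simp; ring
          have e2 : ((r - u₀) / s₁) ^ 2 = ((y - u₀) / s₁) ^ 2 + 2 * (r - y) * ((y - u₀) / s₁ ^ 2)
              + (r - y) ^ 2 * (1 / s₁ ^ 2) := by field_simp; ring
          have h4 := mul_le_mul_of_nonneg_left hratio (show 0 ≤ 2 * (r - y) by linarith)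
          have h5 := mul_le_mul_of_nonneg_left hinv (sq_nonneg (r - y))
          nlinarith [sq_nonneg ((y - u₀) / s₁)]
        calc _ ≤ stdGauss (Set.Ici ((r - u₀) / s₁)) * p := by gcongr
          _ ≤ stdGauss {g | r < v₀ + s₂ * g} := h2 ▸ h3
          _ = 2 * (1 / 2 * stdGauss {g | r < v₀ + s₂ * g}) := htwo _
          _ ≤ _ := by gcongr; exact hsecond r hay.le le_rfl
  calc _ = (stdGauss.prod stdGauss) (firstWins u₀ s₁ v₀ s₂ a) * p / p := by
        rw [ENNReal.mul_div_cancel_right hp0 hpt]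
    _ ≤ 2 * (stdGauss.prod stdGauss) (secondWins u₀ s₁ v₀ s₂ a) / p := by gcongr
    _ = _ := by rw [ENNReal.mul_div_right_comm]

end Duel

/-! ### Measurability with respect to the past -/

section Measurability

variable {Θ Ω : Type*} [MeasurableSpace Ω] {K : ℕ} {μ : Fin K → Θ → ℝ} {θs : Θ} {ks k l : Fin K}
  {α β σ : ℝ} {X : Fin K → ℕ → Ω → ℝ} {G : ℕ → Fin K → Ω → ℝ} {arm : ℕ → Ω → Fin K} {t : ℕ}

/-- Only earlier choices are assumed measurable here and below, so that these lemmas also apply to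
the σ-algebra generated by the data that precede the choice in round `t + 1`. -/
lemma measurable_pulls_of_lt (harm : ∀ r < t, Measurable (arm r)) (k : Fin K) :
    Measurable (pulls arm k t) := by
  have h : pulls arm k t = fun ω => ∑ r ∈ Finset.range t, if arm r ω = k then 1 else 0 := by
    ext ω; simp [pulls]
  rw [h]
  refine Finset.measurable_sum _ fun r hr => ?_
  exact Measurable.ite (harm r (Finset.mem_range.1 hr) (measurableSet_singleton k))
    measurable_const measurable_const

lemma measurable_empMean (harm : ∀ r < t, Measurable (arm r)) (hX : ∀ k i, Measurable (X k i))
    (k : Fin K) : Measurable (empMean X arm k t) := by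
  have h1 : Measurable (fun p : ℕ × Ω => (∑ i ∈ Finset.range p.1, X k i p.2) / (p.1 : ℝ)) := by
    refine measurable_from_prod_countable_right fun n => ?_
    exact (Finset.measurable_sum (Finset.range n) fun i _ => hX k i).div_const (n : ℝ)
  exact h1.comp ((measurable_pulls_of_lt harm k).prodMk measurable_id)

/-- The union over `θ` may be uncountable, and `Θ` carries no structure. But for fixed pull counts
each `θ` imposes an open condition on the vector of empirical means, and any union of open sets is
open. -/
lemma measurableSet_exists_mem_confSet (harm : ∀ r < t, Measurable (arm r))
    (hX : ∀ k i, Measurable (X k i)) (Q : Set Θ) :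
    MeasurableSet {ω | ∃ θ ∈ Q, θ ∈ confSet μ α σ X arm t ω} := by
  have h : {ω | ∃ θ ∈ Q, θ ∈ confSet μ α σ X arm t ω} =
      ⋃ n : Fin K → ℕ, {ω | (fun k => pulls arm k t ω) = n} ∩
        (fun ω k => empMean X arm k t ω) ⁻¹'
          (⋃ θ ∈ Q, ⋂ k, {x | 0 < n k → |μ k θ - x k| < width α σ t (n k)}) := by
    ext ω
    simp only [confSet, Set.mem_ofPred_eq, Set.mem_iUnion, Set.mem_inter_iff, Set.mem_preimage,
      Set.mem_iInter, exists_prop]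
    constructor
    · rintro ⟨θ, hθ, h⟩
      exact ⟨_, rfl, θ, hθ, h⟩
    · rintro ⟨n, rfl, θ, hθ, h⟩
      exact ⟨θ, hθ, h⟩
  rw [h]
  refine MeasurableSet.iUnion fun n => ?_
  refine (measurable_pi_lambda _ (fun k => measurable_pulls_of_lt harm k)
    (measurableSet_singleton n)).inter ?_
  refine (measurable_pi_lambda _ fun k => measurable_empMean harm hX k) ?_
  refine (isOpen_biUnion fun θ _ => isOpen_iInter_of_finite fun k => ?_).measurableSet
  by_cases hn : 0 < n k
  · simp only [hn, true_imp_iff]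
    exact isOpen_lt (by fun_prop) continuous_const
  · simp [hn]

lemma measurableSet_mem_confSet (harm : ∀ r < t, Measurable (arm r))
    (hX : ∀ k i, Measurable (X k i)) (θ : Θ) :
    MeasurableSet {ω | θ ∈ confSet μ α σ X arm t ω} := by
  simpa using measurableSet_exists_mem_confSet (μ := μ) (α := α) (σ := σ) harm hX {θ}

lemma measurableSet_mem_competitiveSet (harm : ∀ r < t, Measurable (arm r))
    (hX : ∀ k i, Measurable (X k i)) (k : Fin K) :
    MeasurableSet {ω | k ∈ competitiveSet μ α σ X arm t ω} := by
  have h1 := measurableSet_exists_mem_confSet (μ := μ) (α := α) (σ := σ) harm hX Set.univ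
  have h2 := measurableSet_exists_mem_confSet (μ := μ) (α := α) (σ := σ) harm hX
    {θ | IsOptimal μ θ k}
  have h : {ω | k ∈ competitiveSet μ α σ X arm t ω} =
      {ω | ∃ θ ∈ Set.univ, θ ∈ confSet μ α σ X arm t ω}ᶜ ∪
      {ω | ∃ θ ∈ {θ | IsOptimal μ θ k}, θ ∈ confSet μ α σ X arm t ω} := by
    ext ω
    simp only [competitiveSet, Set.mem_ofPred_eq, Set.mem_union, Set.mem_compl_iff, Set.mem_univ,
      true_and, Set.eq_empty_iff_forall_notMem, not_exists]
    exact or_congr Iff.rfl (exists_congr fun θ => and_comm)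
  rw [h]
  exact h1.compl.union h2

lemma measurable_tsSample (harm : ∀ r < t, Measurable (arm r)) (hX : ∀ k i, Measurable (X k i))
    (hG : Measurable (G t k)) : Measurable (tsSample β σ X G arm k t) := by
  have hp := measurable_pulls_of_lt harm k
  have hm := measurable_empMean harm hX k
  unfold tsSample
  refine Measurable.ite (hp (measurableSet_singleton 0)) measurable_const ?_
  refine measurable_coe_real_ereal.comp (hm.add (Measurable.mul ?_ hG))
  exact ((measurable_from_top (f := fun n : ℕ => Real.sqrt (β * σ ^ 2 / (n : ℝ)))).comp hp)

open Classical in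
/-- The largest Thompson sample among the competitive arms other than `l` and `ks`, or `∞` if the
true parameter is outside the confidence set. -/
noncomputable def rivalSample (μ : Fin K → Θ → ℝ) (θs : Θ) (α β σ : ℝ) (X : Fin K → ℕ → Ω → ℝ)
    (G : ℕ → Fin K → Ω → ℝ) (arm : ℕ → Ω → Fin K) (l ks : Fin K) (t : ℕ) (ω : Ω) : EReal :=
  if θs ∈ confSet μ α σ X arm t ω then
    ⨆ m : {m : Fin K // m ∉ ({l, ks} : Finset (Fin K))},
      if m.1 ∈ competitiveSet μ α σ X arm t ω then tsSample β σ X G arm m.1 t ω else ⊥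
  else ⊤

lemma measurable_rivalSample (harm : ∀ r < t, Measurable (arm r))
    (hX : ∀ k i, Measurable (X k i))
    (hG : ∀ m, m ∉ ({l, ks} : Finset (Fin K)) → Measurable (G t m)) :
    Measurable (rivalSample μ θs α β σ X G arm l ks t) := by
  unfold rivalSample
  refine Measurable.ite (measurableSet_mem_confSet harm hX θs) ?_ measurable_const
  refine Measurable.iSup fun m => ?_
  exact Measurable.ite (measurableSet_mem_competitiveSet harm hX m.1)
    (measurable_tsSample harm hX (hG m.1 m.2)) measurable_const

end Measurability

/-! ### Independence and conditioning -/

section Independence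

variable {Ω : Type*} [MeasurableSpace Ω] {P : Measure Ω} [IsProbabilityMeasure P]

/-- Rectangles determine the law. On a rectangle, first split off `H` from `Y`, then `f(Y)` from
`g(Y)`. Here `f` will select the two compared arms and `g` the remaining ones. -/
lemma IndepFun.prodMk_of_indepFun {α' β' γ' δ' : Type*} [MeasurableSpace α'] [MeasurableSpace β']
    [MeasurableSpace γ'] [MeasurableSpace δ'] {Y : Ω → δ'} {H : Ω → β'} {f : δ' → α'} {g : δ' → γ'}
    (hY : Measurable Y) (hH : Measurable H) (hf : Measurable f) (hg : Measurable g)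
    (h1 : IndepFun Y H P) (h2 : IndepFun (fun ω => f (Y ω)) (fun ω => g (Y ω)) P) :
    IndepFun (fun ω => f (Y ω)) (fun ω => (H ω, g (Y ω))) P := by
  have hfY : Measurable (fun ω => f (Y ω)) := hf.comp hY
  have hgY : Measurable (fun ω => g (Y ω)) := hg.comp hY
  rw [indepFun_iff_map_prod_eq_prod_map_map hfY.aemeasurable (hH.prodMk hgY).aemeasurable]
  have : IsProbabilityMeasure (P.map fun ω => f (Y ω)) :=
    Measure.isProbabilityMeasure_map hfY.aemeasurable
  have : IsProbabilityMeasure (P.map fun ω => (H ω, g (Y ω))) :=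
    Measure.isProbabilityMeasure_map (hH.prodMk hgY).aemeasurable
  have : IsProbabilityMeasure (P.map fun ω => (f (Y ω), H ω, g (Y ω))) :=
    Measure.isProbabilityMeasure_map (hfY.prodMk (hH.prodMk hgY)).aemeasurable
  refine Measure.ext_prod₃ fun {s t u} hs ht hu => ?_
  rw [Measure.map_apply (hfY.prodMk (hH.prodMk hgY)) (hs.prod (ht.prod hu)), Measure.prod_prod,
    Measure.map_apply hfY hs, Measure.map_apply (hH.prodMk hgY) (ht.prod hu)]
  have e1 : (fun ω => (f (Y ω), H ω, g (Y ω))) ⁻¹' s ×ˢ t ×ˢ u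
      = Y ⁻¹' (f ⁻¹' s ∩ g ⁻¹' u) ∩ H ⁻¹' t := by
    ext ω; simp only [Set.mem_preimage, Set.mem_prod, Set.mem_inter_iff]; tauto
  have e2 : (fun ω => (H ω, g (Y ω))) ⁻¹' t ×ˢ u = Y ⁻¹' (g ⁻¹' u) ∩ H ⁻¹' t := by
    ext ω; simp only [Set.mem_preimage, Set.mem_prod, Set.mem_inter_iff]; tauto
  have e3 : Y ⁻¹' (f ⁻¹' s ∩ g ⁻¹' u) = (fun ω => f (Y ω)) ⁻¹' s ∩ (fun ω => g (Y ω)) ⁻¹' u := by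
    ext ω; simp
  rw [e1, e2, h1.measure_inter_preimage_eq_mul _ _ ((hf hs).inter (hg hu)) ht,
    h1.measure_inter_preimage_eq_mul _ _ (hg hu) ht, e3,
    h2.measure_inter_preimage_eq_mul _ _ hs hu, mul_assoc]
  rfl

/-- Comparing the winning probabilities of two Gaussian samples, given independent data `Z`. -/
lemma measure_firstWins_le_lintegral {ζ : Type*} [MeasurableSpace ζ] {Z : Ω → ζ} {g : Ω → ℝ × ℝ}
    (hZ : Measurable Z) (hg : Measurable g) (hind : IndepFun Z g P)
    (hlaw : P.map g = stdGauss.prod stdGauss)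
    {u₀ s₁ v₀ s₂ : ζ → ℝ} {a : ζ → EReal} {ρ : ζ → ENNReal} {B : Set ζ}
    (hu₀ : Measurable u₀) (hs₁ : Measurable s₁) (hv₀ : Measurable v₀) (hs₂ : Measurable s₂)
    (ha : Measurable a) (hρ : Measurable ρ) (hB : MeasurableSet B)
    (h : ∀ z ∈ B, (stdGauss.prod stdGauss) (firstWins (u₀ z) (s₁ z) (v₀ z) (s₂ z) (a z)) ≤
      ρ z * (stdGauss.prod stdGauss) (secondWins (u₀ z) (s₁ z) (v₀ z) (s₂ z) (a z))) :
    P {ω | Z ω ∈ B ∧ g ω ∈ firstWins (u₀ (Z ω)) (s₁ (Z ω)) (v₀ (Z ω)) (s₂ (Z ω)) (a (Z ω))} ≤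
      ∫⁻ ω in {ω | Z ω ∈ B ∧
        g ω ∈ secondWins (u₀ (Z ω)) (s₁ (Z ω)) (v₀ (Z ω)) (s₂ (Z ω)) (a (Z ω))}, ρ (Z ω) ∂P := by
  set γ₂ := stdGauss.prod stdGauss
  have : IsProbabilityMeasure (P.map Z) := Measure.isProbabilityMeasure_map hZ.aemeasurable
  have hmap : P.map (fun ω => (Z ω, g ω)) = (P.map Z).prod γ₂ := by
    rw [← hlaw]
    exact (indepFun_iff_map_prod_eq_prod_map_map hZ.aemeasurable hg.aemeasurable).1 hind
  set L : Set (ζ × (ℝ × ℝ)) := {p | p.1 ∈ B ∧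
    p.2 ∈ firstWins (u₀ p.1) (s₁ p.1) (v₀ p.1) (s₂ p.1) (a p.1)} with hLdef
  set W : Set (ζ × (ℝ × ℝ)) := {p | p.1 ∈ B ∧
    p.2 ∈ secondWins (u₀ p.1) (s₁ p.1) (v₀ p.1) (s₂ p.1) (a p.1)} with hWdef
  have hBm : MeasurableSet {p : ζ × (ℝ × ℝ) | p.1 ∈ B} := measurable_fst hB
  have hL : MeasurableSet L := by
    rw [hLdef]
    simp only [firstWins, Set.mem_ofPred_eq]
    rw [Set.ofPred_and, Set.ofPred_and]
    exact hBm.inter ((measurableSet_le (by fun_prop) (by fun_prop)).inter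
      (measurableSet_le (by fun_prop) (by fun_prop)))
  have hW : MeasurableSet W := by
    rw [hWdef]
    simp only [secondWins, Set.mem_ofPred_eq]
    rw [Set.ofPred_and, Set.ofPred_and]
    exact hBm.inter ((measurableSet_lt (by fun_prop) (by fun_prop)).inter
      (measurableSet_lt (by fun_prop) (by fun_prop)))
  have h1 : P {ω | Z ω ∈ B ∧
      g ω ∈ firstWins (u₀ (Z ω)) (s₁ (Z ω)) (v₀ (Z ω)) (s₂ (Z ω)) (a (Z ω))}
      = ((P.map Z).prod γ₂) L := by
    rw [← hmap, Measure.map_apply (hZ.prodMk hg) hL]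
    rfl
  have h2 : ∫⁻ ω in {ω | Z ω ∈ B ∧
        g ω ∈ secondWins (u₀ (Z ω)) (s₁ (Z ω)) (v₀ (Z ω)) (s₂ (Z ω)) (a (Z ω))}, ρ (Z ω) ∂P
      = ∫⁻ p in W, ρ p.1 ∂((P.map Z).prod γ₂) := by
    rw [← hmap, setLIntegral_map hW (by fun_prop) (hZ.prodMk hg)]
    rfl
  -- By independence the joint law is a product, so `h` can be integrated over the data `z` with the
  -- Gaussian pair as inner variable.
  rw [h1, h2, Measure.prod_apply hL, ← lintegral_indicator hW,
    lintegral_prod (W.indicator fun p => ρ p.1)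
      (Measurable.indicator (by fun_prop) hW).aemeasurable]
  refine lintegral_mono fun z => ?_
  by_cases hz : z ∈ B
  · have e1 : Prod.mk z ⁻¹' L = firstWins (u₀ z) (s₁ z) (v₀ z) (s₂ z) (a z) := by
      ext x; simp [hLdef, hz]
    have e2 : ∀ x, W.indicator (fun p => ρ p.1) (z, x) =
        (secondWins (u₀ z) (s₁ z) (v₀ z) (s₂ z) (a z)).indicator (fun _ => ρ z) x := by
      intro x
      by_cases hx : x ∈ secondWins (u₀ z) (s₁ z) (v₀ z) (s₂ z) (a z)
      · rw [Set.indicator_of_mem hx, Set.indicator_of_mem (show (z, x) ∈ W from ⟨hz, hx⟩)]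
      · rw [Set.indicator_of_notMem hx,
          Set.indicator_of_notMem (s := W) fun h' => hx (And.right h')]
    have hWz : MeasurableSet (secondWins (u₀ z) (s₁ z) (v₀ z) (s₂ z) (a z)) := by
      have : secondWins (u₀ z) (s₁ z) (v₀ z) (s₂ z) (a z) = Prod.mk z ⁻¹' W := by
        ext x; simp [hWdef, hz]
      rw [this]
      exact measurable_prodMk_left hW
    simp only [e1, e2]
    rw [lintegral_indicator_const hWz]
    exact h z hz
  · have e1 : Prod.mk z ⁻¹' L = ∅ := by ext x; simp [hLdef, hz]
    simp [e1]

end Independence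

/-! ### The exchange between an arm and the optimal arm -/

section DuelData

variable {Θ Ω : Type*} [MeasurableSpace Ω] {K : ℕ} {μ : Fin K → Θ → ℝ} {θs : Θ} {ks l : Fin K}
  {α β σ : ℝ} {X : Fin K → ℕ → Ω → ℝ} {G : ℕ → Fin K → Ω → ℝ} {arm : ℕ → Ω → Fin K} {s : ℕ}

/-- What the rounds before `s` and the Thompson samples of the other arms say about the
comparison of the arms `l` and `ks` in round `s + 1`. -/
noncomputable def duelData (μ : Fin K → Θ → ℝ) (θs : Θ) (α β σ : ℝ) (X : Fin K → ℕ → Ω → ℝ)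
    (G : ℕ → Fin K → Ω → ℝ) (arm : ℕ → Ω → Fin K) (l ks : Fin K) (s : ℕ) (ω : Ω) :
    ℕ × ℕ × ℝ × ℝ × EReal :=
  (pulls arm l s ω, pulls arm ks s ω, empMean X arm l s ω, empMean X arm ks s ω,
    rivalSample μ θs α β σ X G arm l ks s ω)

lemma measurable_duelData (harm : ∀ r < s, Measurable (arm r)) (hX : ∀ k i, Measurable (X k i))
    (hG : ∀ m, m ∉ ({l, ks} : Finset (Fin K)) → Measurable (G s m)) :
    Measurable (duelData μ θs α β σ X G arm l ks s) :=
  (measurable_pulls_of_lt harm l).prodMk ((measurable_pulls_of_lt harm ks).prodMk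
    ((measurable_empMean harm hX l).prodMk ((measurable_empMean harm hX ks).prodMk
      (measurable_rivalSample harm hX hG))))

end DuelData

section Comparison

variable {Θ Ω : Type*} [MeasurableSpace Ω] {P : Measure Ω} {K : ℕ}
  {μ : Fin K → Θ → ℝ} {θs : Θ} {ks k l : Fin K} {α β σ : ℝ} {X : Fin K → ℕ → Ω → ℝ}
  {G : ℕ → Fin K → Ω → ℝ} {arm : ℕ → Ω → Fin K} {s t : ℕ} {ω : Ω}

lemma IsTSC.gauss_pair [IsProbabilityMeasure P] (harm : IsTSC P μ α β σ X G arm) (hl : l ≠ ks)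
    (s : ℕ) : P.map (fun ω => (G s l ω, G s ks ω)) = stdGauss.prod stdGauss := by
  rw [(indepFun_iff_map_prod_eq_prod_map_map (harm.measurable_gauss s l).aemeasurable
    (harm.measurable_gauss s ks).aemeasurable).1 ((harm.indep_arms s).indepFun hl),
    harm.gauss, harm.gauss]

/-- The two compared Gaussians are independent of the past together with the other Gaussians of the
round. The duel data are measurable for the σ-algebra of the latter, so no explicit formula in these
variables is needed. -/
lemma IsTSC.indepFun_duelData [IsProbabilityMeasure P] (harm : IsTSC P μ α β σ X G arm)
    (hX : ∀ k i, Measurable (X k i)) (s : ℕ) :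
    IndepFun (duelData μ θs α β σ X G arm l ks s) (fun ω => (G s l ω, G s ks ω)) P := by
  set S : Finset (Fin K) := {l, ks} with hS
  set H : Ω → (Fin K → ℕ → ℝ) × (Fin s → Fin K × (Fin K → ℝ)) :=
    fun ω => ((fun k i => X k i ω), (fun r => (arm r ω, fun k => G r k ω))) with hHdef
  have hHm : Measurable H := by
    refine Measurable.prodMk ?_ ?_
    · exact measurable_pi_lambda _ fun k => measurable_pi_lambda _ fun i => hX k i
    · exact measurable_pi_lambda _ fun r => (harm.measurable r).prodMk
        (measurable_pi_lambda _ fun k => harm.measurable_gauss r k)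
  have hYm : Measurable (fun ω k => G s k ω) :=
    measurable_pi_lambda _ fun k => harm.measurable_gauss s k
  let f : (Fin K → ℝ) → ℝ × ℝ := fun x => (x l, x ks)
  let g : (Fin K → ℝ) → ((Sᶜ : Finset (Fin K)) → ℝ) := fun x m => x m
  have hf : Measurable f := by fun_prop
  have hg : Measurable g := by fun_prop
  have h2 : IndepFun (fun ω => f (fun k => G s k ω)) (fun ω => g (fun k => G s k ω)) P := by
    have h3 := (harm.indep_arms s).indepFun_finset S Sᶜ disjoint_compl_right
      (fun m => harm.measurable_gauss s m)
    have hl' : l ∈ S := by simp [hS]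
    have hks' : ks ∈ S := by simp [hS]
    exact h3.comp (φ := fun x : S → ℝ => (x ⟨l, hl'⟩, x ⟨ks, hks'⟩)) (ψ := id)
      (by fun_prop) measurable_id
  have h4 := (IndepFun.prodMk_of_indepFun hYm hHm hf hg (harm.indep_past s) h2).symm
  set Φ := fun ω => (H ω, g (fun k => G s k ω)) with hΦ
  rw [IndepFun_iff_Indep] at h4 ⊢
  refine indep_of_indep_of_le_left h4 ?_
  refine Measurable.comap_le ?_
  have hΦm : @Measurable _ _ (MeasurableSpace.comap Φ inferInstance) _ Φ := comap_measurable Φ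
  have hH' : @Measurable _ _ (MeasurableSpace.comap Φ inferInstance) _ H := measurable_fst.comp hΦm
  have hA : ∀ r < s, @Measurable _ _ (MeasurableSpace.comap Φ inferInstance) _ (arm r) := by
    intro r hr
    exact (((measurable_pi_apply (⟨r, hr⟩ : Fin s)).comp measurable_snd).fst).comp hH'
  have hX' : ∀ k i, @Measurable _ _ (MeasurableSpace.comap Φ inferInstance) _ (X k i) := by
    intro k i
    exact ((measurable_pi_apply i).comp ((measurable_pi_apply k).comp measurable_fst)).comp hH'
  have hG' : ∀ m, m ∉ S →
      @Measurable _ _ (MeasurableSpace.comap Φ inferInstance) _ (G s m) := by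
    intro m hm
    exact ((measurable_pi_apply (⟨m, by simpa using hm⟩ : (Sᶜ : Finset (Fin K)))).comp
      measurable_snd).comp hΦm
  exact @measurable_duelData _ _ (MeasurableSpace.comap Φ inferInstance)
    _ _ _ _ _ _ _ _ _ _ _ _ hA hX' hG'

/-- If arm `l` is pulled then its sample beats that of `ks` and those of the other arms. -/
lemma IsTSC.mem_firstWins (harm : IsTSC P μ α β σ X G arm)
    (hks : ∀ l, l ≠ ks → μ l θs < μ ks θs)
    (hg : θs ∈ confSet μ α σ X arm s ω) (hl : arm s ω = l)
    (hnl : 0 < pulls arm l s ω) (hnk : 0 < pulls arm ks s ω) :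
    (G s l ω, G s ks ω) ∈ firstWins (empMean X arm l s ω) (√(β * σ ^ 2 / pulls arm l s ω))
      (empMean X arm ks s ω) (√(β * σ ^ 2 / pulls arm ks s ω))
      (rivalSample μ θs α β σ X G arm l ks s ω) := by
  have h := harm.argmax s ω
  rw [hl] at h
  have hTl : tsSample β σ X G arm l s ω = ((empMean X arm l s ω +
      Real.sqrt (β * σ ^ 2 / (pulls arm l s ω : ℝ)) * G s l ω : ℝ) : EReal) := by
    rw [tsSample, if_neg hnl.ne']
  have hTk : tsSample β σ X G arm ks s ω = ((empMean X arm ks s ω +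
      Real.sqrt (β * σ ^ 2 / (pulls arm ks s ω : ℝ)) * G s ks ω : ℝ) : EReal) := by
    rw [tsSample, if_neg hnk.ne']
  refine ⟨?_, ?_⟩
  · have := h ks (best_mem_competitiveSet hks hg)
    rw [hTl, hTk] at this
    exact_mod_cast this
  · rw [rivalSample, if_pos hg]
    refine iSup_le fun m => ?_
    split_ifs with hm
    · have := h m.1 hm
      rwa [hTl] at this
    · exact bot_le

/-- If the sample of `ks` beats those of all other arms then `ks` is pulled. -/
lemma IsTSC.arm_eq_of_mem_secondWins (harm : IsTSC P μ α β σ X G arm)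
    (hks : ∀ l, l ≠ ks → μ l θs < μ ks θs)
    (hnl : 0 < pulls arm l s ω) (hnk : 0 < pulls arm ks s ω)
    (h : (G s l ω, G s ks ω) ∈ secondWins (empMean X arm l s ω) (√(β * σ ^ 2 / pulls arm l s ω))
      (empMean X arm ks s ω) (√(β * σ ^ 2 / pulls arm ks s ω))
      (rivalSample μ θs α β σ X G arm l ks s ω)) : arm s ω = ks := by
  obtain ⟨h1, h2⟩ := h
  simp only at h1 h2
  by_contra hne
  by_cases hg : θs ∈ confSet μ α σ X arm s ω
  · have hT := harm.argmax s ω ks (best_mem_competitiveSet hks hg)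
    rw [tsSample, if_neg hnk.ne'] at hT
    refine absurd hT (not_le.2 ?_)
    rcases eq_or_ne (arm s ω) l with hl | hl
    · rw [hl, tsSample, if_neg hnl.ne']
      exact_mod_cast h1
    · refine lt_of_le_of_lt ?_ h2
      rw [rivalSample, if_pos hg]
      have hm : arm s ω ∉ ({l, ks} : Finset (Fin K)) := by simp [hl, hne]
      refine le_iSup_of_le ⟨arm s ω, hm⟩ ?_
      rw [if_pos (harm.mem s ω)]
  -- The value `⊤` of the rival sample outside the correct event serves this case: no win of `ks` is
  -- recorded there.
  · rw [rivalSample, if_neg hg] at h2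
    exact absurd h2 not_top_lt

/-- The pulls of arm `l` are charged to pulls of the optimal arm. -/
lemma IsTSC.measure_duel_le [IsProbabilityMeasure P] (harm : IsTSC P μ α β σ X G arm)
    (hX : ∀ k i, Measurable (X k i))
    (hks : ∀ l, l ≠ ks → μ l θs < μ ks θs) (hl : l ≠ ks) (s : ℕ)
    {B : Set (ℕ × ℕ × ℝ × ℝ × EReal)} (hB : MeasurableSet B)
    {ρ : ℕ × ℕ × ℝ × ℝ × EReal → ENNReal} (hρ : Measurable ρ)
    (h : ∀ n j u v a, (n, j, u, v, a) ∈ B → 0 < n ∧ 0 < j ∧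
      (stdGauss.prod stdGauss)
        (firstWins u (√(β * σ ^ 2 / (n : ℝ))) v (√(β * σ ^ 2 / (j : ℝ))) a) ≤
      ρ (n, j, u, v, a) * (stdGauss.prod stdGauss)
        (secondWins u (√(β * σ ^ 2 / (n : ℝ))) v (√(β * σ ^ 2 / (j : ℝ))) a)) :
    P {ω | arm s ω = l ∧ θs ∈ confSet μ α σ X arm s ω ∧
        duelData μ θs α β σ X G arm l ks s ω ∈ B} ≤
      ∫⁻ ω in {ω | arm s ω = ks ∧ duelData μ θs α β σ X G arm l ks s ω ∈ B},
        ρ (duelData μ θs α β σ X G arm l ks s ω) ∂P := by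
  have hsq : Measurable (fun n : ℕ => √(β * σ ^ 2 / (n : ℝ))) := measurable_from_top
  refine le_trans (measure_mono ?_) ((measure_firstWins_le_lintegral
    (measurable_duelData (fun r _ => harm.measurable r) hX fun m _ => harm.measurable_gauss s m)
    ((harm.measurable_gauss s l).prodMk (harm.measurable_gauss s ks))
    (harm.indepFun_duelData (θs := θs) hX s) (harm.gauss_pair hl s)
    (u₀ := fun z => z.2.2.1) (s₁ := fun z => √(β * σ ^ 2 / (z.1 : ℝ)))
    (v₀ := fun z => z.2.2.2.1) (s₂ := fun z => √(β * σ ^ 2 / (z.2.1 : ℝ)))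
    (a := fun z => z.2.2.2.2) (ρ := ρ) (B := B) (by fun_prop) (hsq.comp measurable_fst)
    (by fun_prop) (hsq.comp measurable_snd.fst) (by fun_prop) hρ hB
    (fun z hz => (h _ _ _ _ _ hz).2.2)).trans ?_)
  · rintro ω ⟨h1, h2, h3⟩
    obtain ⟨hn, hj, -⟩ := h _ _ _ _ _ h3
    exact ⟨h3, harm.mem_firstWins hks h2 h1 hn hj⟩
  · refine lintegral_mono_set ?_
    rintro ω ⟨h3, h4⟩
    obtain ⟨hn, hj, -⟩ := h _ _ _ _ _ h3
    exact ⟨harm.arm_eq_of_mem_secondWins hks hn hj h4, h3⟩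

end Comparison

/-! ### Miss costs and the charge for a pull -/

section MissCost

/-- Twice the inverse probability that a Gaussian sample of mean `v` exceeds `y`, if `v < y`. -/
noncomputable def missCost (β σ y : ℝ) (n : ℕ) (v : ℝ) : ENNReal :=
  if v < y then 2 / stdGauss {g | y < v + √(β * σ ^ 2 / n) * g} else 0

lemma measurable_missCost (β σ y : ℝ) : Measurable (fun p : ℕ × ℝ => missCost β σ y p.1 p.2) := by
  refine measurable_from_prod_countable_right fun n => ?_
  unfold missCost
  refine Measurable.ite measurableSet_Iio ?_ measurable_const
  refine Measurable.div measurable_const ?_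
  have h : MeasurableSet {p : ℝ × ℝ | y < p.1 + √(β * σ ^ 2 / n) * p.2} :=
    measurableSet_lt (by fun_prop) (by fun_prop)
  exact measurable_measure_prodMk_left h

end MissCost

section WidthBounds

variable {α σ D J : ℝ} {b n : ℕ}

/-- `J` is the count at which the width is `D / 2`, so the width times `n` is `(D / 2) √(J n)`;
upper bounds for `√(J n)` then come from the arithmetic-geometric mean inequality. -/
lemma width_mul_sq (hα : 0 ≤ α) (hJ : D ^ 2 * J = 8 * α * σ ^ 2 * Real.log b) (n : ℕ) :
    (width α σ b n * n) ^ 2 = D ^ 2 / 4 * (J * n) := by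
  rw [mul_pow, width_sq hα]
  rcases Nat.eq_zero_or_pos n with rfl | hn
  · simp
  have hn' : (0 : ℝ) < n := by exact_mod_cast hn
  field_simp
  linarith

lemma width_mul_le (hα : 0 ≤ α) (hD : 0 ≤ D) (hJ : D ^ 2 * J = 8 * α * σ ^ 2 * Real.log b)
    {x : ℝ} (hx : 0 ≤ x) (h : J * n ≤ x ^ 2) : width α σ b n * n ≤ D / 2 * x := by
  refine abs_le_of_sq_le_sq' ?_ (by positivity) |>.2
  rw [width_mul_sq hα hJ]
  nlinarith [sq_nonneg D]

end WidthBounds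

section TwoArms

variable {Θ Ω : Type*} {K : ℕ} {μ : Fin K → Θ → ℝ} {θs : Θ} {ks l : Fin K} {α β σ : ℝ}
  {X : Fin K → ℕ → Ω → ℝ} {G : ℕ → Fin K → Ω → ℝ} {arm : ℕ → Ω → Fin K} {s : ℕ} {ω : Ω}

/-- Two arms leave no rival. The comparison without threshold then applies, which saves the factor
2. -/
lemma rivalSample_eq_bot (hK : K = 2) (hl : l ≠ ks) (hg : θs ∈ confSet μ α σ X arm s ω) :
    rivalSample μ θs α β σ X G arm l ks s ω = ⊥ := by
  rw [rivalSample, if_pos hg]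
  have : IsEmpty {m : Fin K // m ∉ ({l, ks} : Finset (Fin K))} := by
    subst hK
    refine ⟨fun m => m.2 ?_⟩
    have h := m.1.2
    have h1 := l.2
    have h2 := ks.2
    have h3 : (l : ℕ) ≠ ks := fun h => hl (Fin.ext h)
    simp only [Finset.mem_insert, Finset.mem_singleton, Fin.ext_iff]
    omega
  exact iSup_of_empty _

end TwoArms

section Charge

variable {Θ Ω : Type*} [MeasurableSpace Ω] {P : Measure Ω} {K : ℕ}
  {μ : Fin K → Θ → ℝ} {θs : Θ} {ks k l : Fin K} {α β σ D J : ℝ} {X : Fin K → ℕ → Ω → ℝ}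
  {G : ℕ → Fin K → Ω → ℝ} {arm : ℕ → Ω → Fin K} {s t b : ℕ} {ω : Ω}

/-- The ratio of the pull counts needed for a comparison with the optimal arm and the charge per
pull of the optimal arm are both `1` for two arms and `2` otherwise. -/
def chargeFactor (K : ℕ) : ℕ := if K = 2 then 1 else 2

/-- The confidence bounds put the data in a set `B` where one of the Gaussian comparisons holds:
with the constant factor if the empirical mean of `ks` is at least `y`, with the miss cost
otherwise. -/
lemma IsTSC.measure_pull_le [IsProbabilityMeasure P] (harm : IsTSC P μ α β σ X G arm)
    (hX : ∀ k i, Measurable (X k i)) (hks : ∀ l, l ≠ ks → μ l θs < μ ks θs) (hl : l ≠ ks)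
    (hα : 0 ≤ α) (hβ : 0 < β) (hσ : 0 < σ) (hD : 0 < D) (hgap : D ≤ gapMin μ θs ks)
    (hJ : D ^ 2 * J = 8 * α * σ ^ 2 * Real.log b) (hs : s ≤ b) :
    P {ω | arm s ω = l ∧ θs ∈ confSet μ α σ X arm s ω ∧ chargeFactor K * J ≤ pulls arm l s ω ∧
        0 < pulls arm ks s ω ∧ (pulls arm ks s ω : ℝ) < J} ≤
      ∫⁻ ω in {ω | arm s ω = ks ∧ 0 < pulls arm ks s ω ∧ (pulls arm ks s ω : ℝ) < J},
        (chargeFactor K +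
          missCost β σ (μ ks θs - D / 2) (pulls arm ks s ω) (empMean X arm ks s ω)) ∂P := by
  set y := μ ks θs - D / 2 with hy
  have hgapl : μ l θs ≤ μ ks θs - D := by linarith [gapMin_le (μ := μ) (θs := θs) hl]
  set B : Set (ℕ × ℕ × ℝ × ℝ × EReal) := {z | 0 < z.1 ∧ 0 < z.2.1 ∧ (z.2.1 : ℝ) < J ∧
    z.2.1 ≤ z.1 ∧ z.2.2.1 ≤ y ∧ ((K = 2 ∧ z.2.2.2.2 = ⊥) ∨
      (K ≠ 2 ∧ z.2.1 * (y - z.2.2.2.1) ≤ z.1 * (y - z.2.2.1)))} with hBdef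
  have hcast1 : Measurable (fun z : ℕ × ℕ × ℝ × ℝ × EReal => (z.1 : ℝ)) :=
    measurable_from_top.comp measurable_fst
  have hcast2 : Measurable (fun z : ℕ × ℕ × ℝ × ℝ × EReal => (z.2.1 : ℝ)) :=
    measurable_from_top.comp measurable_snd.fst
  have hB : MeasurableSet B := by
    refine (measurable_fst (measurableSet_Ioi (a := 0))).inter
      ((measurable_snd.fst (measurableSet_Ioi (a := 0))).inter
      ((measurableSet_lt hcast2 measurable_const).inter
      ((measurableSet_le measurable_snd.fst measurable_fst).inter
      ((measurableSet_le measurable_snd.snd.fst measurable_const).inter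
      ((MeasurableSet.const _ |>.inter
        (measurable_snd.snd.snd.snd (measurableSet_singleton ⊥))).union
        (MeasurableSet.const _ |>.inter (measurableSet_le (hcast2.mul ?_) (hcast1.mul ?_))))))))
    · exact measurable_const.sub measurable_snd.snd.snd.fst
    · exact measurable_const.sub measurable_snd.snd.fst
  set ρ : ℕ × ℕ × ℝ × ℝ × EReal → ENNReal :=
    fun z => chargeFactor K + missCost β σ y z.2.1 z.2.2.2.1 with hρdef
  have hρ : Measurable ρ := measurable_const.add
    ((measurable_missCost β σ y).comp (measurable_snd.fst.prodMk measurable_snd.snd.snd.fst))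
  refine le_trans (measure_mono ?_) ((harm.measure_duel_le (θs := θs) hX hks hl s hB hρ ?_).trans
    (lintegral_mono_set ?_))
  · rintro ω ⟨h1, hg, h2, h3, h4⟩
    have hc : (1 : ℝ) ≤ chargeFactor K := by unfold chargeFactor; split_ifs <;> norm_num
    have hj : (0 : ℝ) < pulls arm ks s ω := by exact_mod_cast h3
    have hJ0 : 0 < J := hj.trans h4
    have hJn : J ≤ pulls arm l s ω := by nlinarith
    have hn : (0 : ℝ) < pulls arm l s ω := hJ0.trans_le hJn
    have hn' : 0 < pulls arm l s ω := by exact_mod_cast hn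
    have hjn : pulls arm ks s ω ≤ pulls arm l s ω := by
      have : (pulls arm ks s ω : ℝ) ≤ pulls arm l s ω := h4.le.trans hJn
      exact_mod_cast this
    have hl1 := (abs_lt.1 (hg l hn')).1
    have hk1 := (abs_lt.1 (hg ks h3)).2
    have hlw := width_mono hα (σ := σ) hs (pulls arm l s ω)
    have hkw := width_mono hα (σ := σ) hs (pulls arm ks s ω)
    set n : ℝ := (pulls arm l s ω : ℝ) with hndef
    set j : ℝ := (pulls arm ks s ω : ℝ) with hjdef
    have hwl : width α σ b (pulls arm l s ω) * n ≤ D / 2 * n :=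
      width_mul_le (n := pulls arm l s ω) hα hD.le hJ hn.le (by nlinarith)
    have huy : empMean X arm l s ω ≤ y := by
      have : width α σ b (pulls arm l s ω) ≤ D / 2 := le_of_mul_le_mul_right hwl hn
      linarith
    refine ⟨h1, hg, hn', h3, h4, hjn, huy, ?_⟩
    by_cases hK : K = 2
    · exact Or.inl ⟨hK, rivalSample_eq_bot hK hl hg⟩
    · refine Or.inr ⟨hK, ?_⟩
      change j * (y - empMean X arm ks s ω) ≤ n * (y - empMean X arm l s ω)
      have hc2 : (chargeFactor K : ℝ) = 2 := by simp [chargeFactor, hK]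
      rw [hc2] at h2
      -- With `√(J j) ≤ J/4 + j` and `√(J n) ≤ J + n/4`, the left side of the goal is at most `D J /
      -- 8` and the right side at least `(D / 2) (3 n / 4 - J)`, which is `D J / 4` or more once `n
      -- ≥ 2 J`.
      have e1 : width α σ b (pulls arm ks s ω) * j ≤ D / 2 * (J / 4 + j) :=
        width_mul_le hα hD.le hJ (by positivity) (by nlinarith [sq_nonneg (J / 4 - j)])
      have e2 : width α σ b (pulls arm l s ω) * n ≤ D / 2 * (J + n / 4) :=
        width_mul_le hα hD.le hJ (by positivity) (by nlinarith [sq_nonneg (J - n / 4)])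
      have e3 : j * (y - empMean X arm ks s ω) ≤ D / 2 * (J / 4) := by
        have : j * (y - empMean X arm ks s ω) ≤
            j * (width α σ b (pulls arm ks s ω) - D / 2) :=
          mul_le_mul_of_nonneg_left (by linarith) hj.le
        nlinarith
      have e4 : n * (D / 2 - width α σ b (pulls arm l s ω)) ≤
          n * (y - empMean X arm l s ω) :=
        mul_le_mul_of_nonneg_left (by linarith) hn.le
      nlinarith
  · rintro n j u v a ⟨h1, h2, -, h4, h5, h6⟩
    simp only at h1 h2 h4 h5 h6
    refine ⟨h1, h2, ?_⟩
    have hn : (0 : ℝ) < n := by exact_mod_cast h1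
    have hj : (0 : ℝ) < j := by exact_mod_cast h2
    have hjn : (j : ℝ) ≤ n := by exact_mod_cast h4
    have hs1 : 0 < √(β * σ ^ 2 / (n : ℝ)) := Real.sqrt_pos.2 (by positivity)
    have hs2 : 0 < √(β * σ ^ 2 / (j : ℝ)) := Real.sqrt_pos.2 (by positivity)
    have hs12 : √(β * σ ^ 2 / (n : ℝ)) ≤ √(β * σ ^ 2 / (j : ℝ)) :=
      Real.sqrt_le_sqrt (div_le_div_of_nonneg_left (by positivity) hj hjn)
    rcases lt_or_ge v y with hv | hv
    · refine (firstWins_le_div hs1 hs2 h5 hv ?_).trans (mul_le_mul' ?_ le_rfl)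
      · rcases h6 with ⟨-, ha⟩ | ⟨-, h6⟩
        · exact Or.inl ha
        · refine Or.inr ⟨hs12, ?_⟩
          rw [Real.sq_sqrt (by positivity), Real.sq_sqrt (by positivity), div_div_eq_mul_div,
            div_div_eq_mul_div]
          gcongr ?_ / _
          linarith
      · simp only [hρdef, missCost, if_pos hv]
        exact le_add_self
    · rcases h6 with ⟨hK, ha⟩ | ⟨hK, h6⟩
      · rw [ha]
        refine (firstWins_le hs2 (h5.trans hv)).trans ?_
        refine le_mul_of_one_le_left (zero_le) ?_
        simp [hρdef, chargeFactor, hK]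
      · refine (firstWins_le_two_mul hs1 hs12 (h5.trans hv)).trans (mul_le_mul' ?_ le_rfl)
        simp [hρdef, chargeFactor, hK]
  · rintro ω ⟨h1, -, h2, h3, -⟩
    exact ⟨h1, h2, h3⟩

end Charge

/-! ### Inverse Gaussian tails -/

section MillsRatio

lemma half_le_gaussianReal_Ioi (V : ℝ) : 1 / 2 ≤ gaussianReal V 1 (Set.Ioi V) := by
  have h : gaussianReal V 1 = stdGauss.map (fun x => V + x) := by
    rw [gaussianReal_map_const_add, zero_add]
  rw [h, Measure.map_apply (by fun_prop) measurableSet_Ioi]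
  have h2 : (fun x => V + x) ⁻¹' Set.Ioi V = Set.Ioi 0 := by ext x; simp
  have h3 := measurePreserving_neg_stdGauss.measure_preimage
    (measurableSet_Iic (a := (0 : ℝ))).nullMeasurableSet
  have h4 : (fun x : ℝ => -x) ⁻¹' Set.Iic 0 = Set.Ici 0 := by ext x; simp
  have : NullSingletonClass stdGauss := nullSingletonClass_gaussianReal one_ne_zero
  rw [h2, measure_congr Ioi_ae_eq_Ici, ← h4, h3]
  exact half_le_stdGauss_Iic le_rfl

/-- A lower bound for the Gaussian tail (Mills ratio). -/
lemma gaussianPDFReal_div_le_stdGauss_Ioi {V : ℝ} (hV : 0 ≤ V) :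
    ENNReal.ofReal (gaussianPDFReal 0 1 V / (1 + V)) ≤ stdGauss (Set.Ioi V) := by
  rw [stdGauss, gaussianReal_apply_eq_integral 0 one_ne_zero]
  refine ENNReal.ofReal_le_ofReal ?_
  set c : ℝ := (√(2 * Real.pi))⁻¹ with hc
  have hc0 : 0 < c := by positivity
  have hpdf : gaussianPDFReal 0 1 = fun x => c * Real.exp (-x ^ 2 / 2) := by
    rw [gaussianPDFReal_def]; simp [hc]
  rw [hpdf]
  -- Minus the derivative of `φ(x) / (1 + x)`, with `φ` the Gaussian density. The bracket is at most
  -- 1, so integrating from `V` to infinity compares it with the tail.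
  set f' : ℝ → ℝ := fun x => c * Real.exp (-x ^ 2 / 2) * (x / (1 + x) + 1 / (1 + x) ^ 2)
  have hf : ∀ x ∈ Set.Ici V,
      HasDerivAt (fun x => -(c * Real.exp (-x ^ 2 / 2) / (1 + x))) (f' x) x := by
    intro x hx
    have hx1 : 1 + x ≠ 0 := by have := hV.trans hx; positivity
    have h1 : HasDerivAt (fun x : ℝ => -x ^ 2 / 2) (-x) x := by
      have := ((hasDerivAt_pow 2 x).neg).div_const 2
      refine this.congr_deriv ?_
      push_cast
      ring
    have h2 := ((h1.exp.const_mul c).div ((hasDerivAt_id x).const_add 1) hx1).neg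
    refine h2.congr_deriv ?_
    simp only [f', id]
    field_simp
    ring
  have hf0 : ∀ x ∈ Set.Ioi V, 0 ≤ f' x := by
    intro x hx
    have : 0 < x := hV.trans_lt hx
    positivity
  have hlim : Tendsto (fun x => -(c * Real.exp (-x ^ 2 / 2) / (1 + x))) atTop (nhds 0) := by
    rw [← neg_zero]
    refine Tendsto.neg ?_
    have h1 : Tendsto (fun x : ℝ => c / (1 + x)) atTop (nhds 0) :=
      tendsto_const_nhds.div_atTop (tendsto_atTop_add_const_left _ _ tendsto_id)
    refine squeeze_zero' ?_ ?_ h1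
    · filter_upwards [eventually_ge_atTop 0] with x hx
      positivity
    · filter_upwards [eventually_ge_atTop 0] with x hx
      gcongr
      refine mul_le_of_le_one_right hc0.le (Real.exp_le_one_iff.2 ?_)
      have := sq_nonneg x
      linarith
  have h1 := integral_Ioi_of_hasDerivAt_of_nonneg' hf hf0 hlim
  have h2 := integrableOn_Ioi_deriv_of_nonneg' hf hf0 hlim
  have h3 : IntegrableOn (fun x => c * Real.exp (-x ^ 2 / 2)) (Set.Ioi V) := by
    rw [← hpdf]; exact (integrable_gaussianPDFReal 0 1).integrableOn
  calc c * Real.exp (-V ^ 2 / 2) / (1 + V) = ∫ x in Set.Ioi V, f' x := by rw [h1]; ring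
    _ ≤ _ := by
      refine setIntegral_mono_on h2 h3 measurableSet_Ioi fun x hx => ?_
      have hx0 : 0 < x := hV.trans_lt hx
      refine mul_le_of_le_one_right (by positivity) ?_
      rw [div_add_div _ _ (by positivity) (by positivity), div_le_one (by positivity)]
      nlinarith [sq_nonneg x, mul_pos hx0 hx0, mul_pos (mul_pos hx0 hx0) hx0]

/-- The inverse tail is at most `(1 + V) / φ(V)`, whose growth `exp (V² / 2)` is borderline for a
sub-Gaussian expectation. Multiplying by the mass, at least 1/2, of a Gaussian centred at `V` beyond
`V` rewrites it as a mixture of `exp (u V)`, to which the moment bound applies for each `u`. -/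
lemma inv_stdGauss_Ioi_le {V : ℝ} (hV : 0 ≤ V) :
    (stdGauss (Set.Ioi V))⁻¹ ≤ 2 * ∫⁻ u in Set.Ioi (0 : ℝ),
      ENNReal.ofReal ((1 + u) * Real.exp (u * V - u ^ 2 / 2)) := by
  have hpos := gaussianPDFReal_pos 0 1 V one_ne_zero
  set q := gaussianPDFReal 0 1 V / (1 + V) with hq
  have hq0 : 0 < q := by positivity
  have h1 : (stdGauss (Set.Ioi V))⁻¹ ≤ ENNReal.ofReal q⁻¹ := by
    rw [ENNReal.ofReal_inv_of_pos hq0]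
    exact ENNReal.inv_le_inv.2 (gaussianPDFReal_div_le_stdGauss_Ioi hV)
  have h2 : ENNReal.ofReal q⁻¹ * (1 / 2) ≤ ∫⁻ u in Set.Ioi (0 : ℝ),
      ENNReal.ofReal ((1 + u) * Real.exp (u * V - u ^ 2 / 2)) := by
    calc ENNReal.ofReal q⁻¹ * (1 / 2)
        ≤ ENNReal.ofReal q⁻¹ * ∫⁻ u in Set.Ioi V, gaussianPDF V 1 u := by
          rw [← gaussianReal_apply V one_ne_zero]
          exact mul_le_mul' le_rfl (half_le_gaussianReal_Ioi V)
      _ = ∫⁻ u in Set.Ioi V, ENNReal.ofReal q⁻¹ * gaussianPDF V 1 u :=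
          (lintegral_const_mul _ (measurable_gaussianPDF V 1)).symm
      _ ≤ ∫⁻ u in Set.Ioi V, ENNReal.ofReal ((1 + u) * Real.exp (u * V - u ^ 2 / 2)) := by
          refine setLIntegral_mono' measurableSet_Ioi fun u hu => ?_
          rw [gaussianPDF, ← ENNReal.ofReal_mul (by positivity)]
          refine ENNReal.ofReal_le_ofReal ?_
          have e : Real.exp (u * V - u ^ 2 / 2) =
              Real.exp (-(u - V) ^ 2 / 2) / Real.exp (-V ^ 2 / 2) := by
            rw [← Real.exp_sub]; congr 1; ring
          rw [hq, gaussianPDFReal_def, gaussianPDFReal_def, e]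
          have hc : 0 < √(2 * Real.pi) := by positivity
          simp only [NNReal.coe_one, mul_one, sub_zero]
          rw [inv_div]
          have : (1 + V) / ((√(2 * Real.pi))⁻¹ * Real.exp (-V ^ 2 / 2)) *
              ((√(2 * Real.pi))⁻¹ * Real.exp (-(u - V) ^ 2 / 2)) =
              (1 + V) * (Real.exp (-(u - V) ^ 2 / 2) / Real.exp (-V ^ 2 / 2)) := by
            field_simp
          rw [this]
          have hu' : V ≤ u := le_of_lt hu
          gcongr
      _ ≤ _ := lintegral_mono_set (Set.Ioi_subset_Ioi hV)
  refine h1.trans ?_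
  calc ENNReal.ofReal q⁻¹ = 2 * (ENNReal.ofReal q⁻¹ * (1 / 2)) := by
        rw [mul_left_comm, one_div, ENNReal.mul_inv_cancel (by simp) (by simp), mul_one]
    _ ≤ _ := mul_le_mul' le_rfl h2

lemma lintegral_one_add_mul_exp {c : ℝ} (hc : 0 < c) :
    ∫⁻ u in Set.Ioi (0 : ℝ), ENNReal.ofReal ((1 + u) * Real.exp (-(c * u))) =
      ENNReal.ofReal (1 / c + 1 / c ^ 2) := by
  have hf : ∀ x ∈ Set.Ici (0 : ℝ), HasDerivAt
      (fun u => -(Real.exp (-(c * u)) * ((1 + u) / c + 1 / c ^ 2)))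
      ((1 + x) * Real.exp (-(c * x))) x := by
    intro x _
    have h1 : HasDerivAt (fun u : ℝ => -(c * u)) (-c) x :=
      ((hasDerivAt_id x).const_mul c).neg.congr_deriv (by simp)
    have h2 : HasDerivAt (fun u : ℝ => (1 + u) / c + 1 / c ^ 2) (1 / c) x := by
      simpa using (((hasDerivAt_id x).const_add 1).div_const c).add_const (1 / c ^ 2)
    refine (h1.exp.mul h2).neg.congr_deriv ?_
    field_simp
    ring
  have hf0 : ∀ x ∈ Set.Ioi (0 : ℝ), 0 ≤ (1 + x) * Real.exp (-(c * x)) := by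
    intro x hx
    have : (0 : ℝ) < x := hx
    positivity
  have hlim : Tendsto (fun u : ℝ => -(Real.exp (-(c * u)) * ((1 + u) / c + 1 / c ^ 2)))
      atTop (nhds 0) := by
    have hcu : Tendsto (fun u : ℝ => c * u) atTop atTop := tendsto_id.const_mul_atTop hc
    have h0 := (Real.tendsto_pow_mul_exp_neg_atTop_nhds_zero 0).comp hcu
    have h1 := (Real.tendsto_pow_mul_exp_neg_atTop_nhds_zero 1).comp hcu
    have h := ((h0.const_mul (1 / c + 1 / c ^ 2)).add (h1.const_mul (1 / c ^ 2))).neg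
    simp only [mul_zero, add_zero, neg_zero] at h
    refine h.congr fun u => ?_
    simp only [Function.comp_apply, pow_zero, pow_one]
    field_simp
    ring
  have h1 := integral_Ioi_of_hasDerivAt_of_nonneg' hf hf0 hlim
  have h2 := integrableOn_Ioi_deriv_of_nonneg' hf hf0 hlim
  rw [← ofReal_integral_eq_lintegral_ofReal h2
    ((ae_restrict_iff' measurableSet_Ioi).2 (Eventually.of_forall hf0)), h1]
  simp

end MillsRatio

/-! ### Expected miss cost at a fixed pull count -/

section ExpectedMissCost

/-- For `β ≥ 1` the sample has deviation at least `σ / √n`, which reduces the cost to an inverse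
tail at `V = (y - v) √n / σ`. A cost is due only if `V > 0`, so the factor `exp (a V / 4) ≥ 1` may
be inserted; it produces exponential decay in `a²`. -/
lemma missCost_le {β σ y v a : ℝ} {n : ℕ} (hβ : 1 ≤ β) (hσ : 0 < σ) (hn : 0 < n) (ha : 0 ≤ a) :
    missCost β σ y n v ≤ 4 * ∫⁻ u in Set.Ioi (0 : ℝ), ENNReal.ofReal
      ((1 + u) * Real.exp ((u + a / 4) * ((y - v) * √n / σ) - u ^ 2 / 2)) := by
  unfold missCost
  split_ifs with hv
  · have hn' : (0 : ℝ) < n := by exact_mod_cast hn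
    have hsn : 0 < √(n : ℝ) := Real.sqrt_pos.2 hn'
    set V := (y - v) * √n / σ with hV
    have hV0 : 0 ≤ V := by have := sub_pos.2 hv; positivity
    have h1 : stdGauss (Set.Ioi V) ≤ stdGauss {g | y < v + √(β * σ ^ 2 / n) * g} := by
      refine measure_mono fun g hg => ?_
      have hg' : V < g := hg
      have h2 : σ / √n ≤ √(β * σ ^ 2 / n) := by
        refine Real.le_sqrt_of_sq_le ?_
        rw [div_pow, Real.sq_sqrt hn'.le]
        gcongr
        nlinarith [sq_nonneg σ]
      have h3 : σ / √n * V = y - v := by rw [hV]; field_simp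
      have h4 : σ / √n * V < σ / √n * g := mul_lt_mul_of_pos_left hg' (by positivity)
      have h5 : σ / √n * g ≤ √(β * σ ^ 2 / n) * g :=
        mul_le_mul_of_nonneg_right h2 (hV0.trans hg'.le)
      show y < v + √(β * σ ^ 2 / n) * g
      linarith
    calc 2 / stdGauss {g | y < v + √(β * σ ^ 2 / n) * g}
        ≤ 2 * (stdGauss (Set.Ioi V))⁻¹ := by
          rw [div_eq_mul_inv]
          exact mul_le_mul' le_rfl (ENNReal.inv_le_inv.2 h1)
      _ ≤ 2 * (2 * ∫⁻ u in Set.Ioi (0 : ℝ),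
            ENNReal.ofReal ((1 + u) * Real.exp (u * V - u ^ 2 / 2))) :=
          mul_le_mul' le_rfl (inv_stdGauss_Ioi_le hV0)
      _ ≤ _ := by
          rw [← mul_assoc]
          norm_num
          refine mul_le_mul' le_rfl (setLIntegral_mono' measurableSet_Ioi fun u hu => ?_)
          have hu' : (0 : ℝ) < u := hu
          refine ENNReal.ofReal_le_ofReal ?_
          gcongr
          linarith
  · exact zero_le

variable {Ω : Type*} [MeasurableSpace Ω] {P : Measure Ω} {K : ℕ} {X : Fin K → ℕ → Ω → ℝ}
  {m : Fin K → ℝ} {σ : ℝ}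

lemma IsRewardTable.lintegral_exp_deficit_le (hX : IsRewardTable P X m σ) (hσ : 0 < σ) (k : Fin K)
    {n : ℕ} (hn : 0 < n) {a y : ℝ} (ha : (m k - y) * √n / σ = a) (u : ℝ) :
    ∫⁻ ω, ENNReal.ofReal
        (Real.exp (u * ((y - (∑ i ∈ Finset.range n, X k i ω) / n) * √n / σ))) ∂P ≤
      ENNReal.ofReal (Real.exp (u ^ 2 / 2 - u * a)) := by
  have hn' : (0 : ℝ) < n := by exact_mod_cast hn
  have hsn : 0 < √(n : ℝ) := Real.sqrt_pos.2 hn'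
  have hsq : √(n : ℝ) ^ 2 = n := Real.sq_sqrt hn'.le
  obtain ⟨h1, h2⟩ := hX.mgf_sum_le k n (-(u / (σ * √n)))
  have e : ∀ ω, Real.exp (u * ((y - (∑ i ∈ Finset.range n, X k i ω) / n) * √n / σ)) =
      Real.exp (-(u * a)) *
        Real.exp (-(u / (σ * √n)) * ∑ i ∈ Finset.range n, (X k i ω - m k)) := by
    intro ω
    rw [← Real.exp_add, ← ha]
    congr 1
    simp only [Finset.sum_sub_distrib, Finset.sum_const, Finset.card_range, nsmul_eq_mul]
    field_simp
    rw [hsq]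
    field_simp
    ring
  simp_rw [e]
  rw [← ofReal_integral_eq_lintegral_ofReal (h1.const_mul _)
    (Eventually.of_forall fun ω => by positivity), integral_const_mul]
  refine ENNReal.ofReal_le_ofReal ?_
  calc _ ≤ Real.exp (-(u * a)) * Real.exp (n * σ ^ 2 * (-(u / (σ * √n))) ^ 2 / 2) :=
        mul_le_mul_of_nonneg_left h2 (Real.exp_pos _).le
    _ = _ := by
        rw [← Real.exp_add]
        congr 1
        rw [neg_sq, div_pow, mul_pow, hsq]
        field_simp
        ring

/-- After exchanging the integrals, the moment bound at `u + a/4` contributes `u² / 2`, which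
cancels the `-u² / 2` of the mixture. What is left is `exp (-7 a² / 32 - 3 a u / 4)`, integrable
against `1 + u`. -/
lemma IsRewardTable.lintegral_missCost_le [IsProbabilityMeasure P] (hX : IsRewardTable P X m σ)
    (hσ : 0 < σ) (k : Fin K) {β : ℝ} (hβ : 1 ≤ β) {n : ℕ} (hn : 0 < n) {a y : ℝ}
    (ha : (m k - y) * √n / σ = a) (ha0 : 0 < a) :
    ∫⁻ ω, missCost β σ y n ((∑ i ∈ Finset.range n, X k i ω) / n) ∂P ≤
      ENNReal.ofReal (Real.exp (-(7 / 32 * a ^ 2)) * (4 / 3 + 112 / 9 / a ^ 2)) := by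
  have hmeas : Measurable fun ω => (∑ i ∈ Finset.range n, X k i ω) / n :=
    (Finset.measurable_sum _ fun i _ => hX.measurable k i).div_const _
  have hF : Measurable fun p : ℝ × ℝ => ENNReal.ofReal ((1 + p.2) * Real.exp ((p.2 + a / 4) *
      ((y - p.1) * √n / σ) - p.2 ^ 2 / 2)) := by fun_prop
  have hmeas2 : Measurable fun p : Ω × ℝ => (∑ i ∈ Finset.range n, X k i p.1) / n :=
    hmeas.comp measurable_fst
  have hF' := hF.comp (hmeas2.prodMk measurable_snd)
  calc ∫⁻ ω, missCost β σ y n ((∑ i ∈ Finset.range n, X k i ω) / n) ∂P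
      ≤ ∫⁻ ω, 4 * (∫⁻ u in Set.Ioi (0 : ℝ), ENNReal.ofReal ((1 + u) * Real.exp ((u + a / 4) *
          ((y - (∑ i ∈ Finset.range n, X k i ω) / n) * √n / σ) - u ^ 2 / 2))) ∂P :=
        lintegral_mono fun ω => missCost_le hβ hσ hn ha0.le
    _ = 4 * ∫⁻ ω, (∫⁻ u in Set.Ioi (0 : ℝ), ENNReal.ofReal ((1 + u) * Real.exp ((u + a / 4) *
          ((y - (∑ i ∈ Finset.range n, X k i ω) / n) * √n / σ) - u ^ 2 / 2))) ∂P := by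
        exact lintegral_const_mul _ hF'.lintegral_prod_right'
    _ = 4 * ∫⁻ u in Set.Ioi (0 : ℝ), ∫⁻ ω, ENNReal.ofReal ((1 + u) * Real.exp ((u + a / 4) *
          ((y - (∑ i ∈ Finset.range n, X k i ω) / n) * √n / σ) - u ^ 2 / 2)) ∂P := by
        congr 1
        exact lintegral_lintegral_swap hF'.aemeasurable
    _ ≤ 4 * ∫⁻ u in Set.Ioi (0 : ℝ), ENNReal.ofReal (Real.exp (-(7 / 32 * a ^ 2))) *
          ENNReal.ofReal ((1 + u) * Real.exp (-(3 / 4 * a * u))) := by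
        refine mul_le_mul' le_rfl (setLIntegral_mono' measurableSet_Ioi fun u hu => ?_)
        have hu' : (0 : ℝ) < u := hu
        have e : ∀ x : ℝ, ENNReal.ofReal ((1 + u) * Real.exp ((u + a / 4) * x - u ^ 2 / 2)) =
            ENNReal.ofReal ((1 + u) * Real.exp (-(u ^ 2 / 2))) *
              ENNReal.ofReal (Real.exp ((u + a / 4) * x)) := by
          intro x
          rw [← ENNReal.ofReal_mul (by positivity), mul_assoc, ← Real.exp_add]
          congr 3
          ring
        simp_rw [e]
        rw [lintegral_const_mul _ (by fun_prop)]
        refine (mul_le_mul' le_rfl (hX.lintegral_exp_deficit_le hσ k hn ha _)).trans_eq ?_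
        rw [← ENNReal.ofReal_mul (by positivity), ← ENNReal.ofReal_mul (by positivity),
          mul_assoc, ← Real.exp_add, mul_left_comm, ← Real.exp_add]
        congr 3
        ring
    _ = 4 * (ENNReal.ofReal (Real.exp (-(7 / 32 * a ^ 2))) *
          ENNReal.ofReal (1 / (3 / 4 * a) + 1 / (3 / 4 * a) ^ 2)) := by
        rw [lintegral_const_mul _ (by fun_prop), lintegral_one_add_mul_exp (by positivity)]
    _ ≤ _ := by
        rw [show (4 : ENNReal) = ENNReal.ofReal 4 by simp, ← ENNReal.ofReal_mul (by positivity),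
          ← ENNReal.ofReal_mul (by positivity)]
        refine ENNReal.ofReal_le_ofReal ?_
        rw [mul_left_comm]
        refine mul_le_mul_of_nonneg_left ?_ (Real.exp_pos _).le
        -- This trades `1 / a` for a constant and `1 / a²`, so that the sum over counts involves
        -- only geometric and logarithmic series.
        have h : 4 / a ≤ 1 + 4 / a ^ 2 := by
          rw [← sub_nonneg]
          have : 1 + 4 / a ^ 2 - 4 / a = (1 - 2 / a) ^ 2 := by field_simp; ring
          rw [this]; positivity
        have e : 4 * (1 / (3 / 4 * a) + 1 / (3 / 4 * a) ^ 2) =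
            4 / 3 * (4 / a) + 64 / 9 / a ^ 2 := by
          field_simp; ring
        have e2 : 112 / 9 / a ^ 2 = 4 / 3 * (4 / a ^ 2) + 64 / 9 / a ^ 2 := by field_simp; ring
        rw [e, e2]
        linarith

end ExpectedMissCost

/-! ### Summation over pull counts -/

section MissCostSum

/-- With `x = exp (-b)` these are partial sums of `∑ x^j` and of `∑ x^j / j = -log (1 - x)`. -/
lemma sum_exp_div_le {b r : ℝ} (hb : 0 < b) (hr : 0 ≤ r) {A B : ℝ} (hA : 0 ≤ A) (hB : 0 ≤ B)
    (M : ℕ) :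
    ∑ j ∈ Finset.Icc 1 M, Real.exp (-(b * j)) * (A + B * r / j) ≤
      A * (1 / (Real.exp b - 1)) + B * r * Real.log (1 + 1 / (Real.exp b - 1)) := by
  set x := Real.exp (-b) with hx
  have hx0 : 0 < x := Real.exp_pos _
  have hx1 : x < 1 := by rw [hx]; exact Real.exp_lt_one_iff.2 (by linarith)
  have hexp : Real.exp b = x⁻¹ := by rw [hx, Real.exp_neg, inv_inv]
  have hq : 1 / (Real.exp b - 1) = x * (1 - x)⁻¹ := by
    rw [hexp]
    have : 1 - x ≠ 0 := by linarith
    field_simp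
  have hl : Real.log (1 + 1 / (Real.exp b - 1)) = -Real.log (1 - x) := by
    rw [hq, ← Real.log_inv]
    congr 1
    have : 1 - x ≠ 0 := by linarith
    field_simp
    ring
  have e : ∀ j : ℕ, Real.exp (-(b * j)) = x ^ j := by
    intro j; rw [hx, ← Real.exp_nat_mul]; congr 1; ring
  have hsum : ∀ f : ℕ → ℝ, ∑ j ∈ Finset.Icc 1 M, f j = ∑ j ∈ Finset.range M, f (j + 1) := by
    intro f
    rw [Finset.range_eq_Ico, Finset.sum_Ico_add' f 0 M 1]
    rfl
  have h1 : ∑ j ∈ Finset.Icc 1 M, x ^ j ≤ x * (1 - x)⁻¹ := by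
    rw [hsum]
    have h : HasSum (fun j => x ^ (j + 1)) (x * (1 - x)⁻¹) := by
      simpa [pow_succ, mul_comm] using (hasSum_geometric_of_lt_one hx0.le hx1).mul_left x
    exact sum_le_hasSum _ (fun j _ => by positivity) h
  have h2 : ∑ j ∈ Finset.Icc 1 M, x ^ j / j ≤ -Real.log (1 - x) := by
    rw [hsum]
    have h : HasSum (fun j : ℕ => x ^ (j + 1) / ((j + 1 : ℕ) : ℝ)) (-Real.log (1 - x)) := by
      simpa using Real.hasSum_pow_div_log_of_abs_lt_one (x := x)
        (by rw [abs_of_pos hx0]; exact hx1)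
    exact sum_le_hasSum _ (fun j _ => by positivity) h
  rw [hl, hq]
  calc _ = A * ∑ j ∈ Finset.Icc 1 M, x ^ j + B * r * ∑ j ∈ Finset.Icc 1 M, x ^ j / j := by
        rw [Finset.mul_sum, Finset.mul_sum, ← Finset.sum_add_distrib]
        refine Finset.sum_congr rfl fun j _ => ?_
        rw [e]; ring
    _ ≤ _ := by gcongr

/-- The expected total miss cost is at most half of the threshold `t`. -/
lemma missCost_numeric {t : ℕ} (ht : 2 ≤ t) {r : ℝ} (hr0 : 0 < r)
    (hr : 108 * Real.log t * r ≤ t) :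
    4 / 3 * (1 / (Real.exp (7 / (128 * r)) - 1)) +
      448 / 9 * r * Real.log (1 + 1 / (Real.exp (7 / (128 * r)) - 1)) ≤ t / 2 := by
  have ht' : (2 : ℝ) ≤ t := by exact_mod_cast ht
  have hL : 0 < Real.log t := Real.log_pos (by linarith)
  set b := 7 / (128 * r) with hb
  have hb0 : 0 < b := by positivity
  have hbr : b * r = 7 / 128 := by rw [hb]; field_simp
  -- The constant is `108 · 7 / 128`, rounded down.
  have hbL : 5.9 * Real.log t ≤ b * t := by
    have : b * (108 * Real.log t * r) ≤ b * t := mul_le_mul_of_nonneg_left hr hb0.le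
    nlinarith
  have hexp : 1 + b + b ^ 2 / 2 ≤ Real.exp b := Real.quadratic_le_exp_of_nonneg hb0.le
  have hb2 := sq_nonneg b
  have hpos : 0 < Real.exp b - 1 := by linarith
  -- The main argument uses `log t ≥ 1`, which fails at `t = 2`.
  rcases Nat.lt_or_ge t 3 with h3 | h3
  · have : t = 2 := by omega
    subst this
    have hl2 := Real.log_two_gt_d9
    push_cast at *
    have hb1 : 2.04 ≤ b := by nlinarith
    have hr1 : r ≤ 0.027 := by nlinarith
    have hq : 1 / (Real.exp b - 1) ≤ 0.25 := by
      rw [div_le_iff₀ hpos]; nlinarith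
    have hq0 : 0 ≤ 1 / (Real.exp b - 1) := by positivity
    have hlog : Real.log (1 + 1 / (Real.exp b - 1)) ≤ 0.25 := by
      have := Real.log_le_sub_one_of_pos (show 0 < 1 + 1 / (Real.exp b - 1) by positivity)
      linarith
    nlinarith
  · have h3' : (3 : ℝ) ≤ t := by exact_mod_cast h3
    have hL1 : 1 ≤ Real.log t := by
      rw [Real.le_log_iff_exp_le (by linarith)]
      linarith [Real.exp_one_lt_three]
    have hq : 1 / (Real.exp b - 1) ≤ t / (5.9 * Real.log t) := by
      rw [div_le_div_iff₀ hpos (by positivity)]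
      nlinarith
    have hq1 : 1 / (Real.exp b - 1) ≤ 0.17 * t := by
      refine hq.trans ?_
      rw [div_le_iff₀ (by positivity)]
      nlinarith
    have hq0 : 0 ≤ 1 / (Real.exp b - 1) := by positivity
    -- For `t ≥ 3`, `1 + 0.17 t ≤ 0.504 t`; then `log 0.504 ≤ 0.504 - 1`.
    have hlog : Real.log (1 + 1 / (Real.exp b - 1)) ≤ Real.log t - 0.496 := by
      calc _ ≤ Real.log (t * 0.504) := Real.log_le_log (by positivity) (by nlinarith)
        _ = Real.log t + Real.log 0.504 := Real.log_mul (by positivity) (by norm_num)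
        _ ≤ _ := by
          have := Real.log_le_sub_one_of_pos (show (0 : ℝ) < 0.504 by norm_num)
          linarith
    have h1 : 448 / 9 * r * Real.log (1 + 1 / (Real.exp b - 1)) ≤
        448 / 9 * r * (Real.log t - 0.496) := by gcongr
    have h2 : 448 / 9 * r * (Real.log t - 0.496) ≤
        448 / 972 * t * (Real.log t - 0.496) / Real.log t := by
      rw [le_div_iff₀ hL]
      have : (0 : ℝ) ≤ Real.log t - 0.496 := by linarith
      nlinarith
    have h3 : 4 / 3 * (t / (5.9 * Real.log t)) +
        448 / 972 * t * (Real.log t - 0.496) / Real.log t ≤ t / 2 := by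
      have : 4 / 3 * ((t : ℝ) / (5.9 * Real.log t)) +
        448 / 972 * t * (Real.log t - 0.496) / Real.log t =
        (4 / 3 / 5.9 + 448 / 972 * (Real.log t - 0.496)) * t / Real.log t := by
        field_simp
      rw [this, div_le_iff₀ hL]
      nlinarith
    linarith

end MissCostSum

/-! ### Total miss cost of the algorithm -/

section TotalMissCost

variable {Θ Ω : Type*} [MeasurableSpace Ω] {P : Measure Ω} {K : ℕ}
  {μ : Fin K → Θ → ℝ} {θs : Θ} {ks k l : Fin K} {α β σ D J y : ℝ} {X : Fin K → ℕ → Ω → ℝ}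
  {G : ℕ → Fin K → Ω → ℝ} {arm : ℕ → Ω → Fin K} {m : Fin K → ℝ}

/-- Since `K α ≥ 4`, the choice of `D` gives `108 r log τ ≤ τ` for `r = σ² / D²`, as the numerical
estimate requires. With `a = D √j / (2 σ)` one has `a² = j / (4 r)`. -/
lemma IsRewardTable.sum_lintegral_missCost_le [IsProbabilityMeasure P] (hX : IsRewardTable P X m σ)
    (hσ : 0 < σ) (k : Fin K) (hK : 2 ≤ K) (hα : 2 ≤ α) (hβ : 1 ≤ β) {τ : ℕ} (hτ : 2 ≤ τ)
    (hD : 0 < D) (hDτ : D ^ 2 * τ = 27 * (K * α * σ ^ 2 * Real.log τ)) (M : ℕ) :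
    ∑ j ∈ Finset.Icc 1 M, ∫⁻ ω,
        missCost β σ (m k - D / 2) j ((∑ i ∈ Finset.range j, X k i ω) / j) ∂P ≤
      ENNReal.ofReal (τ / 2) := by
  set r := σ ^ 2 / D ^ 2 with hr
  have hr0 : 0 < r := by positivity
  have hrD : r * D ^ 2 = σ ^ 2 := by rw [hr]; field_simp
  have hτ1 : (1 : ℝ) < τ := by exact_mod_cast hτ
  have hL : 0 < Real.log τ := Real.log_pos hτ1
  have hKα : (4 : ℝ) ≤ K * α := by
    have : (2 : ℝ) ≤ K := by exact_mod_cast hK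
    nlinarith
  have hr1 : 108 * Real.log τ * r ≤ τ := by
    have h1 : 108 * Real.log τ * σ ^ 2 ≤ D ^ 2 * τ := by
      rw [hDτ]
      have : 0 ≤ σ ^ 2 * Real.log τ := by positivity
      nlinarith
    rw [hr, mul_div_assoc', div_le_iff₀ (by positivity)]
    linarith
  have hterm : ∀ j ∈ Finset.Icc 1 M, ∫⁻ ω,
      missCost β σ (m k - D / 2) j ((∑ i ∈ Finset.range j, X k i ω) / j) ∂P ≤
      ENNReal.ofReal (Real.exp (-(7 / (128 * r) * j)) * (4 / 3 + 448 / 9 * r / j)) := by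
    intro j hj
    have hj0 : 0 < j := (Finset.mem_Icc.1 hj).1
    have hj' : (0 : ℝ) < j := by exact_mod_cast hj0
    have hsj : 0 < √(j : ℝ) := Real.sqrt_pos.2 hj'
    have hsq : √(j : ℝ) ^ 2 = j := Real.sq_sqrt hj'.le
    refine (hX.lintegral_missCost_le hσ k hβ hj0 (a := D / 2 * √j / σ)
      (by rw [sub_sub_cancel]) (by positivity)).trans_eq ?_
    have ha : (D / 2 * √(j : ℝ) / σ) ^ 2 = j / (4 * r) := by
      rw [div_pow, mul_pow, hsq, ← hrD]
      field_simp
      norm_num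
    rw [ha]
    congr 3
    · field_simp; norm_num
    · field_simp; norm_num
  refine (Finset.sum_le_sum hterm).trans ?_
  rw [← ENNReal.ofReal_sum_of_nonneg fun j _ => by positivity]
  exact ENNReal.ofReal_le_ofReal ((sum_exp_div_le (by positivity) hr0.le (by norm_num)
    (by norm_num) M).trans (missCost_numeric hτ hr0 hr1))

/-- The expected miss cost of round `s + 1`, if that round pulls the arm `ks`. -/
noncomputable def roundMissCost (P : Measure Ω) (β σ y : ℝ) (X : Fin K → ℕ → Ω → ℝ)
    (arm : ℕ → Ω → Fin K) (ks : Fin K) (s : ℕ) : ENNReal :=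
  ∫⁻ ω in {ω | arm s ω = ks ∧ 0 < pulls arm ks s ω},
    missCost β σ y (pulls arm ks s ω) (empMean X arm ks s ω) ∂P

/-- Distinct pulls of `ks` have distinct counts. The sum over random rounds is therefore dominated,
pointwise, by a sum over counts, where the means are those of a fixed number of rewards. -/
lemma sum_roundMissCost_le (harm : ∀ t, Measurable (arm t)) (hX : ∀ k i, Measurable (X k i))
    (ks : Fin K) (T : ℕ) :
    ∑ s ∈ Finset.range T, roundMissCost P β σ y X arm ks s ≤
      ∑ j ∈ Finset.Icc 1 T, ∫⁻ ω,
        missCost β σ y j ((∑ i ∈ Finset.range j, X ks i ω) / j) ∂P := by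
  have hA : ∀ s, MeasurableSet {ω | arm s ω = ks ∧ 0 < pulls arm ks s ω} := fun s =>
    (harm s (measurableSet_singleton ks)).inter
      (measurable_pulls harm ks s (measurableSet_Ioi (a := 0)))
  have hf : ∀ s, Measurable fun ω =>
      missCost β σ y (pulls arm ks s ω) (empMean X arm ks s ω) := fun s =>
    (measurable_missCost β σ y).comp ((measurable_pulls harm ks s).prodMk
      (measurable_empMean (fun r _ => harm r) hX ks))
  have hg : ∀ j : ℕ, Measurable fun ω =>
      missCost β σ y j ((∑ i ∈ Finset.range j, X ks i ω) / j) := fun j =>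
    (measurable_missCost β σ y).comp (measurable_const.prodMk
      ((Finset.measurable_sum _ fun i _ => hX ks i).div_const _))
  unfold roundMissCost
  rw [← lintegral_finsetSum _ fun j _ => hg j]
  simp_rw [← lintegral_indicator (hA _)]
  rw [← lintegral_finsetSum _ fun s _ => (hf s).indicator (hA s)]
  refine lintegral_mono fun ω => ?_
  classical
  set S := (Finset.range T).filter fun s => arm s ω = ks ∧ 0 < pulls arm ks s ω with hS
  have h1 : ∑ s ∈ Finset.range T, Set.indicator {ω | arm s ω = ks ∧ 0 < pulls arm ks s ω}
      (fun ω => missCost β σ y (pulls arm ks s ω) (empMean X arm ks s ω)) ω =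
      ∑ s ∈ S, missCost β σ y (pulls arm ks s ω) (empMean X arm ks s ω) := by
    rw [hS, Finset.sum_filter]
    refine Finset.sum_congr rfl fun s _ => ?_
    simp only [Set.indicator_apply, Set.mem_ofPred_eq]
  rw [h1]
  have hinj : Set.InjOn (fun s => pulls arm ks s ω) S := by
    intro a ha b hb hab
    rw [Finset.mem_coe, hS, Finset.mem_filter] at ha hb
    exact pulls_inj ha.2.1 hb.2.1 hab
  have h2 := Finset.sum_image (f := fun j : ℕ =>
    missCost β σ y j ((∑ i ∈ Finset.range j, X ks i ω) / j)) hinj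
  refine le_trans (le_of_eq h2.symm) (Finset.sum_le_sum_of_subset ?_)
  intro j hj
  obtain ⟨s, hs, rfl⟩ := Finset.mem_image.1 hj
  rw [hS, Finset.mem_filter, Finset.mem_range] at hs
  exact Finset.mem_Icc.2 ⟨hs.2.2, pulls_le.trans hs.1.le⟩

end TotalMissCost

/-! ### Expected counts of events -/

section Counting

variable {Ω : Type*} [MeasurableSpace Ω] {P : Measure Ω} [IsFiniteMeasure P]

/-- An expected count of events is at most `c` times the probability of an event `A`, if at most
`c` of them happen together, and only inside `A`. -/
lemma sum_measureReal_le_of_card_le {S : Finset ℕ} {E : ℕ → Set Ω} {A : Set Ω} {c : ℝ}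
    (hE : ∀ s, MeasurableSet (E s)) (hA : MeasurableSet A) (hsub : ∀ s ∈ S, E s ⊆ A)
    (hcard : ∀ ω, ∀ S' ⊆ S, (∀ s ∈ S', ω ∈ E s) → (S'.card : ℝ) ≤ c) :
    ∑ s ∈ S, P.real (E s) ≤ c * P.real A := by
  have hint : ∀ s, Integrable ((E s).indicator fun _ => (1 : ℝ)) P := fun s =>
    (integrable_const 1).indicator (hE s)
  have h1 : ∑ s ∈ S, P.real (E s) = ∫ ω, ∑ s ∈ S, (E s).indicator (fun _ => (1 : ℝ)) ω ∂P := by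
    rw [integral_finsetSum _ fun s _ => hint s]
    refine Finset.sum_congr rfl fun s _ => ?_
    rw [integral_indicator_const _ (hE s)]
    simp
  have h2 : c * P.real A = ∫ ω, A.indicator (fun _ => c) ω ∂P := by
    rw [integral_indicator_const _ hA, smul_eq_mul, mul_comm]
  rw [h1, h2]
  refine integral_mono (integrable_finsetSum _ fun s _ => hint s)
    ((integrable_const c).indicator hA) fun ω => ?_
  classical
  have h3 : ∑ s ∈ S, (E s).indicator (fun _ => (1 : ℝ)) ω
      = ((S.filter fun s => ω ∈ E s).card : ℝ) := by
    simp [Set.indicator_apply, Finset.sum_boole]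
  simp only [h3]
  by_cases hω : ω ∈ A
  · rw [Set.indicator_of_mem hω]
    exact hcard ω _ (Finset.filter_subset _ _) fun s hs => (Finset.mem_filter.1 hs).2
  · rw [Set.indicator_of_notMem hω, Finset.filter_false_of_mem fun s hs h => hω (hsub s hs h)]
    simp

end Counting

/-! ### Consequences of a correct confidence set for TS-C -/

section Deterministic

variable {Θ Ω : Type*} [MeasurableSpace Ω] {P : Measure Ω} {K : ℕ}
  {μ : Fin K → Θ → ℝ} {θs : Θ} {ks k l : Fin K} {α β σ D J : ℝ} {X : Fin K → ℕ → Ω → ℝ}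
  {G : ℕ → Fin K → Ω → ℝ} {arm : ℕ → Ω → Fin K} {s b : ℕ} {ω : Ω}

lemma IsTSC.pulls_best_pos (harm : IsTSC P μ α β σ X G arm)
    (hks : ∀ l, l ≠ ks → μ l θs < μ ks θs) (hg : θs ∈ confSet μ α σ X arm s ω)
    (hn : 0 < pulls arm (arm s ω) s ω) : 0 < pulls arm ks s ω := by
  by_contra h
  have h0 : pulls arm ks s ω = 0 := by omega
  have := harm.argmax s ω ks (best_mem_competitiveSet hks hg)
  rw [tsSample, if_pos h0, tsSample, if_neg hn.ne'] at this
  exact absurd this (not_le.2 (EReal.coe_lt_top _))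

/-- If `k` is competitive, twice the width of `ks` exceeds `D`, which means a count below `J`. -/
lemma IsTSC.pulls_best_lt (harm : IsTSC P μ α β σ X G arm) (hα : 0 ≤ α) (hD : 0 < D)
    (hdeg : ENNReal.ofReal D ≤ degree μ θs ks k)
    (hJ : D ^ 2 * J = 8 * α * σ ^ 2 * Real.log b) (hJ0 : 0 < J) (hs : s ≤ b)
    (hg : θs ∈ confSet μ α σ X arm s ω) (hk : arm s ω = k) : (pulls arm ks s ω : ℝ) < J := by
  rcases Nat.eq_zero_or_pos (pulls arm ks s ω) with h0 | h0
  · rw [h0]; simpa using hJ0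
  have h := lt_two_mul_width hdeg hg (hk ▸ harm.mem s ω) h0
  have h2 := width_mono hα (σ := σ) hs (pulls arm ks s ω)
  have hn : (0 : ℝ) < pulls arm ks s ω := by exact_mod_cast h0
  have h3 : D ^ 2 < (2 * width α σ b (pulls arm ks s ω)) ^ 2 := by
    have : D < 2 * width α σ b (pulls arm ks s ω) := by linarith
    gcongr
  rw [mul_pow, width_sq hα] at h3
  have h4 : D ^ 2 * (pulls arm ks s ω : ℝ) < D ^ 2 * J := by
    rw [hJ]
    calc D ^ 2 * (pulls arm ks s ω : ℝ)
        < 2 ^ 2 * (2 * α * σ ^ 2 * Real.log b / (pulls arm ks s ω)) * (pulls arm ks s ω) := by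
          gcongr
      _ = _ := by field_simp; ring
  exact lt_of_mul_lt_mul_left h4 (by positivity)

end Deterministic

/-! ### Charging pulls of other arms to the optimal arm -/

section Charging

variable {Θ Ω : Type*} [MeasurableSpace Ω] {P : Measure Ω} [IsProbabilityMeasure P] {K : ℕ}
  {μ : Fin K → Θ → ℝ} {θs : Θ} {ks k l : Fin K} {α β σ D J : ℝ} {X : Fin K → ℕ → Ω → ℝ}
  {G : ℕ → Fin K → Ω → ℝ} {arm : ℕ → Ω → Fin K} {s t₀ b : ℕ}

/-- Arm `l` is pulled in round `s + 1` while the confidence set is correct, it has been pulled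
often, and the arm `ks` has been pulled, but less than `J` times. -/
def duelEvent (μ : Fin K → Θ → ℝ) (θs : Θ) (α σ : ℝ) (X : Fin K → ℕ → Ω → ℝ)
    (arm : ℕ → Ω → Fin K) (ks : Fin K) (J : ℝ) (l : Fin K) (s : ℕ) : Set Ω :=
  {ω | arm s ω = l ∧ θs ∈ confSet μ α σ X arm s ω ∧ chargeFactor K * J ≤ pulls arm l s ω ∧
    0 < pulls arm ks s ω ∧ (pulls arm ks s ω : ℝ) < J}

lemma measurableSet_pulls (harm : ∀ t, Measurable (arm t)) (k : Fin K) (t : ℕ) (S : Set ℕ) :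
    MeasurableSet {ω | pulls arm k t ω ∈ S} :=
  measurable_pulls harm k t S.to_countable.measurableSet

lemma measurableSet_duelEvent (harm : ∀ t, Measurable (arm t)) (hX : ∀ k i, Measurable (X k i))
    (J : ℝ) (l : Fin K) (s : ℕ) : MeasurableSet (duelEvent μ θs α σ X arm ks J l s) :=
  (harm s (measurableSet_singleton l)).inter
    ((measurableSet_mem_confSet (fun r _ => harm r) hX θs).inter
    ((measurableSet_pulls harm l s {n | chargeFactor K * J ≤ n}).inter
    ((measurableSet_pulls harm ks s {n | 0 < n}).inter
    (measurableSet_pulls harm ks s {n | (n : ℝ) < J}))))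

lemma chargeFactor_pos (K : ℕ) : (1 : ℝ) ≤ chargeFactor K := by
  unfold chargeFactor; split_ifs <;> norm_num

/-- Each duel lost by `ks` is charged to a pull of `ks` with count in `[1, J)`. There are at most
`⌈J⌉ - 1 ≤ J` such pulls, and none after `t₀` if `ks` has already reached `J` there. -/
lemma IsTSC.sum_duelEvent_le (harm : IsTSC P μ α β σ X G arm)
    (hX : ∀ k i, Measurable (X k i)) (hks : ∀ l, l ≠ ks → μ l θs < μ ks θs) (hl : l ≠ ks)
    (hα : 0 ≤ α) (hβ : 0 < β) (hσ : 0 < σ) (hD : 0 < D) (hgap : D ≤ gapMin μ θs ks)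
    (hJ : D ^ 2 * J = 8 * α * σ ^ 2 * Real.log b) (hJ0 : 0 < J) {S : Finset ℕ}
    (hS : ∀ s ∈ S, t₀ ≤ s ∧ s ≤ b)
    (hfin : ∀ s, roundMissCost P β σ (μ ks θs - D / 2) X arm ks s ≠ ⊤) :
    ∑ s ∈ S, P.real (duelEvent μ θs α σ X arm ks J l s) ≤
      chargeFactor K * J * P.real {ω | (pulls arm ks t₀ ω : ℝ) < J} +
        ∑ s ∈ S, (roundMissCost P β σ (μ ks θs - D / 2) X arm ks s).toReal := by
  set A : ℕ → Set Ω := fun s =>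
    {ω | arm s ω = ks ∧ 0 < pulls arm ks s ω ∧ (pulls arm ks s ω : ℝ) < J} with hA
  have hAm : ∀ s, MeasurableSet (A s) := fun s =>
    (harm.measurable s (measurableSet_singleton ks)).inter
      ((measurableSet_pulls harm.measurable ks s {n | 0 < n}).inter
      (measurableSet_pulls harm.measurable ks s {n | (n : ℝ) < J}))
  have h1 : ∀ s ∈ S, P.real (duelEvent μ θs α σ X arm ks J l s) ≤ chargeFactor K * P.real (A s) +
      (roundMissCost P β σ (μ ks θs - D / 2) X arm ks s).toReal := by
    intro s hs
    have h := harm.measure_pull_le (θs := θs) hX hks hl hα hβ hσ hD hgap hJ (hS s hs).2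
    rw [lintegral_add_left measurable_const, setLIntegral_const] at h
    have h' : P (duelEvent μ θs α σ X arm ks J l s) ≤ chargeFactor K * P (A s) +
        roundMissCost P β σ (μ ks θs - D / 2) X arm ks s :=
      h.trans (add_le_add le_rfl (lintegral_mono_set fun ω hω => ⟨hω.1, hω.2.1⟩))
    have h2 := ENNReal.toReal_mono (ENNReal.add_ne_top.2
      ⟨ENNReal.mul_ne_top (by simp) (measure_ne_top P (A s)), hfin s⟩) h'
    rw [ENNReal.toReal_add (ENNReal.mul_ne_top (by simp) (measure_ne_top P (A s))) (hfin s),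
      ENNReal.toReal_mul] at h2
    simpa [Measure.real] using h2
  have h2 : ∑ s ∈ S, P.real (A s) ≤ J * P.real {ω | (pulls arm ks t₀ ω : ℝ) < J} := by
    refine sum_measureReal_le_of_card_le hAm
      (measurableSet_pulls harm.measurable ks t₀ {n | (n : ℝ) < J}) ?_ ?_
    · rintro s hs ω ⟨-, -, h⟩
      have : (pulls arm ks t₀ ω : ℝ) ≤ pulls arm ks s ω := by
        exact Nat.cast_le.2 (pulls_mono (hS s hs).1)
      exact this.trans_lt h
    · intro ω S' _ h
      have hc := card_pulls_between arm ks ω S' 1 ⌈J⌉₊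
      rw [Finset.filter_true_of_mem fun s hs => ⟨(h s hs).1, (h s hs).2.1,
        Nat.lt_ceil.2 (h s hs).2.2⟩] at hc
      have h3 : (S'.card : ℝ) ≤ ((⌈J⌉₊ - 1 : ℕ) : ℝ) := by exact_mod_cast hc
      have h4 := Nat.ceil_lt_add_one hJ0.le
      have h5 : 1 ≤ ⌈J⌉₊ := Nat.one_le_ceil_iff.2 hJ0
      rw [Nat.cast_sub h5] at h3
      push_cast at h3
      linarith
  refine (Finset.sum_le_sum h1).trans ?_
  rw [Finset.sum_add_distrib, ← Finset.mul_sum, mul_assoc]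
  have := chargeFactor_pos K
  gcongr

/-- The probability that the optimal arm has been pulled less than `J` times after a window of
rounds. -/
lemma IsTSC.measure_pulls_best_lt_le (harm : IsTSC P μ α β σ X G arm)
    (hX : IsRewardTable P X (fun k => μ k θs) σ) (hks : ∀ l, l ≠ ks → μ l θs < μ ks θs)
    (hK : 1 ≤ K)
    (hα : 0 < α) (hβ : 0 < β) (hσ : 0 < σ) (hD : 0 < D) (hgap : D ≤ gapMin μ θs ks)
    (hJ : D ^ 2 * J = 8 * α * σ ^ 2 * Real.log b) (hJ0 : 0 < J) {t₁ : ℕ} (h01 : t₀ ≤ t₁)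
    (ht0 : 0 < t₀) (h1b : t₁ ≤ b) {H : ℝ}
    (hfin : ∀ s, roundMissCost P β σ (μ ks θs - D / 2) X arm ks s ≠ ⊤)
    (hH : ∑ s ∈ Finset.Ico t₀ t₁, (roundMissCost P β σ (μ ks θs - D / 2) X arm ks s).toReal ≤ H)
    (hpos : 0 < (t₁ : ℝ) - t₀ - J - (K - 1) * (chargeFactor K * J + 1)) :
    P.real {ω | (pulls arm ks t₁ ω : ℝ) < J} ≤
      ∑ s ∈ Finset.Ico t₀ t₁, 2 * K * (s : ℝ) ^ (1 - α) +
        (K - 1) * (chargeFactor K * J + H) /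
          ((t₁ : ℝ) - t₀ - J - (K - 1) * (chargeFactor K * J + 1)) := by
  classical
  set q := (t₁ : ℝ) - t₀ - J - (K - 1) * (chargeFactor K * J + 1) with hq
  set W := Finset.Ico t₀ t₁ with hW
  set R := (Finset.univ : Finset (Fin K)).erase ks with hR
  have hRcard : (R.card : ℝ) = K - 1 := by
    rw [hR, Finset.card_erase_of_mem (Finset.mem_univ _), Finset.card_fin, Nat.cast_sub hK]
    simp
  have hc := chargeFactor_pos K
  set N : Ω → ℝ := fun ω => ∑ l ∈ R, ∑ s ∈ W,
    (duelEvent μ θs α σ X arm ks J l s).indicator (fun _ => (1 : ℝ)) ω with hN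
  have hE := fun l s => measurableSet_duelEvent (μ := μ) (θs := θs) (α := α) (σ := σ) (ks := ks)
    harm.measurable hX.measurable J l s
  have hint : ∀ l s, Integrable
      ((duelEvent μ θs α σ X arm ks J l s).indicator fun _ => (1 : ℝ)) P := fun l s =>
    (integrable_const 1).indicator (hE l s)
  have hsub : {ω | (pulls arm ks t₁ ω : ℝ) < J} ⊆
      {ω | ∃ s ∈ W, θs ∉ confSet μ α σ X arm s ω} ∪ {ω | q ≤ N ω} := by
    intro ω hω
    by_cases hbad : ∃ s ∈ W, θs ∉ confSet μ α σ X arm s ω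
    · exact Or.inl hbad
    push Not at hbad
    refine Or.inr ?_
    have hω' : (pulls arm ks t₁ ω : ℝ) < J := hω
    -- Each round of the window pulls `ks`, pulls an arm with few pulls so far, or is a duel event.
    -- The first two kinds fill at most `J` and `(K - 1) (c J + 1)` rounds, `c` being the charge
    -- factor, so at least `q` duel events remain.
    have hcover : ∀ s ∈ W, (1 : ℝ) ≤ (if arm s ω = ks then 1 else 0) +
        ∑ l ∈ R, ((if arm s ω = l ∧ (pulls arm l s ω : ℝ) < chargeFactor K * J then (1 : ℝ) else 0)
          + (duelEvent μ θs α σ X arm ks J l s).indicator (fun _ => (1 : ℝ)) ω) := by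
      intro s hs
      have hnn : ∀ l ∈ R, (0 : ℝ) ≤
          ((if arm s ω = l ∧ (pulls arm l s ω : ℝ) < chargeFactor K * J then (1 : ℝ) else 0)
          + (duelEvent μ θs α σ X arm ks J l s).indicator (fun _ => (1 : ℝ)) ω) := by
        intro l _
        refine add_nonneg (by split_ifs <;> norm_num)
          (Set.indicator_nonneg (fun _ _ => zero_le_one) _)
      by_cases ha : arm s ω = ks
      · rw [if_pos ha]
        linarith [Finset.sum_nonneg hnn]
      · rw [if_neg ha, zero_add]
        refine le_trans ?_ (Finset.single_le_sum hnn (a := arm s ω) (by simp [hR, ha]))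
        by_cases hn : (pulls arm (arm s ω) s ω : ℝ) < chargeFactor K * J
        · rw [if_pos ⟨rfl, hn⟩]
          linarith [Set.indicator_nonneg (s := duelEvent μ θs α σ X arm ks J (arm s ω) s)
            (f := fun _ => (1 : ℝ)) (fun _ _ => zero_le_one) ω]
        · have hnpos : 0 < pulls arm (arm s ω) s ω := by
            have : (0 : ℝ) < pulls arm (arm s ω) s ω :=
              lt_of_lt_of_le (by positivity) (not_lt.1 hn)
            exact_mod_cast this
          have hmem : ω ∈ duelEvent μ θs α σ X arm ks J (arm s ω) s := by
            refine ⟨rfl, hbad s hs, not_lt.1 hn, harm.pulls_best_pos hks (hbad s hs) hnpos, ?_⟩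
            have : (pulls arm ks s ω : ℝ) ≤ pulls arm ks t₁ ω := by
              exact Nat.cast_le.2 (pulls_mono (Finset.mem_Ico.1 hs).2.le)
            linarith
          rw [Set.indicator_of_mem hmem]
          linarith [show (0 : ℝ) ≤ if arm s ω = arm s ω ∧
            (pulls arm (arm s ω) s ω : ℝ) < chargeFactor K * J then (1 : ℝ) else 0 by
              split_ifs <;> norm_num]
    have hsum := Finset.sum_le_sum hcover
    rw [Finset.sum_add_distrib, Finset.sum_comm] at hsum
    simp_rw [Finset.sum_add_distrib] at hsum
    have hWcard : ∑ _s ∈ W, (1 : ℝ) = t₁ - t₀ := by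
      rw [Finset.sum_const, hW, Nat.card_Ico, nsmul_eq_mul, mul_one, Nat.cast_sub h01]
    have hbest : ∑ s ∈ W, (if arm s ω = ks then (1 : ℝ) else 0) ≤ J := by
      rw [Finset.sum_boole]
      refine le_trans ?_ hω'.le
      have : (W.filter fun s => arm s ω = ks).card ≤ pulls arm ks t₁ ω := by
        refine Finset.card_le_card (Finset.filter_subset_filter _ fun s hs => ?_)
        exact Finset.mem_range.2 (Finset.mem_Ico.1 hs).2
      exact_mod_cast this
    have hrest : ∑ l ∈ R, ∑ s ∈ W, (if arm s ω = l ∧ (pulls arm l s ω : ℝ) < chargeFactor K * J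
        then (1 : ℝ) else 0) ≤ (K - 1) * (chargeFactor K * J + 1) := by
      rw [← hRcard, ← nsmul_eq_mul (R.card)]
      refine Finset.sum_le_card_nsmul _ _ _ fun l _ => ?_
      rw [Finset.sum_boole]
      have hcl := card_pulls_between arm l ω W 0 ⌈chargeFactor K * J⌉₊
      have h4 := Nat.ceil_lt_add_one (a := chargeFactor K * J) (by positivity)
      have h5 : (W.filter fun s => arm s ω = l ∧ (pulls arm l s ω : ℝ) < chargeFactor K * J).card
          ≤ ⌈chargeFactor K * J⌉₊ := by
        refine le_trans (Finset.card_le_card ?_) hcl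
        refine Finset.monotone_filter_right _ fun s _ hs =>
          ⟨hs.1, Nat.zero_le _, Nat.lt_ceil.2 hs.2⟩
      have h6 : ((W.filter fun s => arm s ω = l ∧
          (pulls arm l s ω : ℝ) < chargeFactor K * J).card : ℝ) ≤ ⌈chargeFactor K * J⌉₊ := by
        exact_mod_cast h5
      linarith
    show q ≤ N ω
    rw [hWcard] at hsum
    simp only [hN, hq]
    linarith
  have hNint : ∫ ω, N ω ∂P ≤ (K - 1) * (chargeFactor K * J + H) := by
    rw [hN, integral_finsetSum _ fun l _ => integrable_finsetSum _ fun s _ => hint l s,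
      ← hRcard, ← nsmul_eq_mul (R.card)]
    refine Finset.sum_le_card_nsmul _ _ _ fun l hl => ?_
    rw [integral_finsetSum _ fun s _ => hint l s]
    have hlks : l ≠ ks := (Finset.mem_erase.1 hl).1
    have h := harm.sum_duelEvent_le (θs := θs) (S := W) (t₀ := t₀) hX.measurable hks hlks hα.le
      hβ hσ hD hgap hJ hJ0 (fun s hs => ⟨(Finset.mem_Ico.1 hs).1,
        (Finset.mem_Ico.1 hs).2.le.trans h1b⟩) hfin
    have e : ∀ s ∈ W, ∫ ω, (duelEvent μ θs α σ X arm ks J l s).indicator (fun _ => (1 : ℝ)) ω ∂P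
        = P.real (duelEvent μ θs α σ X arm ks J l s) := by
      intro s _
      rw [integral_indicator_const _ (hE l s)]
      simp
    rw [Finset.sum_congr rfl e]
    have h1 : chargeFactor K * J * P.real {ω | (pulls arm ks t₀ ω : ℝ) < J} ≤
        chargeFactor K * J := mul_le_of_le_one_right (by positivity) measureReal_le_one
    linarith
  have hNnn : ∀ ω, 0 ≤ N ω := fun ω => Finset.sum_nonneg fun l _ => Finset.sum_nonneg fun s _ =>
    Set.indicator_nonneg (fun _ _ => zero_le_one) _
  have hmarkov : P.real {ω | q ≤ N ω} ≤ (K - 1) * (chargeFactor K * J + H) / q := by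
    rw [le_div_iff₀ hpos, mul_comm]
    refine le_trans ?_ hNint
    exact mul_meas_ge_le_integral_of_nonneg (Eventually.of_forall hNnn)
      (integrable_finsetSum _ fun l _ => integrable_finsetSum _ fun s _ => hint l s) q
  refine (measureReal_mono hsub (measure_ne_top _ _)).trans ((measureReal_union_le _ _).trans ?_)
  refine add_le_add ?_ hmarkov
  exact measure_exists_not_mem_le hX hσ hα arm W fun s hs =>
    ht0.trans_le (Finset.mem_Ico.1 hs).1

end Charging

/-! ### Decomposition of time into blocks -/

section Blocks

variable {Θ Ω : Type*} [MeasurableSpace Ω] {P : Measure Ω} [IsProbabilityMeasure P] {K : ℕ}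
  {μ : Fin K → Θ → ℝ} {θs : Θ} {ks k l : Fin K} {α β σ D J J₁ : ℝ} {X : Fin K → ℕ → Ω → ℝ}
  {G : ℕ → Fin K → Ω → ℝ} {arm : ℕ → Ω → Fin K} {s a b : ℕ}

/-- A pull of `k` in the block has a count below the first threshold, or between the two thresholds,
or is a duel event. The last two kinds need `ks` to be rare already at the start `a`, apart from the
miss costs. -/
lemma IsTSC.sum_block_le (harm : IsTSC P μ α β σ X G arm)
    (hX : ∀ k i, Measurable (X k i)) (hks : ∀ l, l ≠ ks → μ l θs < μ ks θs) (hk : k ≠ ks)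
    (hα : 0 ≤ α) (hβ : 0 < β) (hσ : 0 < σ) (hD : 0 < D) (hgap : D ≤ gapMin μ θs ks)
    (hdeg : ENNReal.ofReal D ≤ degree μ θs ks k)
    (hJ : D ^ 2 * J = 8 * α * σ ^ 2 * Real.log b) (hJ0 : 0 < J)
    (hfin : ∀ s, roundMissCost P β σ (μ ks θs - D / 2) X arm ks s ≠ ⊤) :
    ∑ s ∈ Finset.Ico a b, P.real {ω | arm s ω = k ∧ θs ∈ confSet μ α σ X arm s ω} ≤
      ∑ s ∈ Finset.Ico a b,
        P.real {ω | arm s ω = k ∧ pulls arm k s ω < ⌈chargeFactor K * J₁⌉₊} +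
      ((⌈chargeFactor K * J⌉₊ - ⌈chargeFactor K * J₁⌉₊ : ℕ) + chargeFactor K * J) *
        P.real {ω | (pulls arm ks a ω : ℝ) < J} +
      ∑ s ∈ Finset.Ico a b, (roundMissCost P β σ (μ ks θs - D / 2) X arm ks s).toReal := by
  set N := ⌈chargeFactor K * J⌉₊ with hN
  set N₁ := ⌈chargeFactor K * J₁⌉₊ with hN₁
  set A : Set Ω := {ω | (pulls arm ks a ω : ℝ) < J} with hA
  set M : ℕ → Set Ω := fun s => {ω | arm s ω = k ∧ (N₁ ≤ pulls arm k s ω ∧ pulls arm k s ω < N) ∧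
    (pulls arm ks s ω : ℝ) < J} with hM
  have hMm : ∀ s, MeasurableSet (M s) := fun s =>
    (harm.measurable s (measurableSet_singleton k)).inter
      ((measurableSet_pulls harm.measurable k s {n | N₁ ≤ n ∧ n < N}).inter
      (measurableSet_pulls harm.measurable ks s {n | (n : ℝ) < J}))
  have h1 : ∑ s ∈ Finset.Ico a b, P.real (M s) ≤ (N - N₁ : ℕ) * P.real A := by
    refine sum_measureReal_le_of_card_le hMm
      (measurableSet_pulls harm.measurable ks a {n | (n : ℝ) < J}) ?_ ?_
    · rintro s hs ω ⟨-, -, h⟩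
      have : (pulls arm ks a ω : ℝ) ≤ pulls arm ks s ω :=
        Nat.cast_le.2 (pulls_mono (Finset.mem_Ico.1 hs).1)
      exact this.trans_lt h
    · intro ω S' _ h
      have hc := card_pulls_between arm k ω S' N₁ N
      rw [Finset.filter_true_of_mem fun s hs => ⟨(h s hs).1, (h s hs).2.1.1, (h s hs).2.1.2⟩] at hc
      exact_mod_cast hc
  have h2 := harm.sum_duelEvent_le (θs := θs) (S := Finset.Ico a b) (t₀ := a) hX hks hk hα
    hβ hσ hD hgap hJ hJ0 (fun s hs => ⟨(Finset.mem_Ico.1 hs).1, (Finset.mem_Ico.1 hs).2.le⟩) hfin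
  have h3 : ∀ s ∈ Finset.Ico a b,
      P.real {ω | arm s ω = k ∧ θs ∈ confSet μ α σ X arm s ω} ≤
      P.real {ω | arm s ω = k ∧ pulls arm k s ω < N₁} + P.real (M s) +
        P.real (duelEvent μ θs α σ X arm ks J k s) := by
    intro s hs
    have hsub : {ω | arm s ω = k ∧ θs ∈ confSet μ α σ X arm s ω} ⊆
        {ω | arm s ω = k ∧ pulls arm k s ω < N₁} ∪ M s ∪
          duelEvent μ θs α σ X arm ks J k s := by
      rintro ω ⟨hω, hg⟩
      have hlt := harm.pulls_best_lt hα hD hdeg hJ hJ0 (Finset.mem_Ico.1 hs).2.le hg hω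
      by_cases c1 : pulls arm k s ω < N₁
      · exact Or.inl (Or.inl ⟨hω, c1⟩)
      by_cases c2 : pulls arm k s ω < N
      · exact Or.inl (Or.inr ⟨hω, ⟨not_lt.1 c1, c2⟩, hlt⟩)
      · have c3 : chargeFactor K * J ≤ (pulls arm k s ω : ℝ) := Nat.ceil_le.1 (not_lt.1 c2)
        have hc := chargeFactor_pos K
        have hpos : 0 < pulls arm (arm s ω) s ω := by
          have : (0 : ℝ) < pulls arm k s ω := lt_of_lt_of_le (by positivity) c3
          rw [hω]
          exact_mod_cast this
        exact Or.inr ⟨hω, hg, c3, harm.pulls_best_pos hks hg hpos, hlt⟩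
    exact (measureReal_mono hsub (measure_ne_top _ _)).trans
      ((measureReal_union_le _ _).trans (add_le_add (measureReal_union_le _ _) le_rfl))
  refine (Finset.sum_le_sum h3).trans ?_
  rw [Finset.sum_add_distrib, Finset.sum_add_distrib, add_mul]
  linarith

/-- Pulls of `k` with count below the first threshold are counted once over all time. This explains
the term `- chargeFactor K * J 1` in the weight of each later block. -/
lemma IsTSC.sum_blocks_le (harm : IsTSC P μ α β σ X G arm)
    (hX : ∀ k i, Measurable (X k i)) (hks : ∀ l, l ≠ ks → μ l θs < μ ks θs) (hk : k ≠ ks)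
    (hα : 0 ≤ α) (hβ : 0 < β) (hσ : 0 < σ) (hD : 0 < D) (hgap : D ≤ gapMin μ θs ks)
    (hdeg : ENNReal.ofReal D ≤ degree μ θs ks k) {t : ℕ → ℕ} (ht : Monotone t) {J : ℕ → ℝ}
    (hJ : ∀ i, D ^ 2 * J i = 8 * α * σ ^ 2 * Real.log (t i)) (hJ0 : ∀ i, 0 < J i)
    (hfin : ∀ s, roundMissCost P β σ (μ ks θs - D / 2) X arm ks s ≠ ⊤) {H : ℝ}
    (hH : ∀ T, ∑ s ∈ Finset.range T,
      (roundMissCost P β σ (μ ks θs - D / 2) X arm ks s).toReal ≤ H) (I : ℕ) :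
    ∑ s ∈ Finset.range (t (I + 1)), P.real {ω | arm s ω = k ∧ θs ∈ confSet μ α σ X arm s ω} ≤
      2 * chargeFactor K * J 1 + 1 +
      ∑ i ∈ Finset.Icc 1 I, (2 * chargeFactor K * J (i + 1) + 1 - chargeFactor K * J 1) *
        P.real {ω | (pulls arm ks (t i) ω : ℝ) < J (i + 1)} + H := by
  have hc := chargeFactor_pos K
  set f : ℕ → ℝ := fun s => P.real {ω | arm s ω = k ∧ θs ∈ confSet μ α σ X arm s ω}
  set f₁ : ℕ → ℝ := fun s =>
    P.real {ω | arm s ω = k ∧ pulls arm k s ω < ⌈chargeFactor K * J 1⌉₊} with hf₁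
  set h : ℕ → ℝ := fun s => (roundMissCost P β σ (μ ks θs - D / 2) X arm ks s).toReal
  have hJmono : ∀ i j, i ≤ j → J i ≤ J j := by
    intro i j hij
    have : D ^ 2 * J i ≤ D ^ 2 * J j := by
      rw [hJ, hJ]
      have := log_natCast_mono (ht hij)
      gcongr
    exact le_of_mul_le_mul_left this (by positivity)
  have key : ∀ I : ℕ, ∑ s ∈ Finset.range (t (I + 1)), f s ≤
      ∑ s ∈ Finset.range (t (I + 1)), f₁ s + chargeFactor K * J 1 +
      ∑ i ∈ Finset.Icc 1 I, (2 * chargeFactor K * J (i + 1) + 1 - chargeFactor K * J 1) *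
        P.real {ω | (pulls arm ks (t i) ω : ℝ) < J (i + 1)} +
      ∑ s ∈ Finset.range (t (I + 1)), h s := by
    intro I
    induction I with
    | zero =>
      have h0 := harm.sum_block_le (θs := θs) (a := 0) (J₁ := J 1) hX hks hk hα hβ hσ hD hgap hdeg
        (hJ 1) (hJ0 1) hfin
      have h1 : P.real {ω | (pulls arm ks 0 ω : ℝ) < J 1} ≤ 1 := measureReal_le_one
      have h2 : chargeFactor K * J 1 * P.real {ω | (pulls arm ks 0 ω : ℝ) < J 1} ≤
        chargeFactor K * J 1 := mul_le_of_le_one_right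
          (by have := (hJ0 1).le; positivity) h1
      rw [Nat.sub_self, Nat.cast_zero, zero_add] at h0
      simp only [zero_add, Finset.range_eq_Ico, Finset.Icc_eq_empty_of_lt zero_lt_one,
        Finset.sum_empty, add_zero]
      linarith
    | succ I ih =>
      have hle : t (I + 1) ≤ t (I + 1 + 1) := ht (Nat.le_succ _)
      have hsplit : ∀ g : ℕ → ℝ, ∑ s ∈ Finset.range (t (I + 1 + 1)), g s =
          ∑ s ∈ Finset.range (t (I + 1)), g s +
            ∑ s ∈ Finset.Ico (t (I + 1)) (t (I + 1 + 1)), g s := fun g =>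
        (Finset.sum_range_add_sum_Ico g hle).symm
      have h0 := harm.sum_block_le (θs := θs) (a := t (I + 1)) (J₁ := J 1) hX hks hk hα hβ hσ hD
        hgap hdeg (hJ (I + 1 + 1)) (hJ0 _) hfin
      rw [hsplit, hsplit f₁, hsplit h, Finset.sum_Icc_succ_top (by omega)]
      have hN : ((⌈chargeFactor K * J (I + 1 + 1)⌉₊ - ⌈chargeFactor K * J 1⌉₊ : ℕ) : ℝ) ≤
          chargeFactor K * J (I + 1 + 1) + 1 - chargeFactor K * J 1 := by
        have hJle := hJmono 1 (I + 1 + 1) (by omega)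
        have hle : ⌈chargeFactor K * J 1⌉₊ ≤ ⌈chargeFactor K * J (I + 1 + 1)⌉₊ :=
          Nat.ceil_mono (by gcongr)
        rw [Nat.cast_sub hle]
        have h1 := Nat.ceil_lt_add_one (a := chargeFactor K * J (I + 1 + 1))
          (by have := (hJ0 (I + 1 + 1)).le; positivity)
        have h2 := Nat.le_ceil (chargeFactor K * J 1)
        linarith
      have hu : 0 ≤ P.real {ω | (pulls arm ks (t (I + 1)) ω : ℝ) < J (I + 1 + 1)} :=
        measureReal_nonneg
      have hN' := mul_le_mul_of_nonneg_right hN hu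
      rw [add_mul] at h0
      have e : (2 * chargeFactor K * J (I + 1 + 1) + 1 - chargeFactor K * J 1) *
          P.real {ω | (pulls arm ks (t (I + 1)) ω : ℝ) < J (I + 1 + 1)} =
          (chargeFactor K * J (I + 1 + 1) + 1 - chargeFactor K * J 1) *
          P.real {ω | (pulls arm ks (t (I + 1)) ω : ℝ) < J (I + 1 + 1)} +
          chargeFactor K * J (I + 1 + 1) *
          P.real {ω | (pulls arm ks (t (I + 1)) ω : ℝ) < J (I + 1 + 1)} := by ring
      rw [e]
      linarith
  have hfirst : ∑ s ∈ Finset.range (t (I + 1)), f₁ s ≤ chargeFactor K * J 1 + 1 := by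
    have h1 : ∑ s ∈ Finset.range (t (I + 1)), f₁ s ≤
        (⌈chargeFactor K * J 1⌉₊ : ℝ) * P.real (Set.univ : Set Ω) := by
      refine sum_measureReal_le_of_card_le (fun s =>
        (harm.measurable s (measurableSet_singleton k)).inter
          (measurableSet_pulls harm.measurable k s {n | n < ⌈chargeFactor K * J 1⌉₊}))
        MeasurableSet.univ (fun _ _ => Set.subset_univ _) ?_
      intro ω S' _ h
      have hc := card_pulls_between arm k ω S' 0 ⌈chargeFactor K * J 1⌉₊
      rw [Finset.filter_true_of_mem fun s hs => ⟨(h s hs).1, Nat.zero_le _, (h s hs).2⟩] at hc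
      exact_mod_cast hc
    have h2 := Nat.ceil_lt_add_one (a := chargeFactor K * J 1)
      (by have := (hJ0 1).le; positivity)
    rw [probReal_univ, mul_one] at h1
    linarith
  have := key I
  have := hH (t (I + 1))
  linarith

end Blocks

/-! ### Numerical verification of the budget -/

section Numerics

lemma sum_affine_mul_div_two_pow_le {w₀ w₁ v₀ v₁ : ℝ} (hw₀ : 0 ≤ w₀) (hw₁ : 0 ≤ w₁) (hv₀ : 0 ≤ v₀)
    (hv₁ : 0 ≤ v₁) (I : ℕ) :
    ∑ i ∈ Finset.Icc 1 I, (w₀ + w₁ * i) * (v₀ + v₁ * i) * 2 / 2 ^ i ≤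
      2 * (w₀ * v₀) + 4 * (w₀ * v₁ + w₁ * v₀) + 12 * (w₁ * v₁) := by
  -- The limit comes from `∑ 2^(-i) = 1`, `∑ i 2^(-i) = 2` and `∑ i² 2^(-i) = 6`; the subtracted
  -- term is the exact remainder.
  have h : ∑ i ∈ Finset.Icc 1 I, (w₀ + w₁ * i) * (v₀ + v₁ * i) * 2 / 2 ^ i =
      2 * (w₀ * v₀) + 4 * (w₀ * v₁ + w₁ * v₀) + 12 * (w₁ * v₁) -
        (2 * (w₀ * v₀) + (w₀ * v₁ + w₁ * v₀) * (2 * I + 4) +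
          w₁ * v₁ * (2 * I ^ 2 + 8 * I + 12)) / 2 ^ I := by
    induction I with
    | zero => simp; ring
    | succ I ih =>
      rw [Finset.sum_Icc_succ_top (by omega), ih]
      push_cast
      field_simp
      ring
  rw [h]
  have : 0 ≤ (2 * (w₀ * v₀) + (w₀ * v₁ + w₁ * v₀) * (2 * I + 4) +
      w₁ * v₁ * (2 * I ^ 2 + 8 * I + 12)) / 2 ^ I := by positivity
  linarith

/-- Bounds `log 2 / log τ` by a rational expression, with equality at `τ = 2`, so that the budget
becomes polynomial in `K` and `τ`. -/
lemma log_two_mul_le {τ : ℕ} (hτ : 2 ≤ τ) :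
    Real.log 2 * τ ≤ (τ / 2 + 1) * Real.log τ := by
  have h2 : 0 < Real.log 2 := Real.log_pos (by norm_num)
  rcases Nat.lt_or_ge τ 4 with h | h
  · interval_cases τ
    · norm_num; linarith
    · have h3 : Real.log ((2 : ℝ) ^ 6) ≤ Real.log ((3 : ℝ) ^ 5) :=
        Real.log_le_log (by norm_num) (by norm_num)
      rw [Real.log_pow, Real.log_pow] at h3
      push_cast at *
      linarith
  · have h4 : 2 * Real.log 2 ≤ Real.log τ := by
      have : Real.log ((2 : ℝ) ^ 2) ≤ Real.log τ :=
        Real.log_le_log (by norm_num) (by norm_num; exact_mod_cast h)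
      rw [Real.log_pow] at this
      exact_mod_cast this
    have hτ0 : (0 : ℝ) ≤ τ := by positivity
    nlinarith

lemma log_natCast_le_mul_log_two {K : ℕ} (hK : 1 ≤ K) :
    Real.log K ≤ (K - 1) * Real.log 2 := by
  have h : K ≤ 2 ^ (K - 1) := by
    have := Nat.lt_two_pow_self (n := K - 1)
    omega
  have h1 : Real.log K ≤ Real.log ((2 : ℝ) ^ (K - 1)) :=
    Real.log_le_log (by exact_mod_cast hK) (by exact_mod_cast h)
  rw [Real.log_pow, Nat.cast_sub hK] at h1
  exact_mod_cast h1

lemma two_mul_natCast_le_two_pow {i : ℕ} (hi : 1 ≤ i) : (2 * i : ℝ) ≤ 2 ^ i := by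
  have : 2 * i ≤ 2 ^ i := by
    induction i, hi using Nat.le_induction with
    | base => norm_num
    | succ n hn ih => rw [pow_succ]; omega
  exact_mod_cast this

/-- The first pull-count threshold and the increments of the thresholds from block to block. -/
lemma threshold_bounds {K τ : ℕ} (hK : 2 ≤ K) (hτ : 2 ≤ τ) {J : ℕ → ℝ}
    (hJ : ∀ i, K * Real.log τ * J i =
      8 / 27 * τ * (Real.log (4 * K ^ 2 * τ ^ 2) + i * Real.log 2)) :
    ∃ e : ℝ, 0 ≤ e ∧ K * e ≤ 8 / 27 * (τ / 2 + 1) ∧ (∀ i : ℕ, J (i + 1) = J 1 + i * e) ∧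
      K * J 1 ≤ 8 / 27 * ((2 * K + 1) * (τ / 2 + 1) + 2 * τ) := by
  have hτ' : (2 : ℝ) ≤ τ := by exact_mod_cast hτ
  have hK' : (2 : ℝ) ≤ K := by exact_mod_cast hK
  have hL : 0 < Real.log τ := Real.log_pos (by linarith)
  have h2 : 0 < Real.log 2 := Real.log_pos (by norm_num)
  have hKL : 0 < K * Real.log τ := by positivity
  have hlt := log_two_mul_le hτ
  have hlK := log_natCast_le_mul_log_two (show 1 ≤ K by omega)
  refine ⟨8 / 27 * τ * Real.log 2 / (K * Real.log τ), by positivity, ?_, ?_, ?_⟩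
  · rw [mul_div_assoc', div_le_iff₀ hKL]
    nlinarith
  · intro i
    have h1 := hJ (i + 1)
    have h3 := hJ 1
    refine mul_left_cancel₀ hKL.ne' ?_
    have h4 : K * Real.log τ * (i * (8 / 27 * τ * Real.log 2 / (K * Real.log τ))) =
        i * (8 / 27 * τ * Real.log 2) := by field_simp
    rw [h1, mul_add (K * Real.log τ), h3, h4]
    push_cast
    ring
  · have h1 := hJ 1
    have hlog : Real.log (4 * K ^ 2 * τ ^ 2) =
        2 * Real.log 2 + 2 * Real.log K + 2 * Real.log τ := by
      rw [Real.log_mul (by positivity) (by positivity),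
        Real.log_mul (by positivity) (by positivity),
        Real.log_pow, Real.log_pow, show (4 : ℝ) = 2 ^ 2 by norm_num, Real.log_pow]
      push_cast
      ring
    rw [hlog] at h1
    refine le_of_mul_le_mul_right ?_ hL
    have e1 : K * J 1 * Real.log τ = K * Real.log τ * J 1 := by ring
    rw [e1, h1]
    have h3 : (2 * Real.log 2 + 2 * Real.log K + 2 * Real.log τ + (1 : ℕ) * Real.log 2) ≤
        (2 * K + 1) * Real.log 2 + 2 * Real.log τ := by push_cast; linarith
    calc 8 / 27 * τ * (2 * Real.log 2 + 2 * Real.log K + 2 * Real.log τ + (1 : ℕ) * Real.log 2)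
        ≤ 8 / 27 * τ * ((2 * K + 1) * Real.log 2 + 2 * Real.log τ) := by gcongr
      _ = 8 / 27 * ((2 * K + 1) * (Real.log 2 * τ) + 2 * τ * Real.log τ) := by ring
      _ ≤ 8 / 27 * ((2 * K + 1) * ((τ / 2 + 1) * Real.log τ) + 2 * τ * Real.log τ) := by gcongr
      _ = _ := by ring

/-- Affine bounds, in units of `τ`, for the quantities of the `i`-th block. -/
lemma exists_block_bounds {K τ : ℕ} (hK : 2 ≤ K) (hτ : 2 ≤ τ) {J : ℕ → ℝ} (hJ0 : 0 ≤ J 1) {e : ℝ}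
    (he0 : 0 ≤ e) (he : K * e ≤ 8 / 27 * (τ / 2 + 1)) (hJe : ∀ i : ℕ, J (i + 1) = J 1 + i * e)
    (hJ1 : K * J 1 ≤ 8 / 27 * ((2 * K + 1) * (τ / 2 + 1) + 2 * τ)) :
    ∃ w₀ w₁ v₀ v₁ ρ : ℝ, 0 ≤ w₀ ∧ 0 ≤ w₁ ∧ 0 ≤ v₀ ∧ 0 ≤ v₁ ∧ 0 ≤ ρ ∧
      (w₀ ≤ 5 ∧ w₁ ≤ 1) ∧
      (∀ i : ℕ, 2 * chargeFactor K * J (i + 1) + 1 - chargeFactor K * J 1 ≤ τ * (w₀ + w₁ * i)) ∧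
      (∀ i : ℕ, chargeFactor K * J (i + 1) + τ / 2 ≤ τ * (v₀ + v₁ * i)) ∧
      (K - 1) ≤ ρ * (3.2 * K ^ 2) ∧
      (∀ i : ℕ, J (i + 1) + (K - 1) * (chargeFactor K * J (i + 1) + 1) ≤ K * τ * (2.3 + 0.2 * i)) ∧
      2 * chargeFactor K * J 1 + 1 + τ / 2 +
        ρ * (2 * (w₀ * v₀) + 4 * (w₀ * v₁ + w₁ * v₀) + 12 * (w₁ * v₁)) ≤ K * τ + 2 * K - 1 := by
  have hτ' : (2 : ℝ) ≤ τ := by exact_mod_cast hτ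
  rcases Nat.lt_or_ge K 3 with h3 | h3
  · have hK2 : K = 2 := by omega
    subst hK2
    have hc : (chargeFactor 2 : ℝ) = 1 := by simp [chargeFactor]
    rw [hc]
    push_cast at *
    have he' : e ≤ 4 / 27 * τ := by linarith
    have hJ1' : J 1 ≤ 28 / 27 * τ := by linarith
    have hie : ∀ i : ℕ, (i : ℝ) * e ≤ i * (4 / 27 * τ) := fun i =>
      mul_le_mul_of_nonneg_left he' (Nat.cast_nonneg i)
    -- Here `83 / 54 = 28 / 27 + 1 / 2`, the slopes come from `e ≤ 4 τ / 27`, and `ρ = 5 / 64` is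
    -- equality in `K - 1 ≤ 3.2 ρ K²` at `K = 2`.
    refine ⟨83 / 54, 8 / 27, 83 / 54, 4 / 27, 5 / 64, by norm_num, by norm_num, by norm_num,
      by norm_num, by norm_num, by norm_num, fun i => ?_, fun i => ?_, by norm_num, fun i => ?_,
      by norm_num; linarith⟩
    · rw [hJe]; linarith [hie i]
    · rw [hJe]; linarith [hie i]
    · rw [hJe]
      have : (0 : ℝ) ≤ τ * i := by positivity
      nlinarith [hie i]
  · have hc : (chargeFactor K : ℝ) = 2 := by
      have : K ≠ 2 := by omega
      simp [chargeFactor, this]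
    rw [hc]
    have h3' : (3 : ℝ) ≤ K := by exact_mod_cast h3
    have hK0 : (0 : ℝ) < K := by linarith
    have he3 : e ≤ 8 / 81 * τ := by nlinarith
    have hJ1' : J 1 ≤ 8 / 9 * τ := by
      refine le_of_mul_le_mul_left (hJ1.trans ?_) hK0
      nlinarith
    have hie : ∀ i : ℕ, (i : ℝ) * e ≤ i * (8 / 81 * τ) := fun i =>
      mul_le_mul_of_nonneg_left he3 (Nat.cast_nonneg i)
    have hJ1'' : J 1 ≤ 8 / 27 * ((1 + 2.5 / 3) * τ + 2 + 1 / 3) := by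
      refine le_of_mul_le_mul_left (hJ1.trans ?_) hK0
      nlinarith
    -- Likewise `123 / 54 = 2 · 8 / 9 + 1 / 2`, the slopes come from `e ≤ 8 τ / 81`, and `ρ = 5 /
    -- 72` is equality at `K = 3`.
    refine ⟨123 / 54, 32 / 81, 123 / 54, 16 / 81, 5 / 72, by norm_num, by norm_num, by norm_num,
      by norm_num, by norm_num, by norm_num, fun i => ?_, fun i => ?_, by nlinarith,
      fun i => ?_, ?_⟩
    · rw [hJe]; linarith [hie i]
    · rw [hJe]; linarith [hie i]
    · have h1 : J (i + 1) ≤ τ * (8 / 9 + 8 / 81 * i) := by rw [hJe]; linarith [hie i]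
      have h2 : 0 ≤ J (i + 1) := by rw [hJe]; positivity
      have h3 : J (i + 1) + (K - 1) * (2 * J (i + 1) + 1) ≤ K * (2 * J (i + 1) + 1) := by nlinarith
      refine h3.trans ?_
      rw [mul_assoc]
      refine mul_le_mul_of_nonneg_left ?_ hK0.le
      have : (0 : ℝ) ≤ τ * i := by positivity
      nlinarith
    · norm_num
      nlinarith

/-- The blocks `[2 ^ i T₀, 2 ^ (i + 1) T₀)`, `T₀ = 4 K² τ²`, fit into the budget `K τ + 2 K - 1`. -/
lemma block_budget {K τ : ℕ} (hK : 2 ≤ K) (hτ : 2 ≤ τ) {J : ℕ → ℝ} (hJ0 : ∀ i, 0 < J i)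
    (hJ : ∀ i, K * Real.log τ * J i =
      8 / 27 * τ * (Real.log (4 * K ^ 2 * τ ^ 2) + i * Real.log 2)) {q : ℕ → ℝ}
    (hq : ∀ i, q i = 2 * K ^ 2 * τ ^ 2 * 2 ^ i - J (i + 1)
      - (K - 1) * (chargeFactor K * J (i + 1) + 1)) :
    (∀ i, 1 ≤ i → 0 < q i) ∧
    (∀ i, 1 ≤ i → 0 ≤ 2 * chargeFactor K * J (i + 1) + 1 - chargeFactor K * J 1) ∧
    (∀ i, 1 ≤ i → 2 * chargeFactor K * J (i + 1) + 1 - chargeFactor K * J 1 ≤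
      2 * K ^ 2 * (2 * K ^ 2 * τ ^ 2 * 2 ^ i)) ∧
    ∀ I : ℕ, 2 * chargeFactor K * J 1 + 1 + ∑ i ∈ Finset.Icc 1 I,
      (2 * chargeFactor K * J (i + 1) + 1 - chargeFactor K * J 1) *
        ((K - 1) * (chargeFactor K * J (i + 1) + τ / 2) / q i) + τ / 2 ≤ K * τ + 2 * K - 1 := by
  have hτ' : (2 : ℝ) ≤ τ := by exact_mod_cast hτ
  have hK' : (2 : ℝ) ≤ K := by exact_mod_cast hK
  obtain ⟨e, he0, he, hJe, hJ1⟩ := threshold_bounds hK hτ hJ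
  obtain ⟨w₀, w₁, v₀, v₁, ρ, hw₀, hw₁, hv₀, hv₁, hρ, ⟨hw5, hw1⟩, hW, hV, hρK, hd, htot⟩ :=
    exists_block_bounds hK hτ (hJ0 1).le he0 he hJe hJ1
  have hc : (1 : ℝ) ≤ chargeFactor K := by
    unfold chargeFactor; split_ifs <;> norm_num
  have hKτ : (4 : ℝ) ≤ K * τ := by nlinarith
  have hpow : ∀ i : ℕ, 1 ≤ i → (2 : ℝ) ≤ 2 ^ i ∧ (2 * i : ℝ) ≤ 2 ^ i := by
    intro i hi
    have h1 := two_mul_natCast_le_two_pow hi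
    have h2 : (1 : ℝ) ≤ i := by exact_mod_cast hi
    exact ⟨by linarith, h1⟩
  -- The deduction is at most `1.25 K τ 2^i`, by `i ≥ 1`, and `K τ ≥ 4` makes this less than `0.4 K²
  -- τ² 2^i`.
  have hqi : ∀ i, 1 ≤ i → 1.6 * K ^ 2 * τ ^ 2 * 2 ^ i ≤ q i := by
    intro i hi
    obtain ⟨h1, h2⟩ := hpow i hi
    have h3 : (K * τ * (2.3 + 0.2 * i) : ℝ) ≤ K * τ * (1.25 * 2 ^ i) :=
      mul_le_mul_of_nonneg_left (by linarith) (by positivity)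
    have h4 : (K * τ * 2 ^ i : ℝ) * 4 ≤ K * τ * 2 ^ i * (K * τ) :=
      mul_le_mul_of_nonneg_left hKτ (by positivity)
    rw [hq]
    nlinarith [hd i]
  refine ⟨fun i hi => lt_of_lt_of_le (by positivity) (hqi i hi), fun i _ => ?_,
    fun i hi => (hW i).trans ?_, fun I => ?_⟩
  · rw [hJe]
    have := (hJ0 1).le
    have : 0 ≤ chargeFactor K * J 1 + 2 * chargeFactor K * (i * e) + 1 := by positivity
    linarith
  · obtain ⟨h1, h2⟩ := hpow i hi
    have h3 : w₀ + w₁ * i ≤ 3 * 2 ^ i := by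
      have : w₁ * i ≤ 1 * i := mul_le_mul_of_nonneg_right hw1 (Nat.cast_nonneg i)
      linarith
    calc τ * (w₀ + w₁ * i) ≤ τ * (3 * 2 ^ i) := by gcongr
      _ = 3 * (τ * 2 ^ i * 1) := by ring
      _ ≤ 4 * (τ * 2 ^ i * (K ^ 4 * τ)) := by
        have : (1 : ℝ) ≤ K ^ 4 * τ := by
          have : (1 : ℝ) ≤ K ^ 4 := one_le_pow₀ (by linarith)
          nlinarith
        gcongr
        norm_num
      _ = _ := by ring
  · refine le_trans ?_ htot
    have hterm : ∀ i ∈ Finset.Icc 1 I,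
        (2 * chargeFactor K * J (i + 1) + 1 - chargeFactor K * J 1) *
        ((K - 1) * (chargeFactor K * J (i + 1) + τ / 2) / q i) ≤
        ρ * ((w₀ + w₁ * i) * (v₀ + v₁ * i) * 2 / 2 ^ i) := by
      intro i hi
      have hi1 := (Finset.mem_Icc.1 hi).1
      have hJi := (hJ0 (i + 1)).le
      have hq0 : 0 < 1.6 * K ^ 2 * τ ^ 2 * (2 : ℝ) ^ i := by positivity
      have hK1 : (0 : ℝ) ≤ K - 1 := by linarith
      have h1 : (K - 1) * (chargeFactor K * J (i + 1) + τ / 2) / q i ≤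
          ρ * (3.2 * K ^ 2) * (τ * (v₀ + v₁ * i)) / (1.6 * K ^ 2 * τ ^ 2 * 2 ^ i) := by
        gcongr
        · exact hV i
        · exact hqi i hi1
      refine (mul_le_mul (hW i) h1 ?_ (by positivity)).trans_eq ?_
      · have := hq0.trans_le (hqi i hi1)
        positivity
      · field_simp
        ring
    have h2 := Finset.sum_le_sum hterm
    rw [← Finset.mul_sum] at h2
    have h3 := mul_le_mul_of_nonneg_left
      (sum_affine_mul_div_two_pow_le hw₀ hw₁ hv₀ hv₁ I) hρ
    linarith

end Numerics

/-! ### The bound for TS-C -/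

section TSBound

variable {Θ Ω : Type*} [MeasurableSpace Ω] {P : Measure Ω} [IsProbabilityMeasure P] {K : ℕ}
  {μ : Fin K → Θ → ℝ} {θs : Θ} {ks k : Fin K} {α β σ D : ℝ} {X : Fin K → ℕ → Ω → ℝ}
  {G : ℕ → Fin K → Ω → ℝ} {arm : ℕ → Ω → Fin K}

/-- Pulls in rounds with a wrong confidence set. In the first of these rounds a single pull is
counted, instead of the `2 K` allowed for. -/
lemma sum_measure_not_mem_le (hX : IsRewardTable P X (fun k => μ k θs) σ) (hσ : 0 < σ)
    (hα : 0 < α) {T : ℕ} (hT : 2 ≤ T) :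
    ∑ t ∈ Finset.range T, P.real {ω | arm t ω = k ∧ θs ∉ confSet μ α σ X arm t ω} ≤
      ∑ t ∈ Finset.Icc 1 T, 2 * K * (t : ℝ) ^ (1 - α) - (2 * K - 1) := by
  obtain ⟨T, rfl⟩ : ∃ n, T = n + 2 := ⟨T - 2, by omega⟩
  -- Before the first pull the confidence set is unconstrained, so it contains `θs`.
  have h0 : P.real {ω | arm 0 ω = k ∧ θs ∉ confSet μ α σ X arm 0 ω} = 0 := by
    have : {ω | arm 0 ω = k ∧ θs ∉ confSet μ α σ X arm 0 ω} = ∅ := by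
      refine Set.eq_empty_of_forall_notMem fun ω hω => hω.2 fun l hl => ?_
      rw [pulls_zero] at hl
      exact absurd hl (lt_irrefl 0)
    rw [this, measureReal_empty]
  have h1 : P.real {ω | arm 1 ω = k ∧ θs ∉ confSet μ α σ X arm 1 ω} ≤ 1 := measureReal_le_one
  have h2 : ∀ t ∈ Finset.range T,
      P.real {ω | arm (t + 1 + 1) ω = k ∧ θs ∉ confSet μ α σ X arm (t + 1 + 1) ω} ≤
        2 * K * ((t + 2 : ℕ) : ℝ) ^ (1 - α) := fun t _ =>
    (measureReal_mono (fun ω hω => hω.2) (measure_ne_top _ _)).trans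
      (measure_not_mem_confSet_le hX hσ hα arm (Nat.succ_pos _))
  have h3 : ∑ t ∈ Finset.Icc 1 (T + 2), 2 * K * (t : ℝ) ^ (1 - α) =
      2 * K + ∑ t ∈ Finset.range (T + 1), 2 * K * ((t + 2 : ℕ) : ℝ) ^ (1 - α) := by
    have : Finset.Icc 1 (T + 2) = Finset.Ico (0 + 1) (T + 2 + 1) := rfl
    rw [this, ← Finset.sum_Ico_add' (fun t : ℕ => 2 * K * (t : ℝ) ^ (1 - α)) 0 (T + 2) 1,
      ← Finset.range_eq_Ico, Finset.sum_range_succ']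
    rw [zero_add, Nat.cast_one, Real.one_rpow, mul_one, add_comm]
  rw [Finset.sum_range_succ', Finset.sum_range_succ', h0, h3, Finset.sum_range_succ]
  have h4 := Finset.sum_le_sum h2
  have h5 : 0 ≤ 2 * K * ((T + 2 : ℕ) : ℝ) ^ (1 - α) := by positivity
  simp only [zero_add]
  linarith

lemma sum_windows {t : ℕ → ℕ} (ht : Monotone t) (g : ℕ → ℝ) (I : ℕ) :
    ∑ i ∈ Finset.Icc 1 I, ∑ s ∈ Finset.Ico (t (i - 1)) (t i), g s =
      ∑ s ∈ Finset.Ico (t 0) (t I), g s := by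
  induction I with
  | zero => simp
  | succ I ih =>
    rw [Finset.sum_Icc_succ_top (by omega), ih, Nat.add_sub_cancel,
      Finset.sum_Ico_consecutive _ (ht (Nat.zero_le _)) (ht (Nat.le_succ _))]

/-- Wrong confidence sets leave `2 K - 1` of the second sum unspent. This and `K τ` pay for the
blocks; the failures inside the windows, multiplied by the block weights, go to the last sum. -/
theorem IsTSC.integral_pulls_le_of_two_le (harm : IsTSC P μ α β σ X G arm)
    (hX : IsRewardTable P X (fun k => μ k θs) σ) (hks : ∀ l, l ≠ ks → μ l θs < μ ks θs)
    (hσ : 0 < σ) (hα : 2 ≤ α) (hβ : 1 ≤ β) {τ : ℕ} (hτ : 2 ≤ τ) (hkks : k ≠ ks) (hD : 0 < D)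
    (hDτ : D ^ 2 * τ = 27 * (K * α * σ ^ 2 * Real.log τ)) (hgap : D ≤ gapMin μ θs ks)
    (hdeg : ENNReal.ofReal D ≤ degree μ θs ks k) {T : ℕ} (hT : 2 ≤ T) :
    ∫ ω, (pulls arm k T ω : ℝ) ∂P ≤ K * τ + ∑ t ∈ Finset.Icc 1 T, 2 * K * (t : ℝ) ^ (1 - α)
      + (K : ℝ) ^ 3 * ∑ t ∈ Finset.Icc (K * τ) T, 4 * ((t : ℝ) / K) ^ (2 - α) := by
  have hK := two_le_of_ne hkks
  have hK' : (2 : ℝ) ≤ K := by exact_mod_cast hK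
  have hτ' : (2 : ℝ) ≤ τ := by exact_mod_cast hτ
  have hα0 : 0 < α := by linarith
  have hβ0 : 0 < β := by linarith
  have hL : 0 < Real.log τ := Real.log_pos (by linarith)
  set t : ℕ → ℕ := fun i => 2 ^ i * (4 * K ^ 2 * τ ^ 2) with ht
  have htmono : Monotone t := fun i j hij =>
    Nat.mul_le_mul_right _ (Nat.pow_le_pow_right (by norm_num) hij)
  have htcast : ∀ i, (t i : ℝ) = 2 ^ i * (4 * K ^ 2 * τ ^ 2) := fun i => by
    simp only [ht]; push_cast; ring
  set J : ℕ → ℝ := fun i => 8 * α * σ ^ 2 * Real.log (t i) / D ^ 2 with hJdef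
  have hJ : ∀ i, D ^ 2 * J i = 8 * α * σ ^ 2 * Real.log (t i) := fun i => by
    simp only [hJdef]; field_simp
  have ht16 : ∀ i, (1 : ℝ) < t i := by
    intro i
    have h1 : 1 < t 0 := by simp only [ht]; nlinarith [Nat.mul_le_mul hK hτ]
    exact_mod_cast h1.trans_le (htmono (Nat.zero_le i))
  have hJ0 : ∀ i, 0 < J i := by
    intro i
    have := Real.log_pos (ht16 i)
    simp only [hJdef]
    positivity
  have hJK : ∀ i : ℕ, K * Real.log τ * J i =
      8 / 27 * τ * (Real.log (4 * K ^ 2 * τ ^ 2) + i * Real.log 2) := by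
    intro i
    have hlog : Real.log (t i) = Real.log (4 * K ^ 2 * τ ^ 2) + i * Real.log 2 := by
      rw [htcast, Real.log_mul (by positivity) (by positivity), Real.log_pow, add_comm]
    rw [← hlog]
    have h1 := hJ i
    refine mul_left_cancel₀ (show D ^ 2 ≠ 0 by positivity) ?_
    calc D ^ 2 * (K * Real.log τ * J i) = K * Real.log τ * (D ^ 2 * J i) := by ring
      _ = 8 / 27 * Real.log (t i) * (27 * (K * α * σ ^ 2 * Real.log τ)) := by rw [h1]; ring
      _ = D ^ 2 * (8 / 27 * τ * Real.log (t i)) := by rw [← hDτ]; ring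
  -- the total miss cost
  have htotal : ∀ T, ∑ s ∈ Finset.range T, roundMissCost P β σ (μ ks θs - D / 2) X arm ks s ≤
      ENNReal.ofReal (τ / 2) := fun T =>
    (sum_roundMissCost_le harm.measurable hX.measurable ks T).trans
      (hX.sum_lintegral_missCost_le hσ ks hK hα hβ hτ hD hDτ T)
  have hfin : ∀ s, roundMissCost P β σ (μ ks θs - D / 2) X arm ks s ≠ ⊤ := by
    intro s
    refine ne_top_of_le_ne_top ENNReal.ofReal_ne_top (le_trans ?_ (htotal (s + 1)))
    exact Finset.single_le_sum (f := roundMissCost P β σ (μ ks θs - D / 2) X arm ks)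
      (fun _ _ => zero_le) (Finset.self_mem_range_succ s)
  have hH : ∀ T, ∑ s ∈ Finset.range T,
      (roundMissCost P β σ (μ ks θs - D / 2) X arm ks s).toReal ≤ τ / 2 := by
    intro T
    rw [← ENNReal.toReal_sum fun s _ => hfin s]
    exact ENNReal.toReal_le_of_le_ofReal (by positivity) (htotal T)
  -- the blocks
  obtain ⟨I, hI, hIlt⟩ : ∃ I, T ≤ t (I + 1) ∧ ∀ i ∈ Finset.Icc 1 I, t i < T := by
    classical
    have hex : ∃ n, T ≤ t (n + 1) := by
      refine ⟨T, ?_⟩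
      have h1 := (Nat.lt_two_pow_self (n := T + 1)).le
      have h2 : 0 < 4 * K ^ 2 * τ ^ 2 := by positivity
      simp only [ht]
      nlinarith
    refine ⟨Nat.find hex, Nat.find_spec hex, fun i hi => ?_⟩
    have hi' := Finset.mem_Icc.1 hi
    have := Nat.find_min hex (m := i - 1) (by omega)
    rw [Nat.sub_add_cancel hi'.1] at this
    omega
  set q : ℕ → ℝ := fun i => 2 * K ^ 2 * τ ^ 2 * 2 ^ i - J (i + 1)
    - (K - 1) * (chargeFactor K * J (i + 1) + 1) with hq
  obtain ⟨hq0, hW0, hWle, hbudget⟩ := block_budget hK hτ hJ0 hJK (q := q) fun i => rfl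
  have hgood := harm.sum_blocks_le (θs := θs) hX.measurable hks hkks hα0.le hβ0 hσ hD hgap hdeg
    htmono hJ hJ0 hfin hH I
  -- For the block that starts at `t i`, the window is the preceding one `[t (i - 1), t i)`;
  -- successive windows are disjoint.
  have hpaid : ∀ i ∈ Finset.Icc 1 I,
      (2 * chargeFactor K * J (i + 1) + 1 - chargeFactor K * J 1) *
        P.real {ω | (pulls arm ks (t i) ω : ℝ) < J (i + 1)} ≤
      (2 * chargeFactor K * J (i + 1) + 1 - chargeFactor K * J 1) *
        ((K - 1) * (chargeFactor K * J (i + 1) + τ / 2) / q i) +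
      ∑ s ∈ Finset.Ico (t (i - 1)) (t i), (K : ℝ) ^ 3 * (4 * ((s : ℝ) / K) ^ (2 - α)) := by
    intro i hi
    have hi1 := (Finset.mem_Icc.1 hi).1
    obtain ⟨j, rfl⟩ : ∃ j, i = j + 1 := ⟨i - 1, by omega⟩
    rw [Nat.add_sub_cancel]
    have hqe : (t (j + 1) : ℝ) - t j - J (j + 1 + 1)
        - (K - 1) * (chargeFactor K * J (j + 1 + 1) + 1) = q (j + 1) := by
      rw [htcast, htcast]; simp only [hq]; ring
    have htj : 0 < t j := by
      have := ht16 j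
      have : (0 : ℝ) < t j := by linarith
      exact_mod_cast this
    have hHw : ∑ s ∈ Finset.Ico (t j) (t (j + 1)),
        (roundMissCost P β σ (μ ks θs - D / 2) X arm ks s).toReal ≤ τ / 2 := by
      refine le_trans ?_ (hH (t (j + 1)))
      refine Finset.sum_le_sum_of_subset_of_nonneg (fun s hs => ?_)
        fun _ _ _ => ENNReal.toReal_nonneg
      exact Finset.mem_range.2 (Finset.mem_Ico.1 hs).2
    have hu := harm.measure_pulls_best_lt_le (θs := θs) (J := J (j + 1 + 1)) hX hks (by omega) hα0
      hβ0 hσ hD hgap (hJ _) (hJ0 _) (htmono (Nat.le_succ j)) htj (htmono (Nat.le_succ (j + 1)))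
      hfin hHw (by rw [hqe]; exact hq0 _ hi1)
    rw [hqe] at hu
    refine (mul_le_mul_of_nonneg_left hu (hW0 _ hi1)).trans ?_
    rw [mul_add, add_comm]
    refine add_le_add le_rfl ?_
    rw [Finset.mul_sum]
    refine Finset.sum_le_sum fun s hs => ?_
    have hs1 := (Finset.mem_Ico.1 hs).1
    have hs0 : (0 : ℝ) < s := by exact_mod_cast htj.trans_le hs1
    -- Every `s` in the window is at least `t j`, so the weight is at most `2 K² s`. Its product
    -- with `2 K s^(1-α)` is at most `4 K³ s^(2-α)`, and `(s/K)^(2-α)` is larger still because `α ≥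
    -- 2`.
    have hsle : 2 * K ^ 2 * τ ^ 2 * 2 ^ (j + 1) ≤ (s : ℝ) := by
      have : (t j : ℝ) ≤ s := by exact_mod_cast hs1
      rw [htcast] at this
      rw [pow_succ (2 : ℝ) j]
      linarith
    have hWs : 2 * chargeFactor K * J (j + 1 + 1) + 1 - chargeFactor K * J 1 ≤ 2 * K ^ 2 * s :=
      (hWle _ hi1).trans (by gcongr)
    have hKpos : (0 : ℝ) < K := by linarith
    have e1 : ((s : ℝ) / K) ^ (2 - α) = s * (s : ℝ) ^ (1 - α) / (K : ℝ) ^ (2 - α) := by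
      rw [Real.div_rpow hs0.le hKpos.le, show (2 : ℝ) - α = 1 + (1 - α) by ring,
        Real.rpow_add hs0, Real.rpow_one]
    have e2 : (K : ℝ) ^ (2 - α) ≤ 1 :=
      Real.rpow_le_one_of_one_le_of_nonpos (by linarith) (by linarith)
    have hKα : 0 < (K : ℝ) ^ (2 - α) := by positivity
    rw [e1]
    calc (2 * chargeFactor K * J (j + 1 + 1) + 1 - chargeFactor K * J 1) *
          (2 * K * (s : ℝ) ^ (1 - α)) ≤ 2 * K ^ 2 * s * (2 * K * (s : ℝ) ^ (1 - α)) := by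
          gcongr
      _ = (K : ℝ) ^ 3 * (4 * (s * (s : ℝ) ^ (1 - α) / 1)) := by ring
      _ ≤ _ := by gcongr
  have hwin : ∑ i ∈ Finset.Icc 1 I,
      ∑ s ∈ Finset.Ico (t (i - 1)) (t i), (K : ℝ) ^ 3 * (4 * ((s : ℝ) / K) ^ (2 - α)) ≤
      (K : ℝ) ^ 3 * ∑ t ∈ Finset.Icc (K * τ) T, 4 * ((t : ℝ) / K) ^ (2 - α) := by
    rw [sum_windows htmono, Finset.mul_sum]
    refine Finset.sum_le_sum_of_subset_of_nonneg (fun s hs => ?_) fun _ _ _ => by positivity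
    obtain ⟨h1, h2⟩ := Finset.mem_Ico.1 hs
    refine Finset.mem_Icc.2 ⟨le_trans ?_ h1, ?_⟩
    · simp only [ht]
      have h3 : 1 ≤ K * τ := Nat.mul_pos (by omega) (by omega)
      have h4 : K * τ * 1 ≤ K * τ * (K * τ) := Nat.mul_le_mul_left _ h3
      nlinarith
    · rcases Nat.eq_zero_or_pos I with hI0 | hI0
      · rw [hI0] at h2; omega
      · exact (h2.trans (hIlt I (Finset.mem_Icc.2 ⟨hI0, le_rfl⟩))).le
  have hsplit : ∫ ω, (pulls arm k T ω : ℝ) ∂P ≤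
      ∑ s ∈ Finset.range T, P.real {ω | arm s ω = k ∧ θs ∉ confSet μ α σ X arm s ω} +
      ∑ s ∈ Finset.range (t (I + 1)),
        P.real {ω | arm s ω = k ∧ θs ∈ confSet μ α σ X arm s ω} := by
    rw [integral_pulls harm.measurable]
    have h1 : ∑ s ∈ Finset.range T, P.real {ω | arm s ω = k ∧ θs ∈ confSet μ α σ X arm s ω} ≤
        ∑ s ∈ Finset.range (t (I + 1)),
          P.real {ω | arm s ω = k ∧ θs ∈ confSet μ α σ X arm s ω} :=
      Finset.sum_le_sum_of_subset_of_nonneg (Finset.range_mono hI) fun _ _ _ => measureReal_nonneg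
    refine le_trans ?_ (add_le_add le_rfl h1)
    rw [← Finset.sum_add_distrib]
    refine Finset.sum_le_sum fun s _ => ?_
    refine (measureReal_mono (fun ω hω => ?_) (measure_ne_top _ _)).trans
      (measureReal_union_le _ _)
    by_cases hg : θs ∈ confSet μ α σ X arm s ω
    · exact Or.inr ⟨hω, hg⟩
    · exact Or.inl ⟨hω, hg⟩
  have hbad := sum_measure_not_mem_le (arm := arm) (k := k) hX hσ hα0 hT
  have hsum := Finset.sum_le_sum hpaid
  rw [Finset.sum_add_distrib] at hsum
  have := hbudget I
  linarith

theorem IsTSC.integral_pulls_le (harm : IsTSC P μ α β σ X G arm)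
    (hX : IsRewardTable P X (fun k => μ k θs) σ) (hks : ∀ l, l ≠ ks → μ l θs < μ ks θs)
    (hσ : 0 < σ) (hα : 0 < α) (hβ : 1 ≤ β) {τ : ℕ} (hτ : 2 ≤ τ) (hkks : k ≠ ks)
    (hgap : 3 * √(3 * (K * α * σ ^ 2 * Real.log τ / τ)) ≤ gapMin μ θs ks)
    (hdeg : ENNReal.ofReal (3 * √(3 * (K * α * σ ^ 2 * Real.log τ / τ))) ≤ degree μ θs ks k)
    (T : ℕ) : ∫ ω, (pulls arm k T ω : ℝ) ∂P ≤ tsBound K α β τ T := by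
  have hK := two_le_of_ne hkks
  have hK' : (2 : ℝ) ≤ K := by exact_mod_cast hK
  have hτ' : (2 : ℝ) ≤ τ := by exact_mod_cast hτ
  have hL : 0 < Real.log τ := Real.log_pos (by linarith)
  have hlast : 0 ≤ (K : ℝ) ^ 2 * ∑ t ∈ Finset.Icc (K * τ) T, ((t : ℝ) / K) ^ (1 - 2 * β) := by
    positivity
  have hmid : 0 ≤ ∑ t ∈ Finset.Icc 1 T, 2 * K * (t : ℝ) ^ (1 - α) := by positivity
  have hpow : 0 ≤ (K : ℝ) ^ 3 * ∑ t ∈ Finset.Icc (K * τ) T, 4 * ((t : ℝ) / K) ^ (2 - α) := by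
    positivity
  have htriv : ∫ ω, (pulls arm k T ω : ℝ) ∂P ≤ T := by
    rw [integral_pulls harm.measurable]
    refine (Finset.sum_le_card_nsmul _ _ 1 fun t _ => measureReal_le_one).trans_eq ?_
    simp
  unfold tsBound
  rcases le_or_gt T (K * τ) with hT | hT
  · have : (T : ℝ) ≤ K * τ := by exact_mod_cast hT
    linarith
  -- For `α < 2` the terms of the third sum are at least 1, and they number more than `T - K τ`.
  rcases lt_or_ge α 2 with h2 | h2
  · have h1 : (T : ℝ) - K * τ ≤
        (K : ℝ) ^ 3 * ∑ t ∈ Finset.Icc (K * τ) T, 4 * ((t : ℝ) / K) ^ (2 - α) := by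
      have h3 : ∑ _t ∈ Finset.Icc (K * τ) T, (1 : ℝ) ≤
          ∑ t ∈ Finset.Icc (K * τ) T, 4 * ((t : ℝ) / K) ^ (2 - α) := by
        refine Finset.sum_le_sum fun t ht => ?_
        have := one_le_div_rpow (p := 2 - α) (by omega) (by omega) (Finset.mem_Icc.1 ht).1
          (by linarith)
        linarith
      rw [Finset.sum_const, Nat.card_Icc, nsmul_eq_mul, mul_one,
        Nat.cast_sub (by omega)] at h3
      push_cast at h3
      have h4 : (1 : ℝ) ≤ (K : ℝ) ^ 3 := one_le_pow₀ (by linarith)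
      have h5 : 0 ≤ ∑ t ∈ Finset.Icc (K * τ) T, 4 * ((t : ℝ) / K) ^ (2 - α) := by positivity
      nlinarith
    linarith
  · have hD : 0 < 3 * √(3 * (K * α * σ ^ 2 * Real.log τ / τ)) := by positivity
    have hDτ : (3 * √(3 * (K * α * σ ^ 2 * Real.log τ / τ))) ^ 2 * τ =
        27 * (K * α * σ ^ 2 * Real.log τ) := by
      rw [mul_pow, Real.sq_sqrt (by positivity)]
      field_simp
      norm_num
    have hT2 : 2 ≤ T := by nlinarith
    have := harm.integral_pulls_le_of_two_le hX hks hσ h2 hβ hτ hkks hD hDτ hgap hdeg hT2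
    linarith

end TSBound

end StructuredBandit

/-! ### Both algorithms together -/

theorem theorem2 {Θ Ω : Type*} [MeasurableSpace Ω] (P : MeasureTheory.Measure Ω)
    [MeasureTheory.IsProbabilityMeasure P] {K : ℕ}
    (μ : Fin K → Θ → ℝ) (θs : Θ) (ks : Fin K) (hks : ∀ l, l ≠ ks → μ l θs < μ ks θs)
    (σ : ℝ) (hσ : 0 < σ) (X : Fin K → ℕ → Ω → ℝ)
    (hX : StructuredBandit.IsRewardTable P X (fun k => μ k θs) σ)
    (k : Fin K) (hk : StructuredBandit.NonCompetitive μ θs ks k) (α : ℝ) (hα : 0 < α) :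
    (∀ arm : ℕ → Ω → Fin K, StructuredBandit.IsUCBC μ α σ X arm →
      (∀ T : ℕ, ∫ ω, (StructuredBandit.pulls arm k T ω : ℝ) ∂P ≤
        StructuredBandit.ucbBound K α (StructuredBandit.tZero μ θs ks k α σ) T) ∧
      (3 < α →
        (fun T : ℕ => StructuredBandit.ucbBound K α (StructuredBandit.tZero μ θs ks k α σ) T)
          =O[atTop] (fun _ => (1 : ℝ)) ∧
        (fun T : ℕ => ∫ ω, (StructuredBandit.pulls arm k T ω : ℝ) ∂P)
          =O[atTop] (fun _ => (1 : ℝ)))) ∧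
    (∀ β : ℝ, 1 < β → ∀ (G : ℕ → Fin K → Ω → ℝ) (arm : ℕ → Ω → Fin K),
      StructuredBandit.IsTSC P μ α β σ X G arm →
      (∀ T : ℕ, ∫ ω, (StructuredBandit.pulls arm k T ω : ℝ) ∂P ≤
        StructuredBandit.tsBound K α β (StructuredBandit.tB μ θs ks k α β σ) T) ∧
      (3 < α →
        (fun T : ℕ => StructuredBandit.tsBound K α β (StructuredBandit.tB μ θs ks k α β σ) T)
          =O[atTop] (fun _ => (1 : ℝ)) ∧
        (fun T : ℕ => ∫ ω, (StructuredBandit.pulls arm k T ω : ℝ) ∂P)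
          =O[atTop] (fun _ => (1 : ℝ)))) := by
  have hkks := hk.ne hks
  refine ⟨fun arm harm => ?_, fun β hβ G arm harm => ?_⟩
  · obtain ⟨h2, hgap, hdeg⟩ := StructuredBandit.tZero_spec (α := α) (σ := σ) hks hk
    have hT := fun T => harm.integral_pulls_le hX hks hσ hα h2 hkks hgap hdeg T
    refine ⟨hT, fun h3 => ?_⟩
    obtain ⟨C, hC⟩ := StructuredBandit.exists_ucbBound_le K h3
      (StructuredBandit.tZero μ θs ks k α σ)
    exact ⟨StructuredBandit.isBigO_one_of_le (fun T => StructuredBandit.ucbBound_nonneg _ _ _ T) hC,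
      StructuredBandit.isBigO_one_of_le (fun T => integral_nonneg fun ω => Nat.cast_nonneg _)
        fun T => (hT T).trans (hC T)⟩
  · obtain ⟨h2, hgap, hdeg⟩ := StructuredBandit.tB_spec (α := α) (σ := σ) (β := β) hks hk
      (by linarith) hσ
    have hT := fun T => harm.integral_pulls_le hX hks hσ hα hβ.le h2 hkks hgap hdeg T
    refine ⟨hT, fun h3 => ?_⟩
    obtain ⟨C, hC⟩ := StructuredBandit.exists_tsBound_le K h3 hβ
      (StructuredBandit.tB μ θs ks k α β σ)
    exact ⟨StructuredBandit.isBigO_one_of_le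
        (fun T => StructuredBandit.tsBound_nonneg _ _ _ _ T) hC,
      StructuredBandit.isBigO_one_of_le (fun T => integral_nonneg fun ω => Nat.cast_nonneg _)
        fun T => (hT T).trans (hC T)⟩
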